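/- Let $F\in\mathbb{C}(z)$ be a rational function which, viewed as a map $\mathbb{CP}^1\to\mathbb{CP}^1$, has exactly two poles (the point $\infty$ is allowed to be a pole), and suppose that the orders of these two poles are different. A rational function $A$ is indecomposable if $A=A_1\circ A_2$ with rational $A_1,A_2$ implies that $A_1$ or $A_2$ has degree one. A maximal decomposition of $F$ is a representation $F=U_1\circ U_2\circ\dots\circ U_k$ in which all $U_i$ are indecomposable rational functions of degree greater than one. Two decompositions $F=U_1\circ\dots\circ U_k=V_1\circ\dots\circ V_m$ are equivalent if $k=m$ and there are rational functions $\mu_1,\dots,\mu_{k-1}$ of degree one such that, with $\mu_0=\mu_k=z$, one has $U_i=\mu_{i-1}^{-1}\circ V_i\circ\mu_i$ for $1\le i\le k$. Two maximal decompositions $\mathcal D,\mathcal E$ of $F$ are weakly equivalent if there are maximal decompositions $\mathcal F_1,\dots,\mathcal F_s$ of $F$ such that $\mathcal F_1=\mathcal D$, $\mathcal F_s$ is equivalent to $\mathcal E$, and each $\mathcal F_{j+1}$ is obtained from $\mathcal F_j$ by replacing two successive functions by functions with the same composition. The monodromy group of a non-constant rational function $A$ is the group of permutations of the fibre $A^{-1}(w)$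 over a non-critical value $w$ that are induced by lifting loops based at $w$ in the complement of the critical values of $A$ in $\mathbb{CP}^1$; up to permutation equivalence it does not depend on $w$. Permutation groups $G\le\mathrm{Sym}(\Omega)$ and $G'\le\mathrm{Sym}(\Omega')$ are permutation equivalent if some bijection $\Omega\to\Omega'$ carries $G$ onto $G'$. Then any two maximal decompositions of $F$ are weakly equivalent. Furthermore, for any two maximal decompositions $$F=U_1\circ U_2\circ\dots\circ U_k,\qquad F=V_1\circ V_2\circ\dots\circ V_m$$ one has $k=m$, and there exists a permutation $\sigma\in S_k$ such that the monodromy groups of $U_i$ and $V_{\sigma(i)}$ are permutation equivalent for all $1\le i\le k$. -/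

import Mathlib

noncomputable section

open Polynomial OnePoint

namespace RatDecomp

/-! ### Rational functions: degree, superposition, the induced map of the Riemann sphere -/

/-- The degree of a complex rational function written in lowest terms. -/
def degree (F : RatFunc ℂ) : ℕ := max F.num.natDegree F.denom.natDegree

/-- The superposition `A(B(z))`, obtained by substituting `B` for the variable of `A`. (This is
the superposition whenever `B` is not constant; for constant `B` the result is a constant.) -/
def comp (A B : RatFunc ℂ) : RatFunc ℂ := RatFunc.eval RatFunc.C B A

/-- The Riemann sphere. -/
abbrev Sphere : Type := OnePoint ℂ

/-- The self-map of the Riemann sphere given by a rational function. -/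
def toSphere (F : RatFunc ℂ) : Sphere → Sphere := fun p =>
  OnePoint.elim p
    (if F.denom.natDegree < F.num.natDegree then ∞
      else ((F.num.coeff F.denom.natDegree / F.denom.leadingCoeff : ℂ) : Sphere))
    (fun z : ℂ => if F.denom.eval z = 0 then ∞
      else ((F.num.eval z / F.denom.eval z : ℂ) : Sphere))

/-- The set of poles of `F` on the Riemann sphere (the point at infinity is allowed). -/
def poles (F : RatFunc ℂ) : Set Sphere := {p | toSphere F p = ∞}

/-- The order of the pole of `F` at a point of the sphere (zero if the point is not a pole). -/
def poleOrder (F : RatFunc ℂ) : Sphere → ℕ := fun p =>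
  OnePoint.elim p (F.num.natDegree - F.denom.natDegree)
    (fun z : ℂ => F.denom.rootMultiplicity z)

/-! ### Decompositions -/

/-- `F` is indecomposable: in every `F = A ∘ B` one of the factors has degree one. -/
def Indecomposable (F : RatFunc ℂ) : Prop :=
  ∀ A B : RatFunc ℂ, F = comp A B → degree A = 1 ∨ degree B = 1

/-- The superposition `U₁ ∘ U₂ ∘ ⋯ ∘ U_k` of a list `[U₁, U₂, …, U_k]`. -/
def compList (U : List (RatFunc ℂ)) : RatFunc ℂ := U.foldr comp RatFunc.X

/-- `[U₁, …, U_k]` is a maximal decomposition of `F`: `F = U₁ ∘ ⋯ ∘ U_k` and all `U_i` are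
indecomposable of degree greater than one. -/
def IsMaximalDecomposition (F : RatFunc ℂ) (U : List (RatFunc ℂ)) : Prop :=
  compList U = F ∧ ∀ A ∈ U, Indecomposable A ∧ 1 < degree A

/-- Equivalence of decompositions of the same length `k`: there are functions
`μ₁, …, μ_{k-1}` of degree one with `U₁ = V₁ ∘ μ₁`, `U_i = μ_{i-1}⁻¹ ∘ V_i ∘ μ_i` for `1 < i < k`,
`U_k = μ_{k-1}⁻¹ ∘ V_k`. Here `μ₀ = μ_k = z`, and the inverses are moved to the other side. -/
def DecompEquiv (U V : List (RatFunc ℂ)) : Prop :=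
  ∃ hlen : U.length = V.length, ∃ μ : ℕ → RatFunc ℂ,
    μ 0 = RatFunc.X ∧ μ U.length = RatFunc.X ∧ (∀ i, degree (μ i) = 1) ∧
    ∀ (i : ℕ) (hi : i < U.length),
      comp (μ i) U[i] = comp (V[i]'(hlen ▸ hi)) (μ (i + 1))

/-- `V` is obtained from `U` by replacing two successive functions by functions with the same
composition, `U` and `V` both being maximal decompositions of `F`. -/
def Step (F : RatFunc ℂ) (U V : List (RatFunc ℂ)) : Prop :=
  IsMaximalDecomposition F U ∧ IsMaximalDecomposition F V ∧
  ∃ (L R : List (RatFunc ℂ)) (A B C D : RatFunc ℂ),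
    U = L ++ A :: B :: R ∧ V = L ++ C :: D :: R ∧ comp A B = comp C D

/-- Weak equivalence of maximal decompositions of `F`: a finite (possibly empty) chain of steps
leads from `U` to a maximal decomposition equivalent to `V`. -/
def WeaklyEquivalent (F : RatFunc ℂ) (U V : List (RatFunc ℂ)) : Prop :=
  ∃ W, Relation.ReflTransGen (Step F) U W ∧ DecompEquiv W V

/-! ### Monodromy groups -/

/-- The fibre of `F : ℂℙ¹ → ℂℙ¹` over `w`. -/
abbrev Fiber (F : RatFunc ℂ) (w : Sphere) : Type := {p : Sphere // toSphere F p = w}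

/-- The non-critical values of a non-constant `F`: the values with `deg F` distinct preimages. -/
def regularValues (F : RatFunc ℂ) : Set Sphere :=
  {w | (toSphere F ⁻¹' {w}).ncard = degree F}

/-- The monodromy group of `F` at `w`: all permutations of the fibre over `w` which are induced
by lifting a loop based at `w` that runs through non-critical values only. -/
def monodromyGroup (F : RatFunc ℂ) (w : Sphere) (hw : w ∈ regularValues F) :
    Subgroup (Equiv.Perm (Fiber F w)) where
  carrier := {g | ∃ γ : Path w w, (∀ t, γ t ∈ regularValues F) ∧
    ∀ e : Fiber F w, ∃ Γ : Path e.1 (g e).1, ∀ t, toSphere F (Γ t) = γ t}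
  one_mem' := ⟨Path.refl w, fun _ => hw, fun e => ⟨Path.refl e.1, fun _ => e.2⟩⟩
  mul_mem' := by
    rintro g₁ g₂ ⟨γ₁, h₁, l₁⟩ ⟨γ₂, h₂, l₂⟩
    refine ⟨γ₂.trans γ₁, fun t => ?_, fun e => ?_⟩
    · rw [Path.trans_apply]
      split_ifs
      · exact h₂ _
      · exact h₁ _
    · obtain ⟨Γ₂, k₂⟩ := l₂ e
      obtain ⟨Γ₁, k₁⟩ := l₁ (g₂ e)
      have hg : ((g₁ * g₂) e).1 = (g₁ (g₂ e)).1 := rfl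
      refine ⟨(Γ₂.trans Γ₁).cast rfl hg, fun t => ?_⟩
      rw [Path.cast_coe]
      rw [Path.trans_apply, Path.trans_apply]
      split_ifs
      · exact k₂ _
      · exact k₁ _
  inv_mem' := by
    rintro g ⟨γ, h, l⟩
    refine ⟨γ.symm, fun t => h _, fun e => ?_⟩
    obtain ⟨Γ, k⟩ := l (g⁻¹ e)
    refine ⟨(Γ.cast rfl (by simp)).symm, fun t => k _⟩

/-- Permutation equivalence of `G ≤ Sym(Ω)` and `G' ≤ Sym(Ω')`: some bijection `Ω ≃ Ω'` carries
`G` onto `G'`. -/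
def PermEquivalent {Ω Ω' : Type*} (G : Subgroup (Equiv.Perm Ω)) (G' : Subgroup (Equiv.Perm Ω')) :
    Prop :=
  ∃ e : Ω ≃ Ω', G.map e.permCongrHom.toMonoidHom = G'

/-- The monodromy groups of `F` and `F'` are permutation equivalent, for every choice of
non-critical base points. -/
def MonodromyEquivalent (F F' : RatFunc ℂ) : Prop :=
  ∀ (w w' : Sphere) (hw : w ∈ regularValues F) (hw' : w' ∈ regularValues F'),
    PermEquivalent (monodromyGroup F w hw) (monodromyGroup F' w' hw')

end RatDecomp

end

/-! Let `G` be the Galois group of the normal closure of `ℂ(z)` over `ℂ(F)`, and `H` the stabiliser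
of `z`. By Lüroth's theorem, decompositions of `F` correspond, up to functions of degree one, to
chains of subgroups from `H` to `G`, and maximal decompositions to maximal chains. The theorem is a
Jordan–Hölder theorem for these chains.

The exchange step needs any two overgroups `A`, `B` of `H` to permute, `AB = BA`. Then, if `H` is
maximal in both `A` and `B` and `A ≠ B`, the modular law makes `A` and `B` maximal in `AB`, and the
two right-hand factors can be exchanged in one step. The induction is `reflTransGen_step_and_perm`.
The chain of steps reaches the second decomposition itself, since functions of degree one are
absorbed by a step.

The poles provide the permutability. Put `1/F = s^(pq)`, where `p ≠ q` are the pole orders, and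
solve for `z` in power series in `s` near each pole. The substitution `s ↦ ζ s`, with `ζ` a
primitive root of unity of order `pq`, induces an element `h` of `G` with two orbits on the fibre,
of lengths `p` and `q` (`isGood_of_two_poles`). On the cosets of a larger subgroup these orbits
either merge or stay apart with different lengths, and counting indices gives
`IsGood.exists_mul_eq_mul`.

For the monodromy groups, the actions of `AB` on `AB/A` and of `B` on `B/H` have to agree. There is
a `B`-equivariant bijection `B/H → AB/A`, and the groups induced coincide because `AB = B · core(A)`
(`IsGood.exists_mul_normalCore`).

It remains to identify the topological monodromy group with the Galois action
(`GaloisFrame.permEquivalent_permRep`). The tuples of solutions over `t` that satisfy all algebraic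
relations form one orbit of the Galois group, and continuation along paths preserves relations.
Conversely, an expression invariant under the subgroup realised by loops is single-valued and of
polynomial growth, hence rational in the parameter; so that subgroup is everything
(`RelationIdeal.continues_smul`). -/

noncomputable section

namespace RatDecomp

/-! ### Subgroups over which a cyclic group has few orbits. -/

section GroupTheory

variable {G : Type*} [Group G]

/-- Some cyclic subgroup acts transitively on the left cosets of `H`. -/
def HasCycle (H : Subgroup G) : Prop := ∃ h : G, ∀ g : G, ∃ i : ℤ, h ^ i * g ∈ H

/-- `⟨h⟩` has the two orbits of `H` and `t H` on the left cosets of `H`. -/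
structure IsBicyclic (H : Subgroup G) (h t : G) : Prop where
  not_mem : ∀ i : ℤ, h ^ i * t ∉ H
  cover : ∀ g : G, (∃ i : ℤ, h ^ i * g ∈ H) ∨ ∃ i : ℤ, t⁻¹ * h ^ i * g ∈ H
  ne : ∃ i : ℤ, ¬ (h ^ i ∈ H ↔ t⁻¹ * h ^ i * t ∈ H)

/-- Some cyclic subgroup has at most two orbits on the left cosets of `H`; if there are two, their
lengths are different. -/
def IsGood (H : Subgroup G) : Prop := HasCycle H ∨ ∃ h t, IsBicyclic H h t

theorem conj_zpow' (h t : G) (i : ℤ) : t⁻¹ * h ^ i * t = (t⁻¹ * h * t) ^ i := by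
  have := conj_zpow (i := i) (a := t⁻¹) (b := h)
  simpa using this.symm

/-- The quotient of `⟨h⟩` by `A ∩ ⟨h⟩` is cyclic, generated by the class of `h`, and its order is
the relative index. All later arguments on orbit lengths become divisibility arguments through this
equivalence. -/
theorem zpow_mem_iff_relIndex_dvd [Finite G] (A : Subgroup G) (h : G) (i : ℤ) :
    h ^ i ∈ A ↔ (A.relIndex (Subgroup.zpowers h) : ℤ) ∣ i := by
  set Z := Subgroup.zpowers h
  let z : Z := ⟨h, Subgroup.mem_zpowers h⟩
  have hz : ∀ x : Z, x ∈ Subgroup.zpowers z := by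
    rintro ⟨x, j, rfl⟩
    exact ⟨j, Subtype.ext (by simp [z])⟩
  have key : orderOf (QuotientGroup.mk z : Z ⧸ A.subgroupOf Z) = A.relIndex Z := by
    rw [orderOf_eq_card_of_forall_mem_zpowers]
    · rfl
    · intro x
      obtain ⟨y, rfl⟩ := QuotientGroup.mk_surjective x
      obtain ⟨j, rfl⟩ := hz y
      exact ⟨j, by simp⟩
  rw [← key, orderOf_dvd_iff_zpow_eq_one, ← QuotientGroup.mk_zpow, QuotientGroup.eq_one_iff,
    Subgroup.mem_subgroupOf]
  simp [z]

/-- The natural map from cosets in `X` to cosets in `Y` is always injective; the hypothesis `Y ⊆ XB`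
makes it surjective. -/
theorem relIndex_eq_of_mul_cover [Finite G] {X Y B : Subgroup G} (hXY : X ≤ Y)
    (h : ∀ y ∈ Y, ∃ x ∈ X, x⁻¹ * y ∈ B) : B.relIndex Y = B.relIndex X := by
  symm
  refine Nat.card_eq_of_bijective (Subgroup.quotientSubgroupOfEmbeddingOfLE B hXY)
    ⟨(Subgroup.quotientSubgroupOfEmbeddingOfLE B hXY).injective, fun q => ?_⟩
  obtain ⟨y, rfl⟩ := QuotientGroup.mk_surjective q
  obtain ⟨x, hx, hxy⟩ := h y y.2
  refine ⟨QuotientGroup.mk ⟨x, hx⟩, ?_⟩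
  rw [Subgroup.quotientSubgroupOfEmbeddingOfLE_apply_mk, QuotientGroup.eq,
    Subgroup.mem_subgroupOf]
  simpa using hxy

/-- If `A = (A ∩ ⟨h⟩) H`, the orbit of `H` under `⟨h⟩` covers each point of its image in `G ⧸ A`
exactly `[A : H]` times. -/
theorem relIndex_zpowers_eq_mul [Finite G] {H A : Subgroup G} (hHA : H ≤ A) {h : G}
    (hA : ∀ a ∈ A, ∃ i : ℤ, h ^ i * a ∈ H) :
    H.relIndex (Subgroup.zpowers h) = H.relIndex A * A.relIndex (Subgroup.zpowers h) := by
  have h1 : H.relIndex A = H.relIndex (A ⊓ Subgroup.zpowers h) := by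
    refine relIndex_eq_of_mul_cover inf_le_left fun a ha => ?_
    obtain ⟨i, hi⟩ := hA a ha
    refine ⟨h ^ (-i), ⟨?_, Subgroup.zpow_mem_zpowers _ _⟩, by simpa using hi⟩
    have : h ^ i ∈ A := by simpa using A.mul_mem (hHA hi) (A.inv_mem ha)
    rw [zpow_neg]; exact A.inv_mem this
  rw [h1]
  have := Subgroup.relIndex_mul_relIndex (H ⊓ Subgroup.zpowers h) (A ⊓ Subgroup.zpowers h)
    (Subgroup.zpowers h) (inf_le_inf_right _ hHA) inf_le_right
  rw [Subgroup.inf_relIndex_right, Subgroup.inf_relIndex_right] at this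
  rw [← this]
  congr 1
  rw [← Subgroup.inf_relIndex_right H, ← Subgroup.inf_relIndex_right (H ⊓ Subgroup.zpowers h)]
  congr 1
  ext x; simp; tauto

/-- Both groups are powers of `h` times `D`, and powers of `h` commute: `ab = h^(-i) h^(-j) d` can
be regrouped with the `B`-power in front. -/
theorem exists_mul_eq_mul_of_zpow_cover {A B D : Subgroup G} (hA : D ≤ A) (hB : D ≤ B) {h : G}
    (cA : ∀ a ∈ A, ∃ i : ℤ, h ^ i * a ∈ D) (cB : ∀ b ∈ B, ∃ i : ℤ, h ^ i * b ∈ D)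
    {a b : G} (ha : a ∈ A) (hb : b ∈ B) : ∃ b' ∈ B, ∃ a' ∈ A, a * b = b' * a' := by
  obtain ⟨i, hi⟩ := cA a ha
  have hb2 : h ^ i * a * b ∈ B := B.mul_mem (hB hi) hb
  obtain ⟨j, hj⟩ := cB _ hb2
  have hjB : h ^ j ∈ B := (B.mul_mem_cancel_right hb2).mp (hB hj)
  have hiA : h ^ i ∈ A := by simpa using A.mul_mem (hA hi) (A.inv_mem ha)
  refine ⟨(h ^ j)⁻¹, B.inv_mem hjB, (h ^ i)⁻¹ * (h ^ j * (h ^ i * a * b)),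
    A.mul_mem (A.inv_mem hiA) (hA hj), ?_⟩
  have : (h ^ j)⁻¹ * (h ^ i)⁻¹ = (h ^ i)⁻¹ * (h ^ j)⁻¹ := by
    rw [← zpow_neg, ← zpow_neg, ← zpow_add, ← zpow_add, add_comm]
  rw [← mul_assoc, this]; group

namespace IsBicyclic

variable {H A B : Subgroup G} {h t : G}

/-- If the two orbits remain apart modulo `A`, then `A`, as a union of cosets of `H`, meets only the
first one. -/
theorem zpow_cover (hH : IsBicyclic H h t) (hA : H ≤ A) (tA : ∀ i : ℤ, h ^ i * t ∉ A) :
    ∀ a ∈ A, ∃ i : ℤ, h ^ i * a ∈ H := by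
  intro a ha
  refine (hH.cover a).resolve_right ?_
  rintro ⟨i, hi⟩
  refine tA (-i) ?_
  have := A.mul_mem ha (A.inv_mem (hA hi))
  convert this using 1
  rw [zpow_neg]; group

/-- The counterpart for the second orbit, which is moved to the base coset by `t⁻¹`; this replaces
`h` by its conjugate. -/
theorem conj_zpow_cover (hH : IsBicyclic H h t) (hA : H ≤ A) (tA : ∀ i : ℤ, h ^ i * t ∉ A) :
    ∀ a ∈ A, ∃ i : ℤ, (t⁻¹ * h * t) ^ i * a ∈ H := by
  intro a ha
  rcases hH.cover (t * a) with ⟨i, hi⟩ | ⟨i, hi⟩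
  · refine absurd ?_ (tA i)
    have := A.mul_mem (hA hi) (A.inv_mem ha)
    convert this using 1; group
  · refine ⟨i, ?_⟩
    rw [← conj_zpow']; convert hi using 1; group

/-- The element `h ^ j * t` of `A` conjugates `h` to `t⁻¹ * h * t`, because `h ^ j` commutes with
`h`. -/
theorem mem_iff_of_exists {A : Subgroup G} {h t : G} (tA : ∃ i : ℤ, h ^ i * t ∈ A) (k : ℤ) :
    h ^ k ∈ A ↔ (t⁻¹ * h * t) ^ k ∈ A := by
  obtain ⟨j, hj⟩ := tA
  have : (t⁻¹ * h * t) ^ k = (h ^ j * t)⁻¹ * h ^ k * (h ^ j * t) := by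
    rw [← conj_zpow', mul_inv_rev]
    have : (h ^ j)⁻¹ * h ^ k * h ^ j = h ^ k := by
      rw [← zpow_neg, ← zpow_add, ← zpow_add]; congr 1; ring
    calc t⁻¹ * h ^ k * t = t⁻¹ * ((h ^ j)⁻¹ * h ^ k * h ^ j) * t := by rw [this]
      _ = _ := by group
  rw [this, Subgroup.mul_mem_cancel_right _ hj, Subgroup.mul_mem_cancel_left _ (A.inv_mem hj)]

theorem relIndex_eq_of_exists [Finite G] {A : Subgroup G} {h t : G}
    (tA : ∃ i : ℤ, h ^ i * t ∈ A) :
    A.relIndex (Subgroup.zpowers h) = A.relIndex (Subgroup.zpowers (t⁻¹ * h * t)) := by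
  apply Nat.dvd_antisymm
  · rw [← Int.natCast_dvd_natCast, ← zpow_mem_iff_relIndex_dvd, mem_iff_of_exists tA,
      zpow_mem_iff_relIndex_dvd]
  · rw [← Int.natCast_dvd_natCast, ← zpow_mem_iff_relIndex_dvd, ← mem_iff_of_exists tA,
      zpow_mem_iff_relIndex_dvd]

theorem relIndex_ne [Finite G] (hH : IsBicyclic H h t) :
    H.relIndex (Subgroup.zpowers h) ≠ H.relIndex (Subgroup.zpowers (t⁻¹ * h * t)) := by
  intro e
  obtain ⟨i, hi⟩ := hH.ne
  apply hi
  rw [conj_zpow', zpow_mem_iff_relIndex_dvd, zpow_mem_iff_relIndex_dvd, e]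

/-- If the orbits stayed apart modulo `A`, their lengths on `G ⧸ H` would be `[A : H]` times those
on `G ⧸ A`. Equal lengths below would then give equal lengths above, contrary to `relIndex_ne`. So
equal lengths force the orbits to merge. -/
theorem exists_of_relIndex_eq [Finite G] (hH : IsBicyclic H h t) (hA : H ≤ A)
    (e : A.relIndex (Subgroup.zpowers h) = A.relIndex (Subgroup.zpowers (t⁻¹ * h * t))) :
    ∃ i : ℤ, h ^ i * t ∈ A := by
  by_contra! tA
  apply hH.relIndex_ne
  rw [relIndex_zpowers_eq_mul hA (hH.zpow_cover hA tA),
    relIndex_zpowers_eq_mul hA (hH.conj_zpow_cover hA tA), e]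

theorem cover_of_exists (hH : IsBicyclic H h t) (hA : H ≤ A) (tA : ∃ i : ℤ, h ^ i * t ∈ A)
    (g : G) : ∃ i : ℤ, h ^ i * g ∈ A := by
  obtain ⟨j, hj⟩ := tA
  rcases hH.cover g with ⟨i, hi⟩ | ⟨i, hi⟩
  · exact ⟨i, hA hi⟩
  · refine ⟨j + i, ?_⟩
    have := A.mul_mem hj (hA hi)
    convert this using 1
    rw [zpow_add]; group

/-- Without the inequality of lengths this would fail: transitivity on two coset spaces need not
pass to the intersection. Here the orbit lengths modulo `A ⊓ B` agree, which forces merging. -/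
theorem exists_inf [Finite G] (hH : IsBicyclic H h t) (hA : H ≤ A) (hB : H ≤ B)
    (tA : ∃ i : ℤ, h ^ i * t ∈ A) (tB : ∃ i : ℤ, h ^ i * t ∈ B) :
    ∃ i : ℤ, h ^ i * t ∈ A ⊓ B := by
  refine hH.exists_of_relIndex_eq (le_inf hA hB) ?_
  have : ∀ k : ℤ, h ^ k ∈ A ⊓ B ↔ (t⁻¹ * h * t) ^ k ∈ A ⊓ B := fun k =>
    and_congr (mem_iff_of_exists tA k) (mem_iff_of_exists tB k)
  apply Nat.dvd_antisymm
  · rw [← Int.natCast_dvd_natCast, ← zpow_mem_iff_relIndex_dvd, this, zpow_mem_iff_relIndex_dvd]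
  · rw [← Int.natCast_dvd_natCast, ← zpow_mem_iff_relIndex_dvd, ← this, zpow_mem_iff_relIndex_dvd]

theorem lcm_relIndex [Finite G] (A B : Subgroup G) (h : G) :
    Nat.lcm (A.relIndex (Subgroup.zpowers h)) (B.relIndex (Subgroup.zpowers h)) =
      (A ⊓ B).relIndex (Subgroup.zpowers h) := by
  apply Nat.dvd_antisymm
  · rw [Nat.lcm_dvd_iff]
    have := (zpow_mem_iff_relIndex_dvd (A ⊓ B) h _).mpr dvd_rfl
    rw [← Int.natCast_dvd_natCast, ← Int.natCast_dvd_natCast, ← zpow_mem_iff_relIndex_dvd,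
      ← zpow_mem_iff_relIndex_dvd]
    exact this
  · rw [← Int.natCast_dvd_natCast, ← zpow_mem_iff_relIndex_dvd]
    rw [Subgroup.mem_inf]
    constructor <;> rw [zpow_mem_iff_relIndex_dvd, Int.natCast_dvd_natCast]
    exacts [Nat.dvd_lcm_left _ _, Nat.dvd_lcm_right _ _]

theorem relIndex_zpowers_pos [Finite G] (A : Subgroup G) (h : G) :
    0 < A.relIndex (Subgroup.zpowers h) :=
  Nat.pos_of_ne_zero Subgroup.FiniteIndex.index_ne_zero

/-- The mixed case: `⟨h⟩` is transitive on `G ⧸ A` but not on `G ⧸ B`. -/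
theorem exists_mul_eq_mul_of_mixed [Finite G] (hH : IsBicyclic H h t) (hA : H ≤ A) (hB : H ≤ B)
    (tA : ∃ i : ℤ, h ^ i * t ∈ A) (tB : ∀ i : ℤ, h ^ i * t ∉ B) {a b : G} (ha : a ∈ A)
    (hb : b ∈ B) : ∃ a' ∈ A, ∃ b' ∈ B, b * a = a' * b' := by
  obtain ⟨i, hi⟩ := hH.zpow_cover hB tB b hb
  have hiB : h ^ (-i) ∈ B := by
    rw [zpow_neg]; exact B.inv_mem ((B.mul_mem_cancel_right hb).mp (hB hi))
  set j := -i with hj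
  set x := h ^ i * b * a with hx
  have hxA : x ∈ A := A.mul_mem (hA hi) ha
  have hba : b * a = h ^ j * x := by rw [hx, hj, zpow_neg]; group
  rw [hba]
  -- In the first orbit, commuting powers of `h` suffices. In the second, `h ^ j` has to be split
  -- into a power in `A` and a power whose conjugate by `x` lies in `B`.
  rcases hH.cover x with ⟨k, hk⟩ | ⟨k, hk⟩
  · have hkA : h ^ k ∈ A := (A.mul_mem_cancel_right hxA).mp (hA hk)
    refine ⟨(h ^ k)⁻¹, A.inv_mem hkA, h ^ j * (h ^ k * x), B.mul_mem hiB (hB hk), ?_⟩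
    have : (h ^ k)⁻¹ * h ^ j = h ^ j * (h ^ k)⁻¹ := by
      rw [← zpow_neg, ← zpow_add, ← zpow_add, add_comm]
    rw [← mul_assoc (h ^ k)⁻¹, this, mul_assoc, inv_mul_cancel_left]
  · have tC : ∀ i : ℤ, h ^ i * t ∉ A ⊓ B := fun i hi => tB i hi.2
    have hC : H ≤ A ⊓ B := le_inf hA hB
    have e1 := relIndex_zpowers_eq_mul hC (hH.zpow_cover hC tC)
    have e2 := relIndex_zpowers_eq_mul hC (hH.conj_zpow_cover hC tC)
    rw [relIndex_zpowers_eq_mul hB (hH.zpow_cover hB tB), ← lcm_relIndex] at e1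
    rw [relIndex_zpowers_eq_mul hB (hH.conj_zpow_cover hB tB), ← lcm_relIndex,
      ← relIndex_eq_of_exists tA] at e2
    have hb1 := relIndex_zpowers_pos B h
    have hb2 := relIndex_zpowers_pos B (t⁻¹ * h * t)
    have he : 0 < H.relIndex B := Nat.pos_of_ne_zero Subgroup.FiniteIndex.index_ne_zero
    have m1 : (B.relIndex (Subgroup.zpowers h) : ℤ) ∣ j :=
      (zpow_mem_iff_relIndex_dvd B h j).mp hiB
    have mA := zpow_mem_iff_relIndex_dvd A h
    have mB := zpow_mem_iff_relIndex_dvd B (t⁻¹ * h * t)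
    generalize A.relIndex (Subgroup.zpowers h) = d at *
    generalize B.relIndex (Subgroup.zpowers h) = b₁ at *
    generalize B.relIndex (Subgroup.zpowers (t⁻¹ * h * t)) = b₂ at *
    have g1 := Nat.gcd_mul_lcm d b₁
    have g2 := Nat.gcd_mul_lcm d b₂
    -- Both orbit lengths on `G ⧸ H` are computed through `B` and through `A ⊓ B`. Since the length
    -- modulo `A` is the same `d` for both orbits, each gcd times `[B : H]` equals `d` times `[A ⊓ B
    -- : H]`.
    have gcd_eq : Nat.gcd d b₁ = Nat.gcd d b₂ := by
      have f1 : Nat.gcd d b₁ * H.relIndex B = d * H.relIndex (A ⊓ B) := by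
        apply Nat.eq_of_mul_eq_mul_right hb1
        calc _ = Nat.gcd d b₁ * (H.relIndex B * b₁) := by ring
          _ = Nat.gcd d b₁ * Nat.lcm d b₁ * H.relIndex (A ⊓ B) := by rw [e1]; ring
          _ = _ := by rw [g1]; ring
      have f2 : Nat.gcd d b₂ * H.relIndex B = d * H.relIndex (A ⊓ B) := by
        apply Nat.eq_of_mul_eq_mul_right hb2
        calc _ = Nat.gcd d b₂ * (H.relIndex B * b₂) := by ring
          _ = Nat.gcd d b₂ * Nat.lcm d b₂ * H.relIndex (A ⊓ B) := by rw [e2]; ring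
          _ = _ := by rw [g2]; ring
      exact Nat.eq_of_mul_eq_mul_right he (f1.trans f2.symm)
    obtain ⟨q, hq⟩ : (Nat.gcd d b₂ : ℤ) ∣ j :=
      (Int.natCast_dvd_natCast.mpr (gcd_eq ▸ Nat.gcd_dvd_right d b₁)).trans m1
    rw [Nat.gcd_eq_gcd_ab] at hq
    -- Bézout: `j` is the sum of a multiple of `d`, giving a power in `A`, and the multiple `m` of
    -- `b₂`.
    set m : ℤ := b₂ * (Nat.gcdB d b₂ * q) with hm
    have hmB : (t⁻¹ * h * t) ^ m ∈ B := (mB m).mpr (Dvd.intro _ rfl)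
    have hmA : h ^ (j - m) ∈ A := (mA _).mpr ⟨Nat.gcdA d b₂ * q, by rw [hq, hm]; ring⟩
    refine ⟨h ^ (j - m) * x, A.mul_mem hmA hxA, x⁻¹ * h ^ m * x, ?_, ?_⟩
    · have hx' : x = h ^ (-k) * t * (t⁻¹ * h ^ k * x) := by rw [zpow_neg]; group
      have : x⁻¹ * h ^ m * x = (t⁻¹ * h ^ k * x)⁻¹ * (t⁻¹ * h * t) ^ m * (t⁻¹ * h ^ k * x) := by
        rw [← conj_zpow']
        have c : (h ^ k)⁻¹ * h ^ m * h ^ k = h ^ m := by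
          rw [← zpow_neg, ← zpow_add, ← zpow_add]; congr 1; ring
        calc x⁻¹ * h ^ m * x = x⁻¹ * ((h ^ k)⁻¹ * h ^ m * h ^ k) * x := by rw [c]
          _ = _ := by group
      rw [this]
      exact B.mul_mem (B.mul_mem (B.inv_mem (hB hk)) hmB) (hB hk)
    · rw [zpow_sub]; group

end IsBicyclic

/-- Subgroups that contain a good subgroup permute. -/
theorem IsGood.exists_mul_eq_mul [Finite G] {H A B : Subgroup G} (hH : IsGood H) (hA : H ≤ A)
    (hB : H ≤ B) {a b : G} (ha : a ∈ A) (hb : b ∈ B) :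
    ∃ b' ∈ B, ∃ a' ∈ A, a * b = b' * a' := by
  rcases hH with ⟨h, hh⟩ | ⟨h, t, hH⟩
  · exact exists_mul_eq_mul_of_zpow_cover hA hB (fun a _ => hh a) (fun b _ => hh b) ha hb
  by_cases tA : ∃ i : ℤ, h ^ i * t ∈ A <;> by_cases tB : ∃ i : ℤ, h ^ i * t ∈ B
  -- If both coset spaces have one orbit, `A ⊓ B` serves as the common subgroup `D`; if both have
  -- two, `H` itself does. The mixed case is separate.
  · have tC := hH.exists_inf hA hB tA tB
    have hC := hH.cover_of_exists (le_inf hA hB) tC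
    exact exists_mul_eq_mul_of_zpow_cover inf_le_left inf_le_right (fun a _ => hC a)
      (fun b _ => hC b) ha hb
  · push Not at tB
    obtain ⟨a', ha', b', hb', e⟩ :=
      hH.exists_mul_eq_mul_of_mixed hA hB tA tB (A.inv_mem ha) (B.inv_mem hb)
    refine ⟨b'⁻¹, B.inv_mem hb', a'⁻¹, A.inv_mem ha', ?_⟩
    rw [← inv_inj]; simpa using e
  · push Not at tA
    exact hH.exists_mul_eq_mul_of_mixed hB hA tB tA hb ha
  · push Not at tA tB
    exact exists_mul_eq_mul_of_zpow_cover hA hB (hH.zpow_cover hA tA) (hH.zpow_cover hB tB) ha hb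

/-- If `G = A B` with `A ∩ B` good and `B` maximal, then `B` and the normal core of `A` generate
`G`. -/
theorem IsGood.exists_mul_normalCore [Finite G] {H A B : Subgroup G} (hH : IsGood H)
    (hAB : A ⊓ B = H) (hA : H ≠ A) (cover : ∀ g : G, ∃ a ∈ A, ∃ b ∈ B, g = a * b)
    -- By maximality of `B`, the only obstruction is that the core of `A` lies in `B`, hence in `A ⊓
    -- B = H`; this is refuted below.
    (hB : ∀ M : Subgroup G, B ≤ M → M = B ∨ M = ⊤) (g : G) :
    ∃ b ∈ B, ∃ n ∈ A.normalCore, g = b * n := by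
  have hHA : H ≤ A := hAB ▸ inf_le_left
  have hHB : H ≤ B := hAB ▸ inf_le_right
  rcases hB (B ⊔ A.normalCore) le_sup_left with hM | hM
  swap
  · have : g ∈ B ⊔ A.normalCore := hM ▸ Subgroup.mem_top g
    rw [← SetLike.mem_coe, Subgroup.mul_normal, Set.mem_mul] at this
    obtain ⟨b, hb, n, hn, e⟩ := this
    exact ⟨b, hb, n, hn, e.symm⟩
  exfalso
  have hN : A.normalCore ≤ H := by
    rw [← hAB]
    exact le_inf A.normalCore_le (le_sup_right.trans hM.le)
  rcases hH with ⟨h, hh⟩ | ⟨h, t, hH⟩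
  · refine hA (le_antisymm hHA fun a ha => ?_)
    obtain ⟨i, hi⟩ := hh a
    have hiA : h ^ i ∈ A := (A.mul_mem_cancel_right ha).mp (hHA hi)
    have hiH : h ^ i ∈ H := by
      refine hN fun g => ?_
      obtain ⟨j, hj⟩ := hh g⁻¹
      have : g * h ^ i * g⁻¹ = (h ^ j * g⁻¹)⁻¹ * h ^ i * (h ^ j * g⁻¹) := by
        have c : (h ^ j)⁻¹ * h ^ i * h ^ j = h ^ i := by
          rw [← zpow_neg, ← zpow_add, ← zpow_add]; congr 1; ring
        calc g * h ^ i * g⁻¹ = g * ((h ^ j)⁻¹ * h ^ i * h ^ j) * g⁻¹ := by rw [c]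
          _ = _ := by group
      rw [this]
      exact A.mul_mem (A.mul_mem (A.inv_mem (hHA hj)) hiA) (hHA hj)
    exact (H.mul_mem_cancel_left hiH).mp hi
  -- A power of `h` fixing the base points of both orbits on `G ⧸ A` acts trivially there, so it
  -- lies in the core and therefore in `H`.
  have key : ∀ k : ℤ, h ^ k ∈ A → (t⁻¹ * h * t) ^ k ∈ A →
      h ^ k ∈ H ∧ (t⁻¹ * h * t) ^ k ∈ H := by
    intro k h1 h2
    have : h ^ k ∈ A.normalCore := by
      intro g
      have c : ∀ j : ℤ, (h ^ j)⁻¹ * h ^ k * h ^ j = h ^ k := fun j => by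
        rw [← zpow_neg, ← zpow_add, ← zpow_add]; congr 1; ring
      rcases hH.cover g⁻¹ with ⟨j, hj⟩ | ⟨j, hj⟩
      · have : g * h ^ k * g⁻¹ = (h ^ j * g⁻¹)⁻¹ * h ^ k * (h ^ j * g⁻¹) := by
          calc g * h ^ k * g⁻¹ = g * ((h ^ j)⁻¹ * h ^ k * h ^ j) * g⁻¹ := by rw [c]
            _ = _ := by group
        rw [this]
        exact A.mul_mem (A.mul_mem (A.inv_mem (hHA hj)) h1) (hHA hj)
      · have : g * h ^ k * g⁻¹ =
            (t⁻¹ * h ^ j * g⁻¹)⁻¹ * (t⁻¹ * h * t) ^ k * (t⁻¹ * h ^ j * g⁻¹) := by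
          rw [← conj_zpow']
          calc g * h ^ k * g⁻¹ = g * ((h ^ j)⁻¹ * h ^ k * h ^ j) * g⁻¹ := by rw [c]
            _ = _ := by group
        rw [this]
        exact A.mul_mem (A.mul_mem (A.inv_mem (hHA hj)) h2) (hHA hj)
    refine ⟨hN this, ?_⟩
    rw [← conj_zpow']
    have := hN (A.normalCore_normal.conj_mem _ this t⁻¹)
    simpa using this
  simp only [zpow_mem_iff_relIndex_dvd] at key
  have hne := hH.relIndex_ne
  have d1 : A.relIndex (Subgroup.zpowers h) ∣ H.relIndex (Subgroup.zpowers h) := by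
    rw [← hAB, ← IsBicyclic.lcm_relIndex]; exact Nat.dvd_lcm_left _ _
  have d2 : A.relIndex (Subgroup.zpowers (t⁻¹ * h * t)) ∣
      H.relIndex (Subgroup.zpowers (t⁻¹ * h * t)) := by
    rw [← hAB, ← IsBicyclic.lcm_relIndex]; exact Nat.dvd_lcm_left _ _
  -- If the orbits merge modulo `A`, `key` makes both lengths on `G ⧸ H` equal to the common length
  -- on `G ⧸ A`, a contradiction.
  by_cases tA : ∃ i : ℤ, h ^ i * t ∈ A
  · have e := IsBicyclic.relIndex_eq_of_exists tA
    have := key (A.relIndex (Subgroup.zpowers h)) dvd_rfl (by rw [e])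
    rw [Int.natCast_dvd_natCast, Int.natCast_dvd_natCast] at this
    apply hne
    rw [← Nat.dvd_antisymm d1 this.1, e, ← Nat.dvd_antisymm d2 (e ▸ this.2)]
  push Not at tA
  by_cases tB : ∃ i : ℤ, h ^ i * t ∈ B
  swap
  -- If they stay apart modulo both groups, then `t`, being a product from `A` and `B`, would lie in
  -- the first orbit.
  · push Not at tB
    obtain ⟨a, ha, b, hb, e⟩ := cover t
    obtain ⟨i, hi⟩ := hH.zpow_cover hHA tA a ha
    obtain ⟨j, hj⟩ := hH.zpow_cover hHB tB _ (B.mul_mem (hHB hi) hb)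
    refine hH.not_mem (j + i) ?_
    convert hj using 1
    rw [zpow_add, e]; group
  have hcB := hH.cover_of_exists hHB tB
  have dB : B.relIndex (Subgroup.zpowers h) = H.relIndex A := by
    have r1 : B.relIndex ⊤ = B.relIndex (Subgroup.zpowers h) := by
      refine relIndex_eq_of_mul_cover le_top fun g _ => ?_
      obtain ⟨i, hi⟩ := hcB g
      exact ⟨h ^ (-i), Subgroup.zpow_mem_zpowers _ _, by simpa using hi⟩
    have r2 : B.relIndex ⊤ = B.relIndex A := by
      refine relIndex_eq_of_mul_cover le_top fun g _ => ?_
      obtain ⟨a, ha, b, hb, rfl⟩ := cover g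
      exact ⟨a, ha, by simpa using hb⟩
    rw [← r1, r2, ← hAB, Subgroup.inf_relIndex_left]
  have n1 := relIndex_zpowers_eq_mul hHA (hH.zpow_cover hHA tA)
  have n2 := relIndex_zpowers_eq_mul hHA (hH.conj_zpow_cover hHA tA)
  have l1 := IsBicyclic.lcm_relIndex A B h
  have l2 := IsBicyclic.lcm_relIndex A B (t⁻¹ * h * t)
  rw [hAB, dB] at l1
  rw [hAB, ← IsBicyclic.relIndex_eq_of_exists tB, dB] at l2
  have p1 := IsBicyclic.relIndex_zpowers_pos A h
  have p2 := IsBicyclic.relIndex_zpowers_pos A (t⁻¹ * h * t)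
  have ha1 : H.relIndex A ≠ 1 := fun h1 =>
    hA (le_antisymm hHA (Subgroup.relIndex_eq_one.mp h1))
  generalize A.relIndex (Subgroup.zpowers h) = a₁ at *
  generalize A.relIndex (Subgroup.zpowers (t⁻¹ * h * t)) = a₂ at *
  generalize H.relIndex (Subgroup.zpowers h) = m₁ at *
  generalize H.relIndex (Subgroup.zpowers (t⁻¹ * h * t)) = m₂ at *
  have ha0 : 0 < H.relIndex A := Nat.pos_of_ne_zero Subgroup.FiniteIndex.index_ne_zero
  generalize H.relIndex A = a at *
  -- Now `h` is transitive on `G ⧸ B`, with `a = [G : B] = [A : H]` points. The lengths on `G ⧸ H`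
  -- are both `a * aᵢ` and `lcm aᵢ a`, so `a` is coprime to each `aᵢ`; but `key` gives `a ∣ a₁ *
  -- a₂`, whence `a = 1`.
  have cop : ∀ x, 0 < x → Nat.lcm x a = a * x → Nat.Coprime a x := by
    intro x hx e
    have := Nat.gcd_mul_lcm x a
    rw [e] at this
    have h3 : 0 < a * x := by positivity
    rw [Nat.coprime_comm, Nat.coprime_iff_gcd_eq_one]
    apply Nat.eq_of_mul_eq_mul_right h3
    rw [this]; ring
  have c1 := cop a₁ p1 (l1.trans n1)
  have c2 := cop a₂ p2 (l2.trans n2)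
  have := (key (Nat.lcm a₁ a₂) (Int.natCast_dvd_natCast.mpr (Nat.dvd_lcm_left _ _))
    (Int.natCast_dvd_natCast.mpr (Nat.dvd_lcm_right _ _))).1
  rw [Int.natCast_dvd_natCast, n1] at this
  have h4 : a ∣ a₁ * a₂ :=
    ((Dvd.intro _ rfl).trans this).trans (Nat.lcm_dvd_mul _ _)
  exact ha1 (Nat.Coprime.eq_one_of_dvd (Nat.Coprime.mul_right c1 c2) h4)

/-- A subgroup that contains a good subgroup is good. -/
theorem IsGood.mono [Finite G] {H K : Subgroup G} (hH : IsGood H) (hK : H ≤ K) : IsGood K := by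
  rcases hH with ⟨h, hh⟩ | ⟨h, t, hH⟩
  · exact Or.inl ⟨h, fun g => (hh g).imp fun i hi => hK hi⟩
  by_cases tK : ∃ i : ℤ, h ^ i * t ∈ K
  · exact Or.inl ⟨h, hH.cover_of_exists hK tK⟩
  · refine Or.inr ⟨h, t, not_exists.mp tK, fun g => (hH.cover g).imp (fun ⟨i, hi⟩ => ⟨i, hK hi⟩)
      (fun ⟨i, hi⟩ => ⟨i, hK hi⟩), ?_⟩
    by_contra! hcon
    -- Orbits that stay apart modulo `K` keep different lengths; otherwise they would merge.
    refine tK (hH.exists_of_relIndex_eq hK ?_)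
    simp only [conj_zpow'] at hcon
    apply Nat.dvd_antisymm
    · rw [← Int.natCast_dvd_natCast, ← zpow_mem_iff_relIndex_dvd, hcon, zpow_mem_iff_relIndex_dvd]
    · rw [← Int.natCast_dvd_natCast, ← zpow_mem_iff_relIndex_dvd, ← hcon,
        zpow_mem_iff_relIndex_dvd]

/-- A good subgroup is good in every intermediate group. -/
theorem IsGood.subgroupOf [Finite G] {H K : Subgroup G} (hH : IsGood H) (hK : H ≤ K) :
    IsGood (H.subgroupOf K) := by
  have cyc : ∀ h : G, (∀ g ∈ K, ∃ i : ℤ, h ^ i * g ∈ H) → HasCycle (H.subgroupOf K) := by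
    intro h hh
    set d := K.relIndex (Subgroup.zpowers h)
    have hd : h ^ (d : ℤ) ∈ K := (zpow_mem_iff_relIndex_dvd K h d).mpr dvd_rfl
    refine ⟨⟨h ^ (d : ℤ), hd⟩, fun g => ?_⟩
    obtain ⟨i, hi⟩ := hh g g.2
    obtain ⟨j, rfl⟩ : (d : ℤ) ∣ i :=
      (zpow_mem_iff_relIndex_dvd K h i).mp ((K.mul_mem_cancel_right g.2).mp (hK hi))
    refine ⟨j, ?_⟩
    rw [Subgroup.mem_subgroupOf]
    simpa [zpow_mul] using hi
  rcases hH with ⟨h, hh⟩ | ⟨h, t, hH⟩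
  · exact Or.inl (cyc h fun g _ => hh g)
  by_cases tK : ∃ i : ℤ, h ^ i * t ∈ K
  swap
  · exact Or.inl (cyc h (hH.zpow_cover hK (not_exists.mp tK)))
  obtain ⟨j, hj⟩ := tK
  set d := K.relIndex (Subgroup.zpowers h) with hd'
  have hd : h ^ (d : ℤ) ∈ K := (zpow_mem_iff_relIndex_dvd K h d).mpr dvd_rfl
  have hdvd : ∀ i : ℤ, h ^ i ∈ K → (d : ℤ) ∣ i := fun i => (zpow_mem_iff_relIndex_dvd K h i).mp
  -- The power `h ^ d` generates `⟨h⟩ ∩ K`, and the representative of the second orbit is moved into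
  -- `K` by a power of `h`.
  refine Or.inr ⟨⟨h ^ (d : ℤ), hd⟩, ⟨h ^ j * t, hj⟩, fun i hi => ?_, fun g => ?_, ?_⟩
  · rw [Subgroup.mem_subgroupOf] at hi
    refine hH.not_mem (d * i + j) ?_
    rw [zpow_add, zpow_mul, mul_assoc]; simpa using hi
  · rcases hH.cover g with ⟨i, hi⟩ | ⟨i, hi⟩
    · obtain ⟨q, rfl⟩ := hdvd i ((K.mul_mem_cancel_right g.2).mp (hK hi))
      refine Or.inl ⟨q, ?_⟩
      rw [Subgroup.mem_subgroupOf]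
      simpa [zpow_mul] using hi
    · have hx : (h ^ j * t)⁻¹ * h ^ (j + i) * g ∈ H := by
        convert hi using 1
        rw [zpow_add]; group
      have : h ^ (j + i) ∈ K := by
        have := K.mul_mem hj (hK hx)
        rw [← K.mul_mem_cancel_right g.2]
        convert this using 1; group
      obtain ⟨q, hq⟩ := hdvd _ this
      refine Or.inr ⟨q, ?_⟩
      rw [Subgroup.mem_subgroupOf]
      rw [hq, zpow_mul] at hx
      simpa using hx
  · obtain ⟨i, hi⟩ := hH.ne
    have c : ∀ k : ℤ, (h ^ j)⁻¹ * h ^ k * h ^ j = h ^ k := fun k => by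
      rw [← zpow_neg, ← zpow_add, ← zpow_add]; congr 1; ring
    have hc : ∀ k : ℤ, (h ^ j * t)⁻¹ * h ^ k * (h ^ j * t) = t⁻¹ * h ^ k * t := fun k => by
      calc _ = t⁻¹ * ((h ^ j)⁻¹ * h ^ k * h ^ j) * t := by group
        _ = _ := by rw [c]
    have hiK : h ^ i ∈ K := by
      by_contra hcon
      refine hi ⟨fun h1 => absurd (hK h1) hcon, fun h1 => absurd ?_ hcon⟩
      rw [← hc] at h1
      have := K.mul_mem (K.mul_mem hj (hK h1)) (K.inv_mem hj)
      convert this using 1; group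
    obtain ⟨q, rfl⟩ := hdvd i hiK
    refine ⟨q, ?_⟩
    rw [Subgroup.mem_subgroupOf, Subgroup.mem_subgroupOf]
    rw [← hc, zpow_mul] at hi
    simpa using hi

/-! ### Induced permutation groups and their exchange. -/

/-- The permutation group induced by `K` on the left cosets of `H` in `K`. -/
def permRep (K H : Subgroup G) : Subgroup (Equiv.Perm (K ⧸ H.subgroupOf K)) :=
  (MulAction.toPermHom K (K ⧸ H.subgroupOf K)).range

/-- No homomorphism between the groups is required: only the sets of induced permutations have to
match. This matters when an element is matched only modulo the kernel of the action. -/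
theorem permEquivalent_range_toPermHom {K K' X X' : Type*} [Group K] [Group K'] [MulAction K X]
    [MulAction K' X'] (e : X ≃ X') (h₁ : ∀ k : K, ∃ k' : K', ∀ x, e (k • x) = k' • e x)
    (h₂ : ∀ k' : K', ∃ k : K, ∀ x, e (k • x) = k' • e x) :
    PermEquivalent (MulAction.toPermHom K X).range (MulAction.toPermHom K' X').range := by
  have key : ∀ k : K, ∀ k' : K', (∀ x, e (k • x) = k' • e x) →
      e.permCongrHom (MulAction.toPermHom K X k) = MulAction.toPermHom K' X' k' := by
    intro k k' h
    ext x
    have := h (e.symm x)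
    simpa using this
  refine ⟨e, le_antisymm ?_ ?_⟩
  · rintro _ ⟨_, ⟨k, rfl⟩, rfl⟩
    obtain ⟨k', h⟩ := h₁ k
    exact ⟨k', (key k k' h).symm⟩
  · rintro _ ⟨k', rfl⟩
    obtain ⟨k, h⟩ := h₂ k'
    exact ⟨_, ⟨k, rfl⟩, key k k' h⟩

theorem PermEquivalent.symm' {Ω Ω' : Type*} {P : Subgroup (Equiv.Perm Ω)}
    {Q : Subgroup (Equiv.Perm Ω')} (h : PermEquivalent P Q) : PermEquivalent Q P := by
  obtain ⟨e, rfl⟩ := h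
  refine ⟨e.symm, ?_⟩
  rw [Subgroup.map_map]
  convert Subgroup.map_id P
  ext g x
  simp

theorem PermEquivalent.trans' {Ω Ω' Ω'' : Type*} {P : Subgroup (Equiv.Perm Ω)}
    {Q : Subgroup (Equiv.Perm Ω')} {R : Subgroup (Equiv.Perm Ω'')} (h : PermEquivalent P Q)
    (h' : PermEquivalent Q R) : PermEquivalent P R := by
  obtain ⟨e, rfl⟩ := h
  obtain ⟨e', rfl⟩ := h'
  refine ⟨e.trans e', ?_⟩
  rw [Subgroup.map_map]
  congr 1

theorem mem_sup_of_permute {A B : Subgroup G}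
    (h : ∀ a ∈ A, ∀ b ∈ B, ∃ b' ∈ B, ∃ a' ∈ A, a * b = b' * a') {g : G} (hg : g ∈ A ⊔ B) :
    ∃ b ∈ B, ∃ a ∈ A, g = b * a := by
  let M : Subgroup G :=
    { carrier := {g | ∃ b ∈ B, ∃ a ∈ A, g = b * a}
      one_mem' := ⟨1, B.one_mem, 1, A.one_mem, by simp⟩
      mul_mem' := by
        rintro _ _ ⟨b, hb, a, ha, rfl⟩ ⟨b₁, hb₁, a₁, ha₁, rfl⟩
        obtain ⟨b', hb', a', ha', e⟩ := h a ha b₁ hb₁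
        refine ⟨b * b', B.mul_mem hb hb', a' * a₁, A.mul_mem ha' ha₁, ?_⟩
        rw [mul_assoc, ← mul_assoc a, e]; group
      inv_mem' := by
        rintro _ ⟨b, hb, a, ha, rfl⟩
        obtain ⟨b', hb', a', ha', e⟩ := h a⁻¹ (A.inv_mem ha) b⁻¹ (B.inv_mem hb)
        exact ⟨b', hb', a', ha', by rw [mul_inv_rev, e]⟩ }
  have : A ⊔ B ≤ M := sup_le (fun a ha => ⟨1, B.one_mem, a, ha, by simp⟩)
    fun b hb => ⟨b, hb, 1, A.one_mem, by simp⟩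
  exact this hg

/-- Modular law: as `A ⊔ B = BA`, an intermediate `M` is `(M ⊓ B) A`, and there are only two
candidates for `M ⊓ B`. -/
theorem maximal_sup_of_permute {H A B : Subgroup G}
    (h : ∀ a ∈ A, ∀ b ∈ B, ∃ b' ∈ B, ∃ a' ∈ A, a * b = b' * a') (hA : H ≤ A)
    (hB : H ≤ B) (maxB : ∀ M : Subgroup G, H ≤ M → M ≤ B → M = H ∨ M = B)
    (M : Subgroup G) (hM : A ≤ M) (hM' : M ≤ A ⊔ B) : M = A ∨ M = A ⊔ B := by
  rcases maxB (M ⊓ B) (le_inf (hA.trans hM) hB) inf_le_right with e | e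
  · refine Or.inl (le_antisymm (fun g hg => ?_) hM)
    obtain ⟨b, hb, a, ha, rfl⟩ := mem_sup_of_permute h (hM' hg)
    have : b ∈ M ⊓ B := ⟨(M.mul_mem_cancel_right (hM ha)).mp hg, hb⟩
    rw [e] at this
    exact A.mul_mem (hA this) ha
  · exact Or.inr (le_antisymm hM' (sup_le hM (e ▸ inf_le_left)))

/-- Opposite sides of the diamond carry the same permutation group. Inclusion induces a
`B`-equivariant bijection of coset spaces, because `A ⊔ B = BA` and `A ⊓ B = H`. Maximality of `H`
in `A` makes `B` maximal in `A ⊔ B`, so `B` and the core of `A` generate. -/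
theorem IsGood.permEquivalent_permRep [Finite G] {H A B : Subgroup G} (hH : IsGood H) (hA : H ≤ A)
    (hB : H ≤ B) (hAB : A ⊓ B = H) (hne : H ≠ A)
    (maxA : ∀ M : Subgroup G, H ≤ M → M ≤ A → M = H ∨ M = A) :
    PermEquivalent (permRep (A ⊔ B) A) (permRep B H) := by
  have hperm : ∀ a ∈ A, ∀ b ∈ B, ∃ b' ∈ B, ∃ a' ∈ A, a * b = b' * a' :=
    fun a ha b hb => hH.exists_mul_eq_mul hA hB ha hb
  have hperm' : ∀ b ∈ B, ∀ a ∈ A, ∃ a' ∈ A, ∃ b' ∈ B, b * a = a' * b' :=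
    fun a ha b hb => hH.exists_mul_eq_mul hB hA ha hb
  set K := A ⊔ B with hK
  have hAK : A ≤ K := le_sup_left
  have hBK : B ≤ K := le_sup_right
  have core := (hH.subgroupOf (hA.trans hAK)).exists_mul_normalCore (A := A.subgroupOf K)
    (B := B.subgroupOf K) (by rw [← hAB]; ext; simp [Subgroup.mem_subgroupOf])
    (fun e => hne ((Subgroup.subgroupOf_inj.mp e) |> fun e => by
      rwa [inf_of_le_left (hA.trans hAK), inf_of_le_left hAK] at e))
    (fun g => by
      have hg : (g : G) ∈ B ⊔ A := by rw [sup_comm]; exact g.2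
      obtain ⟨a, ha, b, hb, e⟩ := mem_sup_of_permute hperm' hg
      exact ⟨⟨a, hAK ha⟩, ha, ⟨b, hBK hb⟩, hb, Subtype.ext e⟩)
    (fun M hM => by
      have h1 : B ≤ M.map K.subtype := fun b hb => ⟨⟨b, hBK hb⟩, hM hb, rfl⟩
      have h2 : M.map K.subtype ≤ B ⊔ A := by
        rw [sup_comm]; exact Subgroup.map_subtype_le M
      rcases maximal_sup_of_permute hperm' hB hA maxA _ h1 h2 with e | e
      · left; rw [← e]; ext x; simp [Subgroup.mem_subgroupOf]
      · right
        rw [sup_comm, ← hK] at e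
        rw [_root_.eq_top_iff]
        intro x _
        have : (x : G) ∈ M.map K.subtype := by rw [e]; exact x.2
        simpa using this)
  let f : B ⧸ H.subgroupOf B → K ⧸ A.subgroupOf K :=
    Quotient.map' (fun b : B => (⟨b, hBK b.2⟩ : K)) (fun b b' hb => by
      rw [QuotientGroup.leftRel_apply, Subgroup.mem_subgroupOf] at *
      exact hA hb)
  have hf : ∀ b : B, f (QuotientGroup.mk b) = QuotientGroup.mk ⟨b, hBK b.2⟩ := fun b => rfl
  have hbij : Function.Bijective f := by
    constructor
    · intro x y hxy
      obtain ⟨x, rfl⟩ := QuotientGroup.mk_surjective x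
      obtain ⟨y, rfl⟩ := QuotientGroup.mk_surjective y
      rw [hf, hf, QuotientGroup.eq, Subgroup.mem_subgroupOf] at hxy
      rw [QuotientGroup.eq, Subgroup.mem_subgroupOf, ← hAB]
      exact ⟨hxy, (x⁻¹ * y).2⟩
    · intro y
      obtain ⟨y, rfl⟩ := QuotientGroup.mk_surjective y
      obtain ⟨b, hb, a, ha, e⟩ := mem_sup_of_permute hperm y.2
      refine ⟨QuotientGroup.mk ⟨b, hb⟩, ?_⟩
      rw [hf, QuotientGroup.eq, Subgroup.mem_subgroupOf]
      simpa [e] using ha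
  refine PermEquivalent.symm' (permEquivalent_range_toPermHom (Equiv.ofBijective f hbij)
    (fun b => ⟨⟨b, hBK b.2⟩, fun x => ?_⟩) fun k => ?_)
  · obtain ⟨x, rfl⟩ := QuotientGroup.mk_surjective x
    rfl
  -- The core component `n` acts trivially, so `k` acts as `b`.
  · obtain ⟨b, hb, n, hn, rfl⟩ := core k
    refine ⟨⟨b, hb⟩, fun x => ?_⟩
    obtain ⟨x, rfl⟩ := QuotientGroup.mk_surjective x
    change (QuotientGroup.mk _ : K ⧸ A.subgroupOf K) = QuotientGroup.mk _
    rw [QuotientGroup.eq]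
    have := hn ⟨x⁻¹, hBK (x⁻¹).2⟩
    convert this using 1
    ext
    simp [mul_assoc]

end GroupTheory

section

open Polynomial

/-! ### Composition as substitution, and subfields of `ℂ(z)`. -/

section RationalFunctions

open IntermediateField

/-- `F` is not a constant function. -/
def Nonconst (F : RatFunc ℂ) : Prop := ¬ ∃ c, F = RatFunc.C c

theorem nonconst_iff_degree {F : RatFunc ℂ} : Nonconst F ↔ degree F ≠ 0 := by
  rw [Nonconst, RatFunc.eq_C_iff, degree]
  simp

theorem degree_eq_finrank (F : RatFunc ℂ) : degree F = Module.finrank ℂ⟮F⟯ (RatFunc ℂ) :=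
  (RatFunc.finrank_eq_max_natDegree F).symm

theorem Nonconst.transcendental {F : RatFunc ℂ} (hF : Nonconst F) : Transcendental ℂ F :=
  RatFunc.transcendental_of_ne_C F hF

theorem algHom_algebraMap {L : Type*} [Field L] [Algebra ℂ L] (f : RatFunc ℂ →ₐ[ℂ] L) (p : ℂ[X]) :
    f (algebraMap ℂ[X] (RatFunc ℂ) p) = aeval (f RatFunc.X) p := by
  rw [← RatFunc.aeval_X_left_eq_algebraMap, aeval_algHom_apply]

theorem algHom_apply {L : Type*} [Field L] [Algebra ℂ L] (f : RatFunc ℂ →ₐ[ℂ] L) (A : RatFunc ℂ) :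
    f A = aeval (f RatFunc.X) A.num / aeval (f RatFunc.X) A.denom := by
  conv_lhs => rw [← RatFunc.num_div_denom A]
  rw [map_div₀, algHom_algebraMap, algHom_algebraMap]

/-- Substitution of a transcendental element. -/
def substHom {L : Type*} [Field L] [Algebra ℂ L] (x : L) (hx : Transcendental ℂ x) :
    RatFunc ℂ →ₐ[ℂ] L :=
  RatFunc.liftAlgHom (aeval x) (nonZeroDivisors_le_comap_nonZeroDivisors_of_injective _
    (transcendental_iff_injective.mp hx))

theorem substHom_algebraMap {L : Type*} [Field L] [Algebra ℂ L] (x : L) (hx : Transcendental ℂ x)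
    (p : ℂ[X]) : substHom x hx (algebraMap _ _ p) = aeval x p := by
  have := RatFunc.liftAlgHom_apply_div' (φ := aeval x)
    (nonZeroDivisors_le_comap_nonZeroDivisors_of_injective _
    (transcendental_iff_injective.mp hx)) p 1
  simpa [substHom] using this

@[simp] theorem substHom_X {L : Type*} [Field L] [Algebra ℂ L] (x : L) (hx : Transcendental ℂ x) :
    substHom x hx RatFunc.X = x := by
  rw [← RatFunc.algebraMap_X, substHom_algebraMap, aeval_X]

theorem comp_eq_div (A B : RatFunc ℂ) : comp A B = aeval B A.num / aeval B A.denom := rfl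

/-- For nonconstant `B`, substitution is a field homomorphism; associativity and right cancellation
of composition are read off from this. -/
theorem comp_eq_substHom (A : RatFunc ℂ) {B : RatFunc ℂ} (hB : Nonconst B) :
    comp A B = substHom B hB.transcendental A := by
  rw [algHom_apply, substHom_X, comp_eq_div]

@[simp] theorem comp_X (A : RatFunc ℂ) : comp A RatFunc.X = A := by
  rw [comp_eq_div, RatFunc.aeval_X_left_eq_algebraMap, RatFunc.aeval_X_left_eq_algebraMap,
    RatFunc.num_div_denom]

@[simp] theorem X_comp (A : RatFunc ℂ) : comp RatFunc.X A = A := RatFunc.eval_X _ _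

theorem algHom_comp {L : Type*} [Field L] [Algebra ℂ L] (f : RatFunc ℂ →ₐ[ℂ] L)
    (A B : RatFunc ℂ) : f (comp A B) = aeval (f B) A.num / aeval (f B) A.denom := by
  rw [comp_eq_div, map_div₀, aeval_algHom_apply, aeval_algHom_apply]

theorem nonconst_of_comp {A B : RatFunc ℂ} (h : Nonconst (comp A B)) : Nonconst A ∧ Nonconst B := by
  constructor
  · rintro ⟨c, rfl⟩
    exact h ⟨c, RatFunc.eval_C _ _⟩
  · rintro ⟨b, rfl⟩
    refine h ⟨aeval b A.num / aeval b A.denom, ?_⟩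
    rw [comp_eq_div, map_div₀, ← RatFunc.algebraMap_eq_C, aeval_algebraMap_apply,
      aeval_algebraMap_apply]

theorem nonconst_X : Nonconst RatFunc.X := by
  rw [nonconst_iff_degree]; simp [degree]

theorem degree_X : degree RatFunc.X = 1 := by simp [degree]

theorem comp_nonconst {A B : RatFunc ℂ} (hA : Nonconst A) (hB : Nonconst B) :
    Nonconst (comp A B) := by
  rintro ⟨c, hc⟩
  refine hA ⟨c, ?_⟩
  rw [comp_eq_substHom A hB] at hc
  refine (substHom B hB.transcendental).injective ?_
  change substHom B hB.transcendental A = substHom B hB.transcendental _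
  rw [hc, ← RatFunc.algebraMap_eq_C, AlgHom.commutes]

theorem comp_assoc (A B : RatFunc ℂ) {D : RatFunc ℂ} (hD : Nonconst D) :
    comp (comp A B) D = comp A (comp B D) := by
  rw [comp_eq_substHom _ hD, algHom_comp, ← comp_eq_substHom _ hD, comp_eq_div A (comp B D)]

theorem comp_right_cancel {A B D : RatFunc ℂ} (hD : Nonconst D) (h : comp A D = comp B D) :
    A = B := by
  rw [comp_eq_substHom _ hD, comp_eq_substHom _ hD] at h
  exact (substHom D hD.transcendental).injective h

theorem mem_adjoin_iff {U V : RatFunc ℂ} (hU : Nonconst U) :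
    V ∈ ℂ⟮U⟯ ↔ ∃ A, V = comp A U := by
  rw [mem_adjoin_simple_iff]
  constructor
  · rintro ⟨r, s, rfl⟩
    refine ⟨algebraMap _ _ r / algebraMap _ _ s, ?_⟩
    rw [comp_eq_substHom _ hU, map_div₀, substHom_algebraMap, substHom_algebraMap]
  · rintro ⟨A, rfl⟩
    exact ⟨_, _, comp_eq_div A U⟩

theorem degree_eq_one_iff {A : RatFunc ℂ} : degree A = 1 ↔ ∃ B, comp B A = RatFunc.X := by
  constructor
  · intro h
    have hA : Nonconst A := nonconst_iff_degree.mpr (by omega)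
    have : ℂ⟮A⟯ = ⊤ := by
      rw [degree_eq_finrank] at h
      exact IntermediateField.finrank_eq_one_iff_eq_top.mp h
    obtain ⟨B, hB⟩ := (mem_adjoin_iff hA).mp (show RatFunc.X ∈ ℂ⟮A⟯ by rw [this]; trivial)
    exact ⟨B, hB.symm⟩
  · rintro ⟨B, hB⟩
    have hA : Nonconst A := (nonconst_of_comp (hB ▸ nonconst_X : Nonconst (comp B A))).2
    rw [degree_eq_finrank, IntermediateField.finrank_eq_one_iff_eq_top, _root_.eq_top_iff,
      ← RatFunc.adjoin_X, adjoin_simple_le_iff, mem_adjoin_iff hA]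
    exact ⟨B, hB.symm⟩

theorem comp_eq_X_symm {A B : RatFunc ℂ} (h : comp B A = RatFunc.X) : comp A B = RatFunc.X := by
  have hn := nonconst_of_comp (h ▸ nonconst_X : Nonconst (comp B A))
  apply comp_right_cancel hn.2
  rw [comp_assoc _ _ hn.2, h, comp_X, X_comp]

/-- A rational function of degree one has a compositional inverse. -/
theorem exists_inverse {A : RatFunc ℂ} (h : degree A = 1) :
    ∃ B, degree B = 1 ∧ comp B A = RatFunc.X ∧ comp A B = RatFunc.X := by
  obtain ⟨B, hB⟩ := degree_eq_one_iff.mp h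
  exact ⟨B, degree_eq_one_iff.mpr ⟨A, comp_eq_X_symm hB⟩, hB, comp_eq_X_symm hB⟩

end RationalFunctions

/-! ### The Galois correspondence for decompositions. -/

open IntermediateField

/-- A finite group acting on an extension of `ℂ(z)`, with the properties of the Galois group of the
normal closure of `ℂ(z)` over `ℂ(F)`. -/
structure GaloisFrame (F : RatFunc ℂ) where
  /-- the extension of `ℂ(z)` -/
  L : Type
  /-- the group -/
  Γ : Type
  [field : Field L]
  [algebra : Algebra ℂ L]
  [group : Group Γ]
  [finite : Finite Γ]
  [action : MulSemiringAction Γ L]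
  /-- the embedding of `ℂ(z)` -/
  ι : RatFunc ℂ →ₐ[ℂ] L
  smul_algebraMap : ∀ (g : Γ) (c : ℂ), g • algebraMap ℂ L c = algebraMap ℂ L c
  smul_base : ∀ g : Γ, g • ι F = ι F
  exists_of_fixed : ∀ A U : RatFunc ℂ, F = comp A U → ∀ y : L,
    (∀ g : Γ, g • ι U = ι U → g • y = y) → ∃ B, y = ι (comp B U)
  exists_of_subgroup : ∀ K : Subgroup Γ, MulAction.stabilizer Γ (ι RatFunc.X) ≤ K →
    ∃ A U, F = comp A U ∧ K = MulAction.stabilizer Γ (ι U)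

attribute [instance] GaloisFrame.field GaloisFrame.algebra GaloisFrame.group GaloisFrame.finite
  GaloisFrame.action

namespace GaloisFrame

variable {F : RatFunc ℂ} (W : GaloisFrame F)

/-- The subgroup fixing `U`. -/
def St (U : RatFunc ℂ) : Subgroup W.Γ := MulAction.stabilizer W.Γ (W.ι U)

theorem mem_St {U : RatFunc ℂ} {g : W.Γ} : g ∈ W.St U ↔ g • W.ι U = W.ι U := Iff.rfl

theorem smul_aeval (g : W.Γ) (x : W.L) (p : ℂ[X]) : g • aeval x p = aeval (g • x) p := by
  let φ : W.L →ₐ[ℂ] W.L :=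
    { MulSemiringAction.toRingHom W.Γ W.L g with commutes' := W.smul_algebraMap g }
  exact (aeval_algHom_apply φ x p).symm

theorem smul_comp {g : W.Γ} {U : RatFunc ℂ} (hg : g • W.ι U = W.ι U) (A : RatFunc ℂ) :
    g • W.ι (comp A U) = W.ι (comp A U) := by
  rw [algHom_comp, smul_div₀', smul_aeval, smul_aeval, hg]

/-- An element fixed by the stabiliser of `U` lies in the image of `ℂ(U)`, that is, it is a function
of `U`. -/
theorem St_le_iff {A U V : RatFunc ℂ} (hU : F = comp A U) :
    W.St U ≤ W.St V ↔ ∃ B, V = comp B U := by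
  constructor
  · intro h
    obtain ⟨B, hB⟩ := W.exists_of_fixed A U hU (W.ι V) fun g hg => h hg
    exact ⟨B, W.ι.injective hB⟩
  · rintro ⟨B, rfl⟩ g hg
    exact W.smul_comp hg B

theorem St_le_comp (A U : RatFunc ℂ) : W.St U ≤ W.St (comp A U) := fun _ hg => W.smul_comp hg A

theorem St_base : W.St F = ⊤ := _root_.eq_top_iff.mpr fun g _ => W.smul_base g

/-- The polynomial whose roots are the solutions of `A(x) = v`. -/
def fiberPoly {K : Type*} [Field K] [Algebra ℂ K] (A : RatFunc ℂ) (v : K) : K[X] :=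
  A.num.map (algebraMap ℂ K) - Polynomial.C v * A.denom.map (algebraMap ℂ K)

theorem natDegree_fiberPoly_le {K : Type*} [Field K] [Algebra ℂ K] (A : RatFunc ℂ) (v : K) :
    (fiberPoly A v).natDegree ≤ degree A := by
  refine (natDegree_sub_le _ _).trans (max_le_max ?_ ?_)
  · rw [natDegree_map]
  · exact (natDegree_C_mul_le _ _).trans_eq (natDegree_map _)

theorem fiberPoly_ne_zero (A : RatFunc ℂ) {V : RatFunc ℂ} (hV : Nonconst V) :
    fiberPoly A (W.ι V) ≠ 0 := by
  intro h
  have h2 := congrArg (fun p => coeff p A.denom.natDegree) h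
  simp only [fiberPoly, coeff_sub, coeff_map, coeff_C_mul, coeff_zero, sub_eq_zero] at h2
  have h1 : A.denom.coeff A.denom.natDegree = 1 := A.monic_denom
  rw [h1, map_one, mul_one, ← W.ι.commutes] at h2
  exact hV ⟨_, (W.ι.injective h2).symm⟩

theorem eval_fiberPoly {K : Type*} [Field K] [Algebra ℂ K] (A : RatFunc ℂ) (v x : K) :
    (fiberPoly A v).eval x = aeval x A.num - v * aeval x A.denom := by
  simp [fiberPoly, eval_map_algebraMap]

theorem aeval_ι_denom_ne_zero {A U : RatFunc ℂ} (hU : Nonconst U) :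
    aeval (W.ι U) A.denom ≠ 0 := by
  rw [aeval_algHom_apply]
  exact (map_ne_zero W.ι).mpr
    ((map_ne_zero_iff _ (transcendental_iff_injective.mp hU.transcendental)).mpr A.denom_ne_zero)

variable {W} in
theorem eval_fiberPoly_smul {A U : RatFunc ℂ} (hU : Nonconst U) {g : W.Γ}
    (hg : g ∈ W.St (comp A U)) : (fiberPoly A (W.ι (comp A U))).eval (g • W.ι U) = 0 := by
  have h : (fiberPoly A (W.ι (comp A U))).eval (W.ι U) = 0 := by
    rw [eval_fiberPoly, algHom_comp, div_mul_cancel₀ _ (W.aeval_ι_denom_ne_zero hU), sub_self]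
  rw [eval_fiberPoly] at h ⊢
  rw [← smul_aeval, ← smul_aeval, ← W.mem_St.mp hg, ← smul_mul', ← smul_sub, h, smul_zero]

/-- The orbit of `U` under the group fixing `V`. -/
def orb (V U : RatFunc ℂ) : Set W.L := MulAction.orbit (W.St V) (W.ι U)

theorem finite_orb (V U : RatFunc ℂ) : (W.orb V U).Finite :=
  Set.finite_range fun g : W.St V => g • W.ι U

/-- The conjugates of `U` solve `A(x) = A ∘ U`, an equation of degree at most `degree A`. -/
theorem ncard_orb_le {A U : RatFunc ℂ} (hA : Nonconst A) (hU : Nonconst U) :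
    (W.orb (comp A U) U).ncard ≤ degree A := by
  classical
  have hV := comp_nonconst hA hU
  have h0 := W.fiberPoly_ne_zero A hV
  have hsub : W.orb (comp A U) U ⊆ (fiberPoly A (W.ι (comp A U))).roots.toFinset := by
    rintro _ ⟨g, rfl⟩
    rw [Finset.mem_coe, Multiset.mem_toFinset, mem_roots h0]
    exact eval_fiberPoly_smul hU g.2
  calc _ ≤ _ := Set.ncard_le_ncard hsub (Finset.finite_toSet _)
    _ ≤ _ := by
      rw [Set.ncard_coe_finset]
      exact (Multiset.toFinset_card_le _).trans ((card_roots' _).trans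
        (natDegree_fiberPoly_le _ _))

/-- The monic polynomial with the orbit of `U` as roots is invariant, so its coefficients are
functions of `A ∘ U`. Undoing the substitution `z ↦ U` gives a monic polynomial over `ℂ(A)` that
annihilates `z`, and `z` has degree `degree A` over `ℂ(A)`. -/
theorem le_ncard_orb {A U D : RatFunc ℂ} (hF : Nonconst F) (h : F = comp D (comp A U)) :
    degree A ≤ (W.orb (comp A U) U).ncard := by
  classical
  have hV := (nonconst_of_comp (h ▸ hF)).2
  have hA := (nonconst_of_comp hV).1
  have hU := (nonconst_of_comp hV).2
  set O : Finset W.L := (W.finite_orb (comp A U) U).toFinset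
  have hO : ∀ x, x ∈ O ↔ x ∈ W.orb (comp A U) U := fun x => Set.Finite.mem_toFinset _
  let Q : W.L[X] := ∏ x ∈ O, (X - Polynomial.C x)
  have hQ : Q.Monic := monic_prod_of_monic _ _ fun x _ => monic_X_sub_C x
  have hQdeg : Q.natDegree = O.card := by
    rw [natDegree_prod_of_monic _ _ fun x _ => monic_X_sub_C x]
    simp
  let ψ : RatFunc ℂ →ₐ[ℂ] W.L := W.ι.comp (substHom U hU.transcendental)
  have hψ : ψ RatFunc.X = W.ι U := by simp [ψ]
  let f : ℂ⟮A⟯ →+* W.L := (ψ : RatFunc ℂ →+* W.L).comp (algebraMap ℂ⟮A⟯ (RatFunc ℂ))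
  have hlift : Q ∈ lifts f := by
    rw [lifts_iff_coeff_lifts]
    intro n
    obtain ⟨B, hB⟩ := W.exists_of_fixed D (comp A U) h (Q.coeff n) (fun g hg => by
      rw [← coeff_smul]
      congr 1
      simp only [Q, Finset.smul_prod', smul_sub, smul_X, smul_C]
      refine Finset.prod_nbij (g • ·) (fun x hx => ?_) (fun x _ y _ hxy => ?_) (fun x hx => ?_)
        fun x _ => rfl
      · rw [hO] at hx ⊢
        exact MulAction.mem_orbit_of_mem_orbit (⟨g, hg⟩ : W.St (comp A U)) hx
      · exact MulAction.injective g hxy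
      · refine ⟨g⁻¹ • x, ?_, smul_inv_smul g x⟩
        rw [Finset.mem_coe, hO] at hx ⊢
        exact MulAction.mem_orbit_of_mem_orbit (⟨g, hg⟩⁻¹ : W.St (comp A U)) hx)
    refine ⟨⟨comp B A, (mem_adjoin_iff hA).mpr ⟨B, rfl⟩⟩, ?_⟩
    change W.ι (substHom U hU.transcendental (comp B A)) = Q.coeff n
    rw [← comp_eq_substHom _ hU, comp_assoc _ _ hU, hB]
  obtain ⟨q, hq, hqdeg, hqm⟩ := lifts_and_natDegree_eq_and_monic hlift hQ
  have hroot : aeval (RatFunc.X : RatFunc ℂ) q = 0 := by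
    refine ψ.injective ?_
    change ψ (aeval RatFunc.X q) = ψ 0
    have : ψ (aeval RatFunc.X q) = q.eval₂ f (ψ RatFunc.X) := by
      rw [aeval_def]
      exact hom_eval₂ q (algebraMap ℂ⟮A⟯ (RatFunc ℂ)) (ψ : RatFunc ℂ →+* W.L) RatFunc.X
    rw [this, ← eval_map, hq, hψ, map_zero, eval_prod]
    refine Finset.prod_eq_zero (i := W.ι U) ((hO _).mpr (MulAction.mem_orbit_self _)) (by simp)
  have hint : IsIntegral ℂ⟮A⟯ (RatFunc.X : RatFunc ℂ) := ⟨q, hqm, hroot⟩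
  have h1 : degree A = (minpoly ℂ⟮A⟯ (RatFunc.X : RatFunc ℂ)).natDegree := by
    rw [degree_eq_finrank, ← IntermediateField.adjoin.finrank hint,
      RatFunc.IntermediateField.adjoin_X, IntermediateField.finrank_top']
  rw [h1, Set.ncard_eq_toFinset_card _ (W.finite_orb _ _), ← hQdeg, ← hqdeg]
  exact natDegree_le_of_dvd (minpoly.dvd _ _ hroot) hqm.ne_zero

theorem ncard_orb {A U D : RatFunc ℂ} (hF : Nonconst F) (h : F = comp D (comp A U)) :
    (W.orb (comp A U) U).ncard = degree A := by
  have hV := (nonconst_of_comp (h ▸ hF)).2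
  exact le_antisymm (W.ncard_orb_le (nonconst_of_comp hV).1 (nonconst_of_comp hV).2)
    (W.le_ncard_orb hF h)

theorem relIndex_St {A U D : RatFunc ℂ} (hF : Nonconst F) (h : F = comp D (comp A U)) :
    (W.St U).relIndex (W.St (comp A U)) = degree A := by
  rw [← W.ncard_orb hF h, orb, ← MulAction.index_stabilizer]
  rfl

end GaloisFrame

/-! ### A frame from a Galois extension, by Lüroth's theorem. -/

section Construction

variable {F : RatFunc ℂ}

theorem finiteDimensional_adjoin (hF : Nonconst F) : FiniteDimensional ℂ⟮F⟯ (RatFunc ℂ) := by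
  refine FiniteDimensional.of_finrank_pos ?_
  rw [← degree_eq_finrank]
  exact Nat.pos_of_ne_zero (nonconst_iff_degree.mp hF)

variable {L : Type} [Field L] [Algebra ℂ⟮F⟯ L] (ι : RatFunc ℂ →ₐ[ℂ⟮F⟯] L)

theorem exists_comp_of_mem_adjoin {A U : RatFunc ℂ} (hF : Nonconst F) (hU : F = comp A U) {y : L}
    (hy : y ∈ ℂ⟮F⟯⟮ι U⟯) :
    ∃ B, y = ι (comp B U) := by
  have hUn : Nonconst U := (nonconst_of_comp (hU ▸ hF)).2
  rw [← Set.image_singleton, ← IntermediateField.adjoin_map] at hy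
  obtain ⟨x, hx, rfl⟩ := hy
  have hx' : x ∈ (ℂ⟮F⟯⟮U⟯).restrictScalars ℂ := hx
  rw [IntermediateField.restrictScalars_adjoin] at hx'
  have hle : adjoin ℂ ((ℂ⟮F⟯ : Set (RatFunc ℂ)) ∪ {U}) ≤ ℂ⟮U⟯ := by
    rw [adjoin_le_iff, Set.union_subset_iff]
    refine ⟨?_, by simp⟩
    have : ℂ⟮F⟯ ≤ ℂ⟮U⟯ := by
      rw [adjoin_simple_le_iff, mem_adjoin_iff hUn]; exact ⟨A, hU⟩
    exact this
  obtain ⟨B, rfl⟩ := (mem_adjoin_iff hUn).mp (hle hx')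
  exact ⟨B, rfl⟩

theorem smul_algHom_base (g : L ≃ₐ[ℂ⟮F⟯] L) :
    g • ι F = ι F := by
  have : ι F =
      algebraMap ℂ⟮F⟯ L ⟨F, mem_adjoin_simple_self ℂ F⟩ :=
    ι.commutes ⟨F, mem_adjoin_simple_self ℂ F⟩
  rw [this]
  exact g.commutes _

/-- The frame given by a Galois extension of `ℂ(F)` that contains `ℂ(z)`. -/
def galoisFrame [Algebra ℂ L] [IsScalarTower ℂ ℂ⟮F⟯ L] [FiniteDimensional ℂ⟮F⟯ L] [IsGalois ℂ⟮F⟯ L]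
    (hF : Nonconst F) : GaloisFrame F where
  L := L
  Γ := L ≃ₐ[ℂ⟮F⟯] L
  ι := ι.restrictScalars ℂ
  smul_algebraMap g c := (g.restrictScalars ℂ).commutes c
  smul_base := smul_algHom_base ι
  exists_of_fixed A U hU y hy := by
    refine exists_comp_of_mem_adjoin ι hF hU ?_
    rw [← IsGalois.fixedField_fixingSubgroup
      (ℂ⟮F⟯⟮ι U⟯), mem_fixedField_iff]
    intro g hg
    exact hy g (hg ⟨_, mem_adjoin_simple_self _ _⟩)
  exists_of_subgroup K hK := by
    set M := fixedField K with hM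
    have hM' : M.fixingSubgroup = K := fixingSubgroup_fixedField K
    -- The part of the fixed field of `K` inside `ℂ(z)`; its Lüroth generator is the required `U`.
    let M₀ : IntermediateField ℂ (RatFunc ℂ) := (M.comap ι).restrictScalars ℂ
    have hM₀ : ∀ x, x ∈ M₀ ↔ ι x ∈ M := fun x => Iff.rfl
    have hgen : M₀ = ℂ⟮RatFunc.Luroth.generator M₀⟯ := RatFunc.Luroth.eq_adjoin_generator
    set U := RatFunc.Luroth.generator M₀ with hU
    have hFM : F ∈ M₀ := by
      rw [hM₀, hM, mem_fixedField_iff]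
      exact fun g _ => smul_algHom_base ι g
    have hUn : Nonconst U := by
      rintro ⟨c, hc⟩
      rw [hgen, hc, adjoin_simple_eq_bot_iff.mpr (show RatFunc.C c ∈ ⊥ from ⟨c, rfl⟩)] at hFM
      obtain ⟨d, hd⟩ := hFM
      exact hF ⟨d, hd.symm⟩
    have hFU : F ∈ ℂ⟮U⟯ := hgen ▸ hFM
    obtain ⟨A, hA⟩ := (mem_adjoin_iff hUn).mp hFU
    refine ⟨A, U, hA, ?_⟩
    have hUM : ι U ∈ M := by
      rw [← hM₀, hgen]; exact mem_adjoin_simple_self _ _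
    apply le_antisymm
    · intro g hg
      exact (mem_fixedField_iff K _).mp hUM g hg
    · intro g hg
      rw [← hM']
      rintro ⟨y, hy⟩
      -- Since `K` contains the stabiliser of `z`, its whole fixed field lies in the image of
      -- `ℂ(z)`, so nothing was lost in passing to `M₀`.
      have hyX : y ∈ ℂ⟮F⟯⟮ι RatFunc.X⟯ := by
        rw [← IsGalois.fixedField_fixingSubgroup
          (ℂ⟮F⟯⟮ι RatFunc.X⟯), mem_fixedField_iff]
        intro f hf
        exact (mem_fixedField_iff K _).mp hy f (hK (hf ⟨_, mem_adjoin_simple_self _ _⟩))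
      obtain ⟨B, rfl⟩ := exists_comp_of_mem_adjoin ι hF (comp_X F).symm hyX
      have hB : comp B RatFunc.X ∈ M₀ := hy
      rw [hgen] at hB
      obtain ⟨D, hD⟩ := (mem_adjoin_iff hUn).mp hB
      change g (ι (comp B RatFunc.X)) = ι (comp B RatFunc.X)
      have e : ι (comp B RatFunc.X) = aeval (ι U) D.num / aeval (ι U) D.denom := by
        rw [hD]; exact algHom_comp (ι.restrictScalars ℂ) D U
      have hg' : (g.restrictScalars ℂ).toAlgHom (ι U) = ι U := hg
      have e2 : (g.restrictScalars ℂ).toAlgHom (aeval (ι U) D.num / aeval (ι U) D.denom) =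
          aeval (ι U) D.num / aeval (ι U) D.denom := by
        rw [map_div₀, ← aeval_algHom_apply, ← aeval_algHom_apply, hg']
      rw [e]
      exact e2

end Construction

end

section

open Polynomial

/-! ### The variety of algebraic relations between the solutions. -/

section Relations

/-- The ideal `I` of algebraic relations between the solutions, indexed by `O`, of
`P(x) - v Q(x) = 0`, where `v` is an indeterminate, together with the group `K` permuting the
solutions. -/
structure RelationIdeal (P Q : ℂ[X]) (O K : Type) [Fintype O] [Group K] [MulAction K O] where
  /-- the ideal of relations -/
  I : Ideal (MvPolynomial O ℂ)
  /-- the parameter, as a polynomial in the solutions -/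
  v : MvPolynomial O ℂ
  prime : I.IsPrime
  rename_mem : ∀ (k : K) (r : MvPolynomial O ℂ), r ∈ I → MvPolynomial.rename (k • ·) r ∈ I
  exists_of_invariant : ∀ r : MvPolynomial O ℂ, (∀ k : K, MvPolynomial.rename (k • ·) r = r) →
    ∃ p : ℂ[X], r - aeval v p ∈ I
  rename_v : ∀ k : K, MvPolynomial.rename (k • ·) v - v ∈ I
  exists_point : ∀ t : ℂ, ∃ e : O → ℂ, (∀ r ∈ I, MvPolynomial.aeval e r = 0) ∧
    MvPolynomial.aeval e v = t
  eq_prod : ∀ e : O → ℂ, (∀ r ∈ I, MvPolynomial.aeval e r = 0) →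
    P - Polynomial.C (MvPolynomial.aeval e v) * Q =
      Polynomial.C P.leadingCoeff * ∏ x, (X - Polynomial.C (e x))

variable {P Q : ℂ[X]} {O K : Type} [Fintype O] [Group K] [MulAction K O]

namespace RelationIdeal

variable (R : RelationIdeal P Q O K)

/-- The points over `t` of the variety of `I`. -/
def points (t : ℂ) : Set (O → ℂ) :=
  {e | (∀ r ∈ R.I, MvPolynomial.aeval e r = 0) ∧ MvPolynomial.aeval e R.v = t}

theorem aeval_rename {O K : Type} [Group K] [MulAction K O] (k : K) (e : O → ℂ) (r : MvPolynomial O ℂ) :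
    MvPolynomial.aeval e (MvPolynomial.rename (k • ·) r) =
      MvPolynomial.aeval (fun x => e (k • x)) r := by
  rw [MvPolynomial.aeval_rename]; rfl

theorem points_smul {t : ℂ} {e : O → ℂ} (he : e ∈ R.points t) (k : K) :
    (fun x => e (k • x)) ∈ R.points t := by
  refine ⟨fun r hr => ?_, ?_⟩
  · rw [← aeval_rename]; exact he.1 _ (R.rename_mem k r hr)
  · rw [← aeval_rename]
    have := he.1 _ (R.rename_v k)
    rw [map_sub, sub_eq_zero] at this
    rw [this, he.2]

theorem aeval_eq_eval {t : ℂ} {e : O → ℂ} (he : e ∈ R.points t) {r : MvPolynomial O ℂ} {p : ℂ[X]}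
    (hp : r - aeval R.v p ∈ R.I) : MvPolynomial.aeval e r = p.eval t := by
  have := he.1 _ hp
  rw [map_sub, sub_eq_zero] at this
  rw [this, ← aeval_algHom_apply, he.2, coe_aeval_eq_eval]

/-- A linear form that separates finitely many distinct points. -/
theorem exists_separating {α : Type*} [Finite α] (f : α → O → ℂ) :
    ∃ c : O → ℂ, ∀ a b, ∑ x, c x * f a x = ∑ x, c x * f b x → f a = f b := by
  classical
  have := Fintype.ofFinite α
  let g : MvPolynomial O ℂ := ∏ ab : {ab : α × α // f ab.1 ≠ f ab.2},
    ∑ x, MvPolynomial.X x * MvPolynomial.C (f ab.1.1 x - f ab.1.2 x)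
  have hg : g ≠ 0 := by
    refine Finset.prod_ne_zero_iff.mpr fun ab _ h => ab.2 (funext fun y => ?_)
    have := congrArg (MvPolynomial.eval (Pi.single y 1)) h
    simpa [Pi.single_apply, sub_eq_zero] using this
  obtain ⟨c, hc⟩ : ∃ c, MvPolynomial.eval c g ≠ 0 := by
    by_contra! h
    exact hg (MvPolynomial.funext fun c => by simpa using h c)
  refine ⟨c, fun a b hab => by_contra fun hne => hc ?_⟩
  rw [map_prod]
  refine Finset.prod_eq_zero (Finset.mem_univ ⟨(a, b), hne⟩) ?_
  simp [mul_sub, hab]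

/-- The linear form with coefficients `c`. -/
def linForm (c : O → ℂ) : MvPolynomial O ℂ := ∑ x, MvPolynomial.C (c x) * MvPolynomial.X x

@[simp] theorem aeval_linForm (c e : O → ℂ) :
    MvPolynomial.aeval e (linForm c) = ∑ x, c x * e x := by
  simp [linForm]

theorem rename_rename {O K : Type} [Group K] [MulAction K O] (k l : K) (r : MvPolynomial O ℂ) :
    MvPolynomial.rename (k • ·) (MvPolynomial.rename (l • ·) r) =
      MvPolynomial.rename ((k * l) • ·) r := by
  rw [MvPolynomial.rename_rename]
  congr 1
  ext x; simp [mul_smul]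

/-- `K` acts transitively on the points over `t`. -/
theorem exists_smul_eq [Finite K] {t : ℂ} {e e' : O → ℂ} (he : e ∈ R.points t)
    (he' : e' ∈ R.points t) : ∃ k : K, ∀ x, e' x = e (k • x) := by
  classical
  have := Fintype.ofFinite K
  -- One linear form separates `e'` (index `none`) from the translates of `e`.
  obtain ⟨c, hc⟩ := exists_separating (fun a : Option K => a.elim e' fun k x => e (k • x))
  let y : ℂ := ∑ x, c x * e' x
  -- This norm is invariant, so its value at a point depends on `t` only. It vanishes at `e'`, hence
  -- at `e`, and a vanishing factor exhibits `e'` as a translate.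
  let r : MvPolynomial O ℂ :=
    ∏ k : K, (MvPolynomial.C y - MvPolynomial.rename (k • ·) (linForm c))
  have hr : ∀ l : K, MvPolynomial.rename (l • ·) r = r := by
    intro l
    rw [map_prod]
    refine Fintype.prod_equiv (Equiv.mulLeft l) _ _ fun k => ?_
    rw [map_sub, MvPolynomial.rename_C, rename_rename]; rfl
  obtain ⟨p, hp⟩ := R.exists_of_invariant r hr
  have h1 := R.aeval_eq_eval he hp
  have h2 := R.aeval_eq_eval he' hp
  have h3 : MvPolynomial.aeval e' r = 0 := by
    rw [map_prod]
    refine Finset.prod_eq_zero (Finset.mem_univ 1) ?_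
    rw [map_sub, aeval_rename]
    simp [y]
  have h4 : MvPolynomial.aeval e r = 0 := h1.trans (h2.symm.trans h3)
  rw [map_prod, Finset.prod_eq_zero_iff] at h4
  obtain ⟨k, -, hk⟩ := h4
  refine ⟨k, fun x => ?_⟩
  rw [map_sub, aeval_rename, sub_eq_zero] at hk
  have := hc none (some k) (by simpa [y, MvPolynomial.algebraMap_eq] using hk)
  exact congrFun this x

end RelationIdeal

end Relations

end

section

open Polynomial Topology

/-! ### Regular values and local solutions of `P - t Q`. -/

section Fibers

variable {P Q : ℂ[X]}

/-- The polynomial `P - t Q`. -/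
def pencil (P Q : ℂ[X]) (t : ℂ) : ℂ[X] := P - Polynomial.C t * Q

/-- The values `t` for which `P - t Q` has simple roots only. -/
def Reg (P Q : ℂ[X]) : Set ℂ :=
  {t | ∀ z, (pencil P Q t).eval z = 0 → (pencil P Q t).derivative.eval z ≠ 0}

theorem eval_pencil (t z : ℂ) : (pencil P Q t).eval z = P.eval z - t * Q.eval z := by
  simp [pencil]

theorem eval_derivative_pencil (t z : ℂ) :
    (pencil P Q t).derivative.eval z = P.derivative.eval z - t * Q.derivative.eval z := by
  simp [pencil]

theorem eval_ne_zero_of_pencil (hPQ : IsCoprime P Q) {t z : ℂ}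
    (h : (pencil P Q t).eval z = 0) : Q.eval z ≠ 0 := by
  intro hQ
  obtain ⟨a, b, hab⟩ := hPQ
  have := congrArg (Polynomial.eval z) hab
  rw [eval_pencil, hQ, mul_zero, sub_zero] at h
  simp [h, hQ] at this

theorem natDegree_pencil (hd : Q.natDegree < P.natDegree) (t : ℂ) :
    (pencil P Q t).natDegree = P.natDegree := by
  rw [pencil]
  exact natDegree_sub_eq_left_of_natDegree_lt ((natDegree_C_mul_le _ _).trans_lt hd)

/-- The coefficient is the difference of the degrees times both leading coefficients, and the
degrees differ. -/
theorem coeff_wronskian_ne_zero (hd : Q.natDegree < P.natDegree) (hQ : Q ≠ 0) :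
    (P.derivative * Q - P * Q.derivative).coeff (P.natDegree - 1 + Q.natDegree) ≠ 0 := by
  have hP : P ≠ 0 := by rintro rfl; simp at hd
  intro hc
  have h1 : coeff (P.derivative * Q) (P.natDegree - 1 + Q.natDegree) =
      (P.natDegree : ℂ) * (P.leadingCoeff * Q.leadingCoeff) := by
    rw [coeff_mul_add_eq_of_natDegree_le (natDegree_derivative_le P) le_rfl, coeff_derivative]
    have : P.natDegree - 1 + 1 = P.natDegree := by omega
    rw [this]
    have : ((P.natDegree - 1 : ℕ) : ℂ) + 1 = P.natDegree := by exact_mod_cast this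
    rw [this, coeff_natDegree, coeff_natDegree]; ring
  have h2 : coeff (P * Q.derivative) (P.natDegree - 1 + Q.natDegree) =
      (Q.natDegree : ℂ) * (P.leadingCoeff * Q.leadingCoeff) := by
    rcases Nat.eq_zero_or_pos Q.natDegree with h0 | h0
    · rw [natDegree_eq_zero.mp h0 |>.choose_spec.symm]; simp
    · have : P.natDegree - 1 + Q.natDegree = P.natDegree + (Q.natDegree - 1) := by omega
      rw [this, coeff_mul_add_eq_of_natDegree_le le_rfl (natDegree_derivative_le Q), coeff_derivative]
      have : Q.natDegree - 1 + 1 = Q.natDegree := by omega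
      rw [this]
      have : ((Q.natDegree - 1 : ℕ) : ℂ) + 1 = Q.natDegree := by exact_mod_cast this
      rw [this, coeff_natDegree, coeff_natDegree]; ring
  rw [coeff_sub, h1, h2, ← sub_mul, mul_eq_zero, sub_eq_zero, Nat.cast_inj, mul_eq_zero,
    leadingCoeff_eq_zero, leadingCoeff_eq_zero] at hc
  rcases hc with hc | hc | hc
  · omega
  · exact hP hc
  · exact hQ hc

theorem wronskian_ne_zero (hd : Q.natDegree < P.natDegree) (hQ : Q ≠ 0) :
    P.derivative * Q - P * Q.derivative ≠ 0 := by
  intro h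
  exact coeff_wronskian_ne_zero hd hQ (by rw [h, coeff_zero])

/-- A multiple root `z` of `P - t Q` is a zero of the Wronskian, and it determines `t = P(z)/Q(z)`.
-/
theorem finite_compl_Reg (hPQ : IsCoprime P Q) (hd : Q.natDegree < P.natDegree) :
    (Reg P Q)ᶜ.Finite := by
  have hQ : Q ≠ 0 := by
    rintro rfl
    have := (isCoprime_zero_right.mp hPQ)
    rw [natDegree_eq_zero_of_isUnit this] at hd
    simp at hd
  have hW := wronskian_ne_zero hd hQ
  refine ((P.derivative * Q - P * Q.derivative).roots.toFinset.finite_toSet.image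
    fun z => P.eval z / Q.eval z).subset ?_
  intro t ht
  simp only [Reg, Set.mem_compl_iff, Set.mem_ofPred_eq, not_forall, not_not] at ht
  obtain ⟨z, h1, h2⟩ := ht
  have hQz := eval_ne_zero_of_pencil hPQ h1
  rw [eval_pencil, sub_eq_zero] at h1
  rw [eval_derivative_pencil, sub_eq_zero] at h2
  refine ⟨z, ?_, by rw [div_eq_iff hQz, h1]⟩
  rw [Finset.mem_coe, Multiset.mem_toFinset, mem_roots hW, IsRoot]
  simp only [eval_sub, eval_mul, h1, h2]; ring

theorem isOpen_Reg (hPQ : IsCoprime P Q) (hd : Q.natDegree < P.natDegree) : IsOpen (Reg P Q) := by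
  rw [← isClosed_compl_iff]; exact (finite_compl_Reg hPQ hd).isClosed

theorem isPreconnected_Reg (hPQ : IsCoprime P Q) (hd : Q.natDegree < P.natDegree) :
    IsPreconnected (Reg P Q) := by
  have := (finite_compl_Reg hPQ hd).countable.isConnected_compl_of_one_lt_rank (E := ℂ)
    (by rw [Complex.rank_real_complex]; exact Nat.one_lt_ofNat)
  rw [compl_compl] at this
  exact this.isPreconnected

/-- The leading coefficient of `P - t Q` does not involve `t`, and the others are affine in `t`. The
bound yields compactness of fibres over bounded sets, and polynomial growth. -/
theorem exists_root_bound (hd : Q.natDegree < P.natDegree) :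
    ∃ M : ℝ, 0 < M ∧ ∀ t z : ℂ, (pencil P Q t).eval z = 0 → ‖z‖ ≤ M * (1 + ‖t‖) := by
  have hP : P ≠ 0 := by rintro rfl; simp at hd
  set n := P.natDegree with hn
  have hl : 0 < ‖P.leadingCoeff‖ := norm_pos_iff.mpr (leadingCoeff_ne_zero.mpr hP)
  set S : ℝ := ∑ i ∈ Finset.range n, (‖P.coeff i‖ + ‖Q.coeff i‖) with hS
  have hS0 : 0 ≤ S := Finset.sum_nonneg fun i _ => by positivity
  refine ⟨S / ‖P.leadingCoeff‖ + 1, by positivity, fun t z hz => ?_⟩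
  rcases le_or_gt ‖z‖ 1 with h1 | h1
  · have : 0 ≤ S / ‖P.leadingCoeff‖ := by positivity
    nlinarith [norm_nonneg t]
  have hsum : P.leadingCoeff * z ^ n = -∑ i ∈ Finset.range n, (P.coeff i - t * Q.coeff i) * z ^ i := by
    have e : (pencil P Q t).eval z = ∑ i ∈ Finset.range (n + 1), (P.coeff i - t * Q.coeff i) * z ^ i := by
      rw [eval_eq_sum_range' (n := n + 1) (by rw [natDegree_pencil hd]; omega)]
      simp [pencil]
    rw [hz, Finset.sum_range_succ, coeff_eq_zero_of_natDegree_lt hd, mul_zero, sub_zero] at e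
    rw [eq_neg_iff_add_eq_zero, add_comm]; exact e.symm
  have hn0 : n = n - 1 + 1 := by omega
  have key : ‖P.leadingCoeff‖ * ‖z‖ ^ n ≤ S * (1 + ‖t‖) * ‖z‖ ^ (n - 1) := by
    rw [← norm_pow, ← norm_mul, hsum, norm_neg]
    refine (norm_sum_le _ _).trans ?_
    rw [hS, Finset.sum_mul, Finset.sum_mul]
    refine Finset.sum_le_sum fun i hi => ?_
    rw [norm_mul, norm_pow]
    refine mul_le_mul ?_ (pow_le_pow_right₀ h1.le (by have := Finset.mem_range.mp hi; omega))
      (by positivity) (by positivity)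
    refine (norm_sub_le _ _).trans ?_
    rw [norm_mul]
    nlinarith [norm_nonneg t, norm_nonneg (P.coeff i), norm_nonneg (Q.coeff i)]
  have hzp : 0 < ‖z‖ ^ (n - 1) := by positivity
  have : ‖P.leadingCoeff‖ * ‖z‖ ≤ S * (1 + ‖t‖) := by
    rw [hn0, pow_succ, ← mul_assoc, mul_right_comm, Nat.add_sub_cancel] at key
    exact le_of_mul_le_mul_right key hzp
  have h2 : ‖z‖ ≤ S / ‖P.leadingCoeff‖ * (1 + ‖t‖) := by
    rw [div_mul_eq_mul_div, le_div_iff₀ hl, mul_comm]; exact this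
  nlinarith [norm_nonneg t]

/-- A simple root depends nicely on the parameter. -/
theorem exists_local_root (hPQ : IsCoprime P Q) {t₀ z₀ : ℂ} (ht : t₀ ∈ Reg P Q)
    (hz : (pencil P Q t₀).eval z₀ = 0) :
    ∃ g : ℂ → ℂ, g t₀ = z₀ ∧ DifferentiableAt ℂ g t₀ ∧
      ∀ᶠ t in 𝓝 t₀, ContinuousAt g t ∧ (pencil P Q t).eval (g t) = 0 := by
  have hQ := eval_ne_zero_of_pencil hPQ hz
  have h1 := ht z₀ hz
  have hval : P.eval z₀ / Q.eval z₀ = t₀ := by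
    rw [eval_pencil, sub_eq_zero] at hz; rw [div_eq_iff hQ, hz]
  -- The root function is the local inverse of `P / Q`, whose derivative at `z₀` is nonzero because
  -- the root is simple.
  have hder : HasStrictDerivAt (fun z => P.eval z / Q.eval z)
      ((P.derivative.eval z₀ * Q.eval z₀ - P.eval z₀ * Q.derivative.eval z₀) / Q.eval z₀ ^ 2) z₀ :=
    (P.hasStrictDerivAt z₀).fun_div (Q.hasStrictDerivAt z₀) hQ
  have hne : (P.derivative.eval z₀ * Q.eval z₀ - P.eval z₀ * Q.derivative.eval z₀) /
      Q.eval z₀ ^ 2 ≠ 0 := by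
    refine div_ne_zero ?_ (pow_ne_zero 2 hQ)
    rw [eval_derivative_pencil] at h1
    rw [eval_pencil, sub_eq_zero] at hz
    rw [hz]
    have : P.derivative.eval z₀ * Q.eval z₀ - t₀ * Q.eval z₀ * Q.derivative.eval z₀ =
      (P.derivative.eval z₀ - t₀ * Q.derivative.eval z₀) * Q.eval z₀ := by ring
    rw [this]
    exact mul_ne_zero h1 hQ
  let φ := (hder.hasStrictFDerivAt_equiv hne).toOpenPartialHomeomorph _
  have hφ : ∀ z, φ z = P.eval z / Q.eval z := fun z => rfl
  have hs : z₀ ∈ φ.source := HasStrictFDerivAt.mem_toOpenPartialHomeomorph_source _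
  have htar : t₀ ∈ φ.target := by rw [← hval, ← hφ]; exact φ.map_source hs
  have hsymm : φ.symm t₀ = z₀ := by rw [← hval, ← hφ]; exact φ.left_inv hs
  have hmem : ∀ᶠ t in 𝓝 t₀, t ∈ φ.target := φ.open_target.mem_nhds htar
  have hcont : ∀ t ∈ φ.target, ContinuousAt φ.symm t := fun t ht => φ.symm.continuousAt ht
  refine ⟨φ.symm, hsymm, ?_, ?_⟩
  · have := (hder.to_localInverse hne).hasDerivAt.differentiableAt
    rw [hval] at this
    exact this
  · have hQe : ∀ᶠ t in 𝓝 t₀, Q.eval (φ.symm t) ≠ 0 := by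
      have : ContinuousAt (fun t => Q.eval (φ.symm t)) t₀ :=
        Q.continuous.continuousAt.comp (hcont t₀ htar)
      refine this.eventually_ne ?_
      rw [hsymm]; exact hQ
    filter_upwards [hmem, hQe] with t ht hQt
    refine ⟨hcont t ht, ?_⟩
    have := φ.right_inv ht
    rw [hφ, div_eq_iff hQt] at this
    rw [eval_pencil, this, sub_self]

end Fibers

end

section

open Polynomial Topology

/-! ### Continuation of tuples of solutions along paths. -/

section Continuation

variable {P Q : ℂ[X]} {O K : Type} [Fintype O] [Group K] [MulAction K O]

namespace RelationIdeal

variable (R : RelationIdeal P Q O K)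

theorem eval_pencil_eq_zero_iff (hP : P ≠ 0) {t : ℂ} {e : O → ℂ} (he : e ∈ R.points t) {z : ℂ} :
    (pencil P Q t).eval z = 0 ↔ ∃ x, z = e x := by
  have h := R.eq_prod e he.1
  rw [he.2] at h
  rw [pencil, h, eval_mul, eval_C, mul_eq_zero, or_iff_right (leadingCoeff_ne_zero.mpr hP),
    eval_prod, Finset.prod_eq_zero_iff]
  simp [sub_eq_zero]

theorem injective_of_mem_points {t : ℂ} (ht : t ∈ Reg P Q) {e : O → ℂ}
    (he : e ∈ R.points t) : Function.Injective e := by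
  classical
  intro x y hxy
  by_contra hne
  have h := R.eq_prod e he.1
  rw [he.2, ← Finset.mul_prod_erase _ _ (Finset.mem_univ x),
    ← Finset.mul_prod_erase _ _ (Finset.mem_erase.mpr ⟨Ne.symm hne, Finset.mem_univ y⟩)] at h
  have hp : pencil P Q t = (X - C (e x)) * (X - C (e x)) * (C P.leadingCoeff *
      ∏ z ∈ (Finset.univ.erase x).erase y, (X - C (e z))) := by
    rw [pencil, h, ← hxy]; ring
  refine ht (e x) (by rw [hp]; simp) ?_
  rw [hp]
  simp

theorem isClosed_points : IsClosed {p : ℂ × (O → ℂ) | p.2 ∈ R.points p.1} := by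
  have hcont : ∀ r : MvPolynomial O ℂ, Continuous fun p : ℂ × (O → ℂ) =>
      MvPolynomial.aeval p.2 r := fun r => by
    have := (MvPolynomial.continuous_eval r).comp (continuous_snd (X := ℂ) (Y := O → ℂ))
    simpa [Function.comp_def, MvPolynomial.coe_aeval_eq_eval] using this
  have : {p : ℂ × (O → ℂ) | p.2 ∈ R.points p.1} =
      (⋂ r ∈ R.I, {p | MvPolynomial.aeval p.2 r = 0}) ∩
        {p | MvPolynomial.aeval p.2 R.v = p.1} := by
    ext p; simp [points]
  rw [this]
  exact (isClosed_biInter fun r _ => isClosed_eq (hcont r) continuous_const).inter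
    (isClosed_eq (hcont R.v) continuous_fst)

/-- Over a regular value the variety is open among all tuples of roots. If bad tuples accumulated at
`e`, genuine points over the same parameters would, by compactness, converge along an ultrafilter to
some `e₁` over `t₀`. After translation by `K` that limit is `e`; as the entries of `e` are distinct,
the bad tuples must eventually coincide with the translated genuine points. -/
theorem eventually_mem_points [Finite K] (hd : Q.natDegree < P.natDegree) {t₀ : ℂ}
    (ht : t₀ ∈ Reg P Q) {e : O → ℂ} (he : e ∈ R.points t₀) :
    ∀ᶠ p : ℂ × (O → ℂ) in 𝓝 (t₀, e), (∀ x, (pencil P Q p.1).eval (p.2 x) = 0) →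
      p.2 ∈ R.points p.1 := by
  have hP : P ≠ 0 := by rintro rfl; simp at hd
  by_contra hcon
  rw [Filter.not_eventually] at hcon
  have hne : (𝓝 (t₀, e) ⊓ Filter.principal {p : ℂ × (O → ℂ) |
      ¬ ((∀ x, (pencil P Q p.1).eval (p.2 x) = 0) → p.2 ∈ R.points p.1)}).NeBot :=
    Filter.frequently_mem_iff_neBot.mp hcon
  obtain ⟨𝒰, hle⟩ := @Ultrafilter.exists_le _ _ hne
  have h𝒰 : (𝒰 : Filter _) ≤ 𝓝 (t₀, e) := hle.trans inf_le_left
  have hbad : ∀ᶠ p in (𝒰 : Filter (ℂ × (O → ℂ))),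
      ¬ ((∀ x, (pencil P Q p.1).eval (p.2 x) = 0) → p.2 ∈ R.points p.1) :=
    hle.trans inf_le_right (Filter.mem_principal_self _)
  choose s hs using R.exists_point
  have hs' : ∀ t, s t ∈ R.points t := hs
  obtain ⟨M, hM, hbound⟩ := exists_root_bound hd
  have hfst : Filter.Tendsto (fun p : ℂ × (O → ℂ) => p.1) 𝒰 (𝓝 t₀) :=
    (continuous_fst.tendsto (t₀, e)).mono_left h𝒰
  have hsnd : Filter.Tendsto (fun p : ℂ × (O → ℂ) => p.2) 𝒰 (𝓝 e) :=
    (continuous_snd.tendsto (t₀, e)).mono_left h𝒰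
  have hball : ∀ᶠ p in (𝒰 : Filter (ℂ × (O → ℂ))),
      s p.1 ∈ Metric.closedBall (0 : O → ℂ) (M * (1 + (‖t₀‖ + 1))) := by
    have : ∀ᶠ p in (𝒰 : Filter (ℂ × (O → ℂ))), ‖p.1‖ < ‖t₀‖ + 1 :=
      hfst.norm.eventually (gt_mem_nhds (by linarith))
    filter_upwards [this] with p hp
    rw [mem_closedBall_zero_iff, pi_norm_le_iff_of_nonneg (by positivity)]
    intro x
    refine (hbound p.1 _ ((R.eval_pencil_eq_zero_iff hP (hs' p.1)).mpr ⟨x, rfl⟩)).trans ?_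
    gcongr
  have hcompact := isCompact_closedBall (0 : O → ℂ) (M * (1 + (‖t₀‖ + 1)))
  obtain ⟨e₁, hlim⟩ : ∃ e₁, Filter.Tendsto (fun p : ℂ × (O → ℂ) => s p.1) 𝒰 (𝓝 e₁) := by
    generalize Metric.closedBall (0 : O → ℂ) (M * (1 + (‖t₀‖ + 1))) = B at *
    obtain ⟨e₁, -, he₁⟩ := isCompact_iff_ultrafilter_le_nhds'.mp hcompact
      (Ultrafilter.map (fun p : ℂ × (O → ℂ) => s p.1) 𝒰) hball
    exact ⟨e₁, he₁⟩
  have he₁p : e₁ ∈ R.points t₀ := by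
    have := R.isClosed_points.mem_of_tendsto (hfst.prodMk_nhds hlim)
      (Filter.Eventually.of_forall fun p => hs' p.1)
    exact this
  obtain ⟨k, hk⟩ := R.exists_smul_eq he₁p he
  have hinj := R.injective_of_mem_points ht he
  have hlim2 : ∀ x, Filter.Tendsto (fun p : ℂ × (O → ℂ) => s p.1 (k • x)) 𝒰 (𝓝 (e x)) := by
    intro x
    rw [hk x]
    exact (tendsto_pi_nhds.mp hlim) (k • x)
  have hsep : ∀ᶠ p in (𝒰 : Filter (ℂ × (O → ℂ))), ∀ x y, x ≠ y → p.2 x ≠ s p.1 (k • y) := by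
    rw [Filter.eventually_all]; intro x
    rw [Filter.eventually_all]; intro y
    by_cases hxy : x = y
    · exact Filter.Eventually.of_forall fun p h => absurd hxy h
    · have h1 := (tendsto_pi_nhds.mp hsnd) x
      filter_upwards [(h1.sub (hlim2 y)).eventually_ne
        (sub_ne_zero.mpr fun h => hxy (hinj h))] with p hp _ using sub_ne_zero.mp hp
  obtain ⟨p, hp1, hp2⟩ := (hbad.and hsep).exists
  apply hp1
  intro hroot
  have hq := R.points_smul (hs' p.1) k
  convert hq using 1
  ext x
  obtain ⟨y, hy⟩ := (R.eval_pencil_eq_zero_iff hP hq).mp (hroot x)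
  by_cases hxy : x = y
  · rw [hy, hxy]
  · exact absurd hy (hp2 x y hxy)

end RelationIdeal

/-- The tuple `e` of solutions over `t` is continued to the tuple `e'` over `t'` along some path. -/
def Continues (P Q : ℂ[X]) (t : ℂ) (e : O → ℂ) (t' : ℂ) (e' : O → ℂ) : Prop :=
  ∃ γ : Path t t', (∀ τ, γ τ ∈ Reg P Q) ∧ ∃ Γ : ∀ x, Path (e x) (e' x),
    ∀ x τ, (pencil P Q (γ τ)).eval (Γ x τ) = 0

theorem Continues.refl {O : Type} {t : ℂ} (ht : t ∈ Reg P Q) {e : O → ℂ}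
    (he : ∀ x, (pencil P Q t).eval (e x) = 0) : Continues P Q t e t e :=
  ⟨Path.refl t, fun _ => ht, fun x => Path.refl (e x), fun x _ => he x⟩

theorem Continues.symm {O : Type} {t t' : ℂ} {e e' : O → ℂ} (h : Continues P Q t e t' e') :
    Continues P Q t' e' t e := by
  obtain ⟨γ, h1, Γ, h2⟩ := h
  exact ⟨γ.symm, fun τ => h1 _, fun x => (Γ x).symm, fun x τ => h2 x _⟩

theorem Continues.trans {O : Type} {t t' t'' : ℂ} {e e' e'' : O → ℂ}
    (h : Continues P Q t e t' e') (h' : Continues P Q t' e' t'' e'') :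
    Continues P Q t e t'' e'' := by
  obtain ⟨γ, h1, Γ, h2⟩ := h
  obtain ⟨γ', h1', Γ', h2'⟩ := h'
  refine ⟨γ.trans γ', fun τ => ?_, fun x => (Γ x).trans (Γ' x), fun x τ => ?_⟩
  · rw [Path.trans_apply]; split_ifs
    exacts [h1 _, h1' _]
  · rw [Path.trans_apply, Path.trans_apply]; split_ifs
    exacts [h2 _ _, h2' _ _]

theorem Continues.comp {O O' : Type} {t t' : ℂ} {e e' : O → ℂ} (h : Continues P Q t e t' e')
    (f : O' → O) : Continues P Q t (fun x => e (f x)) t' (fun x => e' (f x)) := by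
  obtain ⟨γ, h1, Γ, h2⟩ := h
  exact ⟨γ, h1, fun x => Γ (f x), fun x τ => h2 _ τ⟩

/-- Algebraic relations persist under continuation. -/
theorem Continues.mem_points [Finite K] (R : RelationIdeal P Q O K)
    (hd : Q.natDegree < P.natDegree) {t t' : ℂ} {e e' : O → ℂ} (h : Continues P Q t e t' e')
    (he : e ∈ R.points t) : e' ∈ R.points t' := by
  obtain ⟨γ, h1, Γ, h2⟩ := h
  let f : unitInterval → ℂ × (O → ℂ) := fun τ => (γ τ, fun x => Γ x τ)
  have hf : Continuous f := by
    refine γ.continuous.prodMk (continuous_pi fun x => (Γ x).continuous)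
  -- Closed because the variety is closed, open by `eventually_mem_points`.
  let S : Set unitInterval := {τ | (f τ).2 ∈ R.points (f τ).1}
  have hS : IsClopen S := by
    refine ⟨R.isClosed_points.preimage hf, isOpen_iff_mem_nhds.mpr fun τ hτ => ?_⟩
    filter_upwards [hf.continuousAt.eventually (R.eventually_mem_points hd (h1 τ) hτ)] with σ hσ
    exact hσ fun x => h2 x σ
  have h0 : (0 : unitInterval) ∈ S := by
    change (fun x => Γ x 0) ∈ R.points (γ 0)
    simpa using he
  have hu := hS.eq_univ ⟨0, h0⟩
  have h1' : (1 : unitInterval) ∈ S := hu ▸ Set.mem_univ _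
  have h1'' : (fun x => Γ x 1) ∈ R.points (γ 1) := h1'
  simpa using h1''

theorem exists_local_sections (hPQ : IsCoprime P Q) (hd : Q.natDegree < P.natDegree) {t₀ : ℂ}
    (ht : t₀ ∈ Reg P Q) {e : O → ℂ} (he : ∀ x, (pencil P Q t₀).eval (e x) = 0) :
    ∃ z : O → ℂ → ℂ, (∀ x, z x t₀ = e x) ∧ (∀ x, DifferentiableAt ℂ (z x) t₀) ∧
      ∃ ε > 0, ∀ t ∈ Metric.ball t₀ ε, t ∈ Reg P Q ∧ ∀ x, ContinuousAt (z x) t ∧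
        (pencil P Q t).eval (z x t) = 0 := by
  choose z hz1 hz2 hz3 using fun x => exists_local_root hPQ ht (he x)
  refine ⟨z, hz1, hz2, ?_⟩
  have : ∀ᶠ t in 𝓝 t₀, t ∈ Reg P Q ∧ ∀ x, ContinuousAt (z x) t ∧
      (pencil P Q t).eval (z x t) = 0 :=
    ((isOpen_Reg hPQ hd).eventually_mem ht).and (Filter.eventually_all.mpr hz3)
  obtain ⟨ε, hε, h⟩ := Metric.eventually_nhds_iff_ball.mp this
  exact ⟨ε, hε, fun t => h t⟩

theorem continues_of_sections {O : Type} {t₀ : ℂ} {z : O → ℂ → ℂ} {ε : ℝ}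
    (h : ∀ t ∈ Metric.ball t₀ ε, t ∈ Reg P Q ∧ ∀ x, ContinuousAt (z x) t ∧
        (pencil P Q t).eval (z x t) = 0) {t t' : ℂ} (ht : t ∈ Metric.ball t₀ ε)
    (ht' : t' ∈ Metric.ball t₀ ε) :
    Continues P Q t (fun x => z x t) t' (fun x => z x t') := by
  obtain ⟨γ, hγ⟩ := ((convex_ball t₀ ε).isPathConnected ⟨t, ht⟩).joinedIn t ht t' ht'
  refine ⟨γ, fun τ => (h _ (hγ τ)).1, fun x => ⟨⟨fun τ => z x (γ τ), ?_⟩, by simp, by simp⟩,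
    fun x τ => ((h _ (hγ τ)).2 x).2⟩
  rw [continuous_iff_continuousAt]
  intro τ
  exact ContinuousAt.comp (f := γ) ((h _ (hγ τ)).2 x).1 γ.continuous.continuousAt

/-- The set reachable from `w` is open and closed in the connected set `Reg P Q`: on a small ball,
any continued tuple is a translate of one family of local sections and moves along with it. -/
theorem RelationIdeal.exists_continues [Finite K] (R : RelationIdeal P Q O K) (hPQ : IsCoprime P Q)
    (hd : Q.natDegree < P.natDegree) {w : ℂ} (hw : w ∈ Reg P Q) {e₀ : O → ℂ}
    (he₀ : e₀ ∈ R.points w) {t : ℂ} (ht : t ∈ Reg P Q) :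
    ∃ e ∈ R.points t, Continues P Q w e₀ t e := by
  have hP : P ≠ 0 := by rintro rfl; simp at hd
  have hroot : ∀ {t : ℂ} {e : O → ℂ}, e ∈ R.points t → ∀ x, (pencil P Q t).eval (e x) = 0 :=
    fun he x => (R.eval_pencil_eq_zero_iff hP he).mpr ⟨x, rfl⟩
  suffices h : ∃ e, Continues P Q w e₀ t e by
    obtain ⟨e, he⟩ := h
    exact ⟨e, he.mem_points R hd he₀, he⟩
  let S : Set ℂ := {t | ∃ e, Continues P Q w e₀ t e}
  have hloc : ∀ t₀ ∈ Reg P Q, ∃ ε > 0, ∀ t ∈ Metric.ball t₀ ε, ∀ t' ∈ Metric.ball t₀ ε,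
      t ∈ S → t' ∈ S := by
    intro t₀ ht₀
    obtain ⟨s, hs⟩ := R.exists_point t₀
    obtain ⟨z, hz1, -, ε, hε, h⟩ := exists_local_sections hPQ hd ht₀ (hroot hs)
    refine ⟨ε, hε, fun t ht t' ht' hS => ?_⟩
    obtain ⟨e, he⟩ := hS
    have he' := he.mem_points R hd he₀
    have hzt : (fun x => z x t) ∈ R.points t := by
      have := continues_of_sections (t₀ := t₀) h (Metric.mem_ball_self hε) ht
      simp only [hz1] at this
      exact this.mem_points R hd hs
    obtain ⟨k, hk⟩ := R.exists_smul_eq hzt he'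
    have hc := (continues_of_sections (t₀ := t₀) h ht ht').comp (fun x => k • x)
    have hek : e = fun x => z (k • x) t := funext hk
    exact ⟨_, he.trans (hek ▸ hc)⟩
  have hsub : Reg P Q ⊆ S := by
    refine (isPreconnected_Reg hPQ hd).subset_of_closure_inter_subset (u := interior S)
      isOpen_interior ?_ ?_ |>.trans interior_subset
    · obtain ⟨ε, hε, h⟩ := hloc w hw
      refine ⟨w, hw, mem_interior_iff_mem_nhds.mpr (Filter.mem_of_superset
        (Metric.ball_mem_nhds w hε) fun t ht => h w (Metric.mem_ball_self hε) t ht ?_)⟩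
      exact ⟨e₀, Continues.refl hw (hroot he₀)⟩
    · rintro t₀ ⟨h1, h2⟩
      obtain ⟨ε, hε, h⟩ := hloc t₀ h2
      obtain ⟨t, ht, hd⟩ := Metric.mem_closure_iff.mp h1 ε hε
      refine mem_interior_iff_mem_nhds.mpr (Filter.mem_of_superset
        (Metric.ball_mem_nhds t₀ hε) fun t' ht' => h t ?_ t' ht' (interior_subset ht))
      rw [Metric.mem_ball']; exact hd
  exact hsub ht

end Continuation

end

section

open Polynomial Topology

/-! ### Holomorphic functions of polynomial growth. -/

section Analysis

/-- An entire function of polynomial growth is a polynomial. -/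
theorem exists_polynomial_of_growth {f : ℂ → ℂ} (hf : Differentiable ℂ f) {M : ℝ} {N : ℕ}
    (hM : ∀ z, ‖f z‖ ≤ M * (1 + ‖z‖) ^ N) : ∃ p : ℂ[X], ∀ z, f z = p.eval z := by
  have hM0 : 0 ≤ M := by
    have := hM 0
    simp only [norm_zero, add_zero, one_pow, mul_one] at this
    exact (norm_nonneg _).trans this
  have hder : ∀ n, N < n → iteratedDeriv n f 0 = 0 := by
    intro n hn
    -- Cauchy's estimate on the circle of radius `R`; letting `R` grow kills the derivatives of
    -- order above `N`.
    have hle : ∀ R : ℝ, 1 ≤ R → ‖iteratedDeriv n f 0‖ ≤ (n.factorial * (M * 2 ^ N)) / R := by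
      intro R hR
      have hR0 : 0 < R := by linarith
      have h := Complex.norm_iteratedDeriv_le_of_forall_mem_sphere_norm_le (c := 0) (R := R)
        (C := M * (2 * R) ^ N) n hR0 hf.diffContOnCl (fun z hz => by
          refine (hM z).trans ?_
          have : ‖z‖ = R := by simpa using hz
          rw [this]
          gcongr
          linarith)
      refine h.trans ?_
      rw [div_le_div_iff₀ (by positivity) hR0, mul_pow]
      have : R ^ N * R ≤ R ^ n := by
        rw [← pow_succ]; exact pow_le_pow_right₀ hR hn
      calc n.factorial * (M * (2 ^ N * R ^ N)) * R = n.factorial * (M * 2 ^ N) * (R ^ N * R) := by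
            ring
        _ ≤ _ := by gcongr
    have hlim : Filter.Tendsto (fun R : ℝ => (n.factorial * (M * 2 ^ N)) / R) Filter.atTop (𝓝 0) :=
      Filter.Tendsto.div_atTop tendsto_const_nhds Filter.tendsto_id
    have := ge_of_tendsto hlim (Filter.eventually_atTop.mpr ⟨1, hle⟩)
    exact norm_le_zero_iff.mp this
  refine ⟨∑ n ∈ Finset.range (N + 1), C ((n.factorial : ℂ)⁻¹ * iteratedDeriv n f 0) * X ^ n,
    fun z => ?_⟩
  rw [← Complex.taylorSeries_eq_of_entire' 0 z hf, tsum_eq_sum (s := Finset.range (N + 1))]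
  · simp [eval_finsetSum]
  · intro n hn
    rw [hder n (by simpa using hn)]; simp

/-- A function that is holomorphic off a finite set and of polynomial growth is rational. -/
theorem exists_rational_of_growth {f : ℂ → ℂ} {B : Set ℂ} (hB : B.Finite)
    (hf : ∀ z, z ∉ B → DifferentiableAt ℂ f z) {M : ℝ} {N : ℕ}
    (hM : ∀ z, ‖f z‖ ≤ M * (1 + ‖z‖) ^ N) :
    ∃ m p : ℂ[X], (∀ z, z ∉ B → m.eval z ≠ 0) ∧ ∀ z, m.eval z * f z = p.eval z := by
  classical
  have hM0 : 0 ≤ M := by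
    have := hM 0
    simp only [norm_zero, add_zero, one_pow, mul_one] at this
    exact (norm_nonneg _).trans this
  set S := hB.toFinset
  -- The exponent two makes the product with `f` differentiable, with derivative zero, at each
  -- exceptional point: `f` is bounded there, but its value may be arbitrary.
  let m : ℂ[X] := ∏ b ∈ S, (X - C b) ^ 2
  have hm : ∀ z, z ∉ B → m.eval z ≠ 0 := by
    intro z hz
    rw [eval_prod]
    refine Finset.prod_ne_zero_iff.mpr fun b hb => ?_
    have : z ≠ b := fun h => hz (by rw [h]; exact hB.mem_toFinset.mp hb)
    simpa [sub_eq_zero] using this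
  have hgrow : ∃ M' N', ∀ z, ‖m.eval z‖ ≤ M' * (1 + ‖z‖) ^ N' := by
    refine ⟨∑ i ∈ Finset.range (m.natDegree + 1), ‖m.coeff i‖, m.natDegree, fun z => ?_⟩
    rw [eval_eq_sum_range, Finset.sum_mul]
    refine (norm_sum_le _ _).trans (Finset.sum_le_sum fun i hi => ?_)
    rw [norm_mul, norm_pow]
    have h1 : ‖z‖ ^ i ≤ (1 + ‖z‖) ^ i := pow_le_pow_left₀ (norm_nonneg _) (by linarith) i
    have h2 : (1 + ‖z‖) ^ i ≤ (1 + ‖z‖) ^ m.natDegree :=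
      pow_le_pow_right₀ (by linarith [norm_nonneg z])
        (Nat.lt_succ_iff.mp (Finset.mem_range.mp hi))
    gcongr
    exact h1.trans h2
  obtain ⟨M', N', hM'⟩ := hgrow
  have hd : Differentiable ℂ fun z => m.eval z * f z := by
    intro b
    by_cases hb : b ∈ B
    · have hbS : b ∈ S := hB.mem_toFinset.mpr hb
      let m' : ℂ[X] := ∏ b ∈ S.erase b, (X - C b) ^ 2
      have hmm : ∀ z, m.eval z = (z - b) ^ 2 * m'.eval z := by
        intro z
        have : m = (X - C b) ^ 2 * m' := (Finset.mul_prod_erase S _ hbS).symm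
        rw [this]; simp
      refine HasDerivAt.differentiableAt (f' := 0) ?_
      rw [hasDerivAt_iff_isLittleO]
      have h0 : m.eval b * f b = 0 := by rw [hmm]; simp
      simp only [h0, sub_zero, smul_zero]
      have hbd : (fun z => m'.eval z * f z) =O[𝓝 b] (fun _ => (1 : ℂ)) := by
        refine Asymptotics.IsBigO.of_bound
          ((‖m'.eval b‖ + 1) * (M * (1 + (‖b‖ + 1)) ^ N)) ?_
        have e1 : ∀ᶠ z in 𝓝 b, ‖m'.eval z‖ < ‖m'.eval b‖ + 1 :=
          m'.continuous.norm.continuousAt.eventually (gt_mem_nhds (by linarith))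
        have e2 : ∀ᶠ z in 𝓝 b, ‖z‖ < ‖b‖ + 1 :=
          continuous_norm.continuousAt.eventually (gt_mem_nhds (by linarith))
        filter_upwards [e1, e2] with z h1 h2
        rw [norm_mul, norm_one, mul_one]
        refine mul_le_mul h1.le ((hM z).trans ?_) (norm_nonneg _) (by positivity)
        gcongr
      have hlit : (fun z : ℂ => (z - b) ^ 2) =o[𝓝 b] fun z => z - b := by
        have := Asymptotics.isLittleO_pow_sub_sub b one_lt_two
        refine Asymptotics.isLittleO_norm_left.mp ?_
        simpa only [norm_pow] using this
      have := hlit.mul_isBigO hbd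
      refine this.congr (fun z => ?_) fun z => by ring
      rw [hmm]; ring
    · exact (m.differentiableAt).mul (hf b hb)
  obtain ⟨p, hp⟩ := exists_polynomial_of_growth hd (M := M' * M) (N := N' + N) (fun z => by
    rw [norm_mul]
    calc _ ≤ (M' * (1 + ‖z‖) ^ N') * (M * (1 + ‖z‖) ^ N) :=
          mul_le_mul (hM' z) (hM z) (norm_nonneg _) ((norm_nonneg _).trans (hM' z))
      _ = _ := by rw [pow_add]; ring)
  exact ⟨m, p, hm, hp⟩

theorem mvPolynomial_growth {O : Type} (r : MvPolynomial O ℂ) (M : ℝ) :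
    ∃ M' N, ∀ (t : ℂ) (e : O → ℂ), (∀ x, ‖e x‖ ≤ M * (1 + ‖t‖)) →
      ‖MvPolynomial.aeval e r‖ ≤ M' * (1 + ‖t‖) ^ N := by
  induction r using MvPolynomial.induction_on with
  | C a => exact ⟨‖a‖, 0, fun t e _ => by simp⟩
  | add p q hp hq =>
    obtain ⟨a, n, ha⟩ := hp
    obtain ⟨b, m, hb⟩ := hq
    refine ⟨|a| + |b|, max n m, fun t e he => ?_⟩
    have h1 : 1 ≤ 1 + ‖t‖ := by linarith [norm_nonneg t]
    rw [map_add, add_mul]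
    refine (norm_add_le _ _).trans (add_le_add ((ha t e he).trans ?_) ((hb t e he).trans ?_))
    · exact mul_le_mul (le_abs_self a) (pow_le_pow_right₀ h1 (le_max_left _ _)) (by positivity)
        (abs_nonneg a)
    · exact mul_le_mul (le_abs_self b) (pow_le_pow_right₀ h1 (le_max_right _ _)) (by positivity)
        (abs_nonneg b)
  | mul_X p x hp =>
    obtain ⟨a, n, ha⟩ := hp
    refine ⟨a * M, n + 1, fun t e he => ?_⟩
    rw [map_mul, MvPolynomial.aeval_X, norm_mul]
    calc _ ≤ (a * (1 + ‖t‖) ^ n) * (M * (1 + ‖t‖)) :=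
          mul_le_mul (ha t e he) (he x) (norm_nonneg _) ((norm_nonneg _).trans (ha t e he))
      _ = _ := by ring

theorem differentiableAt_aeval {O : Type} (r : MvPolynomial O ℂ) {z : O → ℂ → ℂ} {t : ℂ}
    (hz : ∀ x, DifferentiableAt ℂ (z x) t) :
    DifferentiableAt ℂ (fun s => MvPolynomial.aeval (fun x => z x s) r) t := by
  induction r using MvPolynomial.induction_on with
  | C a => simp
  | add p q hp hq => simpa only [map_add] using hp.fun_add hq
  | mul_X p x hp => simpa only [map_mul, MvPolynomial.aeval_X] using hp.fun_mul (hz x)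

end Analysis

/-! ### Every Galois permutation comes from a loop. -/

section Monodromy

variable {P Q : ℂ[X]} {O K : Type} [Fintype O] [Group K] [MulAction K O] [Finite K]

/-- Every element of `K` is induced by continuation along a loop. -/
theorem RelationIdeal.continues_smul (R : RelationIdeal P Q O K) (hPQ : IsCoprime P Q)
    (hd : Q.natDegree < P.natDegree) {w : ℂ} (hw : w ∈ Reg P Q) {e₀ : O → ℂ}
    (he₀ : e₀ ∈ R.points w) (k₀ : K) : Continues P Q w e₀ w (fun x => e₀ (k₀ • x)) := by
  classical
  have := Fintype.ofFinite K
  have hP : P ≠ 0 := by rintro rfl; simp at hd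
  have hroot : ∀ {t : ℂ} {e : O → ℂ}, e ∈ R.points t → ∀ x, (pencil P Q t).eval (e x) = 0 :=
    fun he x => (R.eval_pencil_eq_zero_iff hP he).mpr ⟨x, rfl⟩
  -- The permutations realised by loops from `e₀`; the aim is `k₀ ∈ M`.
  let M : Subgroup K :=
    { carrier := {k | Continues P Q w e₀ w (fun x => e₀ (k • x))}
      one_mem' := by
        change Continues P Q w e₀ w (fun x => e₀ ((1 : K) • x))
        simp only [one_smul]
        exact Continues.refl hw (hroot he₀)
      mul_mem' := by
        intro k l hk hl
        have := Continues.trans hl (Continues.comp hk fun x => l • x)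
        simpa only [Set.mem_ofPred_eq, mul_smul] using this
      inv_mem' := by
        intro k hk
        have := (Continues.comp hk fun x => k⁻¹ • x).symm
        simp only [smul_inv_smul] at this
        exact this }
  have hM : ∀ k, k ∈ M ↔ Continues P Q w e₀ w (fun x => e₀ (k • x)) := fun k => Iff.rfl
  obtain ⟨c, hc⟩ := exists_separating (fun (k : K) x => e₀ (k • x))
  let y : ℂ := ∑ x, c x * e₀ (k₀ • x)
  -- A norm over `M` only: it vanishes at the `k₀`-translate of `e₀`, and it vanishes at `e₀` only
  -- if that translate is realised by an element of `M`.
  let r : MvPolynomial O ℂ :=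
    ∏ m : M, (MvPolynomial.C y - MvPolynomial.rename ((m : K) • ·) (linForm c))
  have hr : ∀ l ∈ M, MvPolynomial.rename (l • ·) r = r := by
    intro l hl
    rw [map_prod]
    refine Fintype.prod_equiv (Equiv.mulLeft (⟨l, hl⟩ : M)) _ _ fun k => ?_
    rw [map_sub, MvPolynomial.rename_C, rename_rename]; rfl
  choose! E hE hEc using fun (t : ℂ) (ht : t ∈ Reg P Q) => R.exists_continues hPQ hd hw he₀ ht
  -- Two continuations of `e₀` to the same `t` differ by an element of `M`, under which `r` is
  -- invariant. So `r` becomes a single-valued function on `Reg P Q`.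
  have hwell : ∀ t ∈ Reg P Q, ∀ e, Continues P Q w e₀ t e →
      MvPolynomial.aeval (E t) r = MvPolynomial.aeval e r := by
    intro t ht e he
    have hep := he.mem_points R hd he₀
    obtain ⟨k, hk⟩ := R.exists_smul_eq hep (hE t ht)
    have hEk : E t = fun x => e (k • x) := funext hk
    have hkM : k ∈ M := (hEc t ht).trans (hEk ▸ (he.comp fun x => k • x).symm)
    rw [hEk, ← aeval_rename, hr k hkM]
  -- The default value only concerns the finitely many critical parameters and keeps the growth
  -- bound.
  let φ : ℂ → ℂ := fun t => if t ∈ Reg P Q then MvPolynomial.aeval (E t) r else 0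
  obtain ⟨B, -, hbound⟩ := exists_root_bound hd
  obtain ⟨M', N, hgrow⟩ := mvPolynomial_growth r B
  have hgrow' : ∀ t, ‖φ t‖ ≤ |M'| * (1 + ‖t‖) ^ N := by
    intro t
    simp only [φ]
    split_ifs with ht
    · refine (hgrow t (E t) fun x => hbound t _ (hroot (hE t ht) x)).trans ?_
      gcongr
      exact le_abs_self _
    · rw [norm_zero]; positivity
  have hdiff : ∀ t, t ∉ (Reg P Q)ᶜ → DifferentiableAt ℂ φ t := by
    intro t₀ ht₀
    rw [Set.notMem_compl_iff] at ht₀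
    obtain ⟨z, hz1, hz2, ε, hε, h⟩ := exists_local_sections hPQ hd ht₀ (hroot (hE t₀ ht₀))
    refine (differentiableAt_aeval r hz2).congr_of_eventuallyEq ?_
    filter_upwards [Metric.ball_mem_nhds t₀ hε] with t ht
    have hc := continues_of_sections h (Metric.mem_ball_self hε) ht
    simp only [hz1] at hc
    simp only [φ, if_pos (h t ht).1]
    exact hwell t (h t ht).1 _ ((hEc t₀ ht₀).trans hc)
  obtain ⟨m, p, hm, hp⟩ := exists_rational_of_growth (finite_compl_Reg hPQ hd) hdiff hgrow'
  -- the relation `m(v) r = p(v)` holds identically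
  let d : MvPolynomial O ℂ := aeval R.v m * r - aeval R.v p
  have hpt : ∀ {t : ℂ} {e : O → ℂ}, e ∈ R.points t → ∀ q : ℂ[X],
      MvPolynomial.aeval e (aeval R.v q) = q.eval t := fun {t e} he q => by
    rw [← aeval_algHom_apply, he.2, coe_aeval_eq_eval]
  have hd0 : ∀ t ∈ Reg P Q, MvPolynomial.aeval (E t) d = 0 := by
    intro t ht
    rw [map_sub, map_mul, hpt (hE t ht), hpt (hE t ht), ← hp t]
    simp only [φ, if_pos ht, sub_self]
  -- The norm of `d` over `K` is, modulo `I`, a polynomial in the parameter with infinitely many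
  -- zeros. Hence the norm lies in the prime `I`, and so does one translate of `d`.
  have hdI : d ∈ R.I := by
    let n : MvPolynomial O ℂ := ∏ k : K, MvPolynomial.rename (k • ·) d
    have hn : ∀ l : K, MvPolynomial.rename (l • ·) n = n := by
      intro l
      rw [map_prod]
      refine Fintype.prod_equiv (Equiv.mulLeft l) _ _ fun k => ?_
      rw [rename_rename]; rfl
    obtain ⟨q, hq⟩ := R.exists_of_invariant n hn
    have hq0 : q = 0 := by
      refine eq_zero_of_infinite_isRoot q (Set.Infinite.mono (s := Reg P Q) ?_ ?_)
      · intro t ht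
        have h1 := R.aeval_eq_eval (hE t ht) hq
        rw [Set.mem_ofPred_eq, IsRoot, ← h1, map_prod]
        refine Finset.prod_eq_zero (Finset.mem_univ 1) ?_
        rw [aeval_rename]
        simpa only [one_smul] using hd0 t ht
      · have := (finite_compl_Reg hPQ hd).infinite_compl
        rwa [compl_compl] at this
    rw [hq0, map_zero, sub_zero] at hq
    have := R.prime
    obtain ⟨k, -, hk⟩ := (Ideal.IsPrime.prod_mem_iff (s := Finset.univ)).mp hq
    have hk' := R.rename_mem k⁻¹ _ hk
    rw [rename_rename, inv_mul_cancel] at hk'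
    have hid : ((1 : K) • · : O → O) = id := funext fun x => one_smul K x
    rwa [hid, MvPolynomial.rename_id_apply] at hk'
  -- The relation holds at every point over `w`, so `r` takes the same value at all translates of
  -- `e₀`, not just at those under `M`.
  have hval : ∀ k : K, m.eval w * MvPolynomial.aeval (fun x => e₀ (k • x)) r = p.eval w := by
    intro k
    have hk := R.points_smul he₀ k
    have := hk.1 d hdI
    rwa [map_sub, map_mul, hpt hk, hpt hk, sub_eq_zero] at this
  have hmw : m.eval w ≠ 0 := hm w (Set.notMem_compl_iff.mpr hw)
  have h0 : MvPolynomial.aeval (fun x => e₀ (k₀ • x)) r = 0 := by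
    rw [map_prod]
    refine Finset.prod_eq_zero (Finset.mem_univ 1) ?_
    rw [map_sub, aeval_rename]
    simp [y]
  have h1 : MvPolynomial.aeval e₀ r = 0 := by
    have e1 := hval k₀
    have e2 := hval 1
    simp only [one_smul] at e2
    rw [h0, mul_zero] at e1
    rw [← e1, mul_eq_zero] at e2
    exact e2.resolve_left hmw
  rw [map_prod, Finset.prod_eq_zero_iff] at h1
  obtain ⟨l, -, hl⟩ := h1
  rw [map_sub, aeval_rename, sub_eq_zero] at hl
  have := hc k₀ l (by simpa [y] using hl)
  have hlM := (hM l).mp l.2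
  rw [← this] at hlM
  exact hlM

end Monodromy

end

section

open Polynomial Topology

/-! ### From plane paths to monodromy on the sphere. -/

section SphereBridge

theorem toSphere_coe_eq_coe (A : RatFunc ℂ) (z w : ℂ) :
    toSphere A (z : Sphere) = (w : Sphere) ↔ (pencil A.num A.denom w).eval z = 0 := by
  change (if A.denom.eval z = 0 then OnePoint.infty
      else ((A.num.eval z / A.denom.eval z : ℂ) : Sphere)) = (w : Sphere) ↔ _
  split_ifs with h
  · refine iff_of_false (OnePoint.infty_ne_coe w) fun h' => ?_
    exact eval_ne_zero_of_pencil (RatFunc.isCoprime_num_denom A) h' h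
  · rw [OnePoint.coe_eq_coe, div_eq_iff h, eval_pencil, sub_eq_zero]

theorem toSphere_infty {A : RatFunc ℂ} (hd : A.denom.natDegree < A.num.natDegree) :
    toSphere A OnePoint.infty = OnePoint.infty := if_pos hd

/-- As `A` sends infinity to infinity, the fibre over a finite value consists of the roots of the
pencil polynomial, whose degree is `degree A`. -/
theorem coe_mem_regularValues_iff {A : RatFunc ℂ} (hd : A.denom.natDegree < A.num.natDegree)
    (w : ℂ) : (w : Sphere) ∈ regularValues A ↔ w ∈ Reg A.num A.denom := by
  classical
  set p := pencil A.num A.denom w with hp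
  have hpd : p.natDegree = A.num.natDegree := natDegree_pencil hd w
  have hp0 : p ≠ 0 := by
    intro h
    rw [h, natDegree_zero] at hpd
    omega
  have hpre : toSphere A ⁻¹' {(w : Sphere)} = ((↑) : ℂ → Sphere) '' (p.roots.toFinset : Set ℂ) := by
    ext q
    induction q using OnePoint.rec with
    | infty => simp [toSphere_infty hd]
    | coe z => simp [toSphere_coe_eq_coe, hp0, ← hp]
  have hdeg : degree A = p.natDegree := by rw [hpd, degree, max_eq_left hd.le]
  have hsplit : p.Splits := IsAlgClosed.splits p
  rw [regularValues, Set.mem_ofPred_eq, hpre, Set.ncard_image_of_injective _ OnePoint.coe_injective,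
    Set.ncard_coe_finset, hdeg, hsplit.natDegree_eq_card_roots, Multiset.toFinset_card_eq_card_iff_nodup,
    nodup_roots_iff_of_splits hp0 hsplit, Separable,
    isCoprime_iff_aeval_ne_zero_of_isAlgClosed ℂ ℂ]
  simp only [coe_aeval_eq_eval, Reg, Set.mem_ofPred_eq, ← hp]
  exact forall_congr' fun z => or_iff_not_imp_left.trans (by rw [not_not])

theorem exists_path_of_forall_ne_infty {a b : ℂ} (γ : Path (a : Sphere) (b : Sphere))
    (h : ∀ τ, γ τ ≠ OnePoint.infty) : ∃ γ' : Path a b, ∀ τ, γ τ = (γ' τ : Sphere) := by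
  choose f hf using fun τ => OnePoint.ne_infty_iff_exists.mp (h τ)
  have hcont : Continuous f := by
    rw [(OnePoint.isOpenEmbedding_coe (X := ℂ)).isInducing.continuous_iff]
    have : ((↑) : ℂ → Sphere) ∘ f = γ := funext hf
    rw [this]; exact γ.continuous
  refine ⟨⟨⟨f, hcont⟩, ?_, ?_⟩, fun τ => (hf τ).symm⟩
  · exact OnePoint.coe_injective ((hf 0).trans γ.source)
  · exact OnePoint.coe_injective ((hf 1).trans γ.target)

variable {O K : Type} [Fintype O] [Group K] [MulAction K O] [Finite K]

/-- The monodromy group is the group of permutations of the solutions that preserve all algebraic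
relations, provided that infinity is a critical value that is attained at infinity. -/
theorem RelationIdeal.permEquivalent_monodromyGroup {A : RatFunc ℂ}
    (R : RelationIdeal A.num A.denom O K) (hd : A.denom.natDegree < A.num.natDegree)
    (hinf : OnePoint.infty ∉ regularValues A) {w : Sphere} (hw : w ∈ regularValues A) :
    PermEquivalent (monodromyGroup A w hw) (MulAction.toPermHom K O).range := by
  have hP : A.num ≠ 0 := by intro h; simp [h] at hd
  have hcop := RatFunc.isCoprime_num_denom A
  induction w using OnePoint.rec with
  | infty => exact absurd hw hinf
  | coe w =>
  have hreg := (coe_mem_regularValues_iff hd w).mp hw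
  obtain ⟨e₀, he₀⟩ := R.exists_point w
  have he₀ : e₀ ∈ R.points w := he₀
  have hinj := R.injective_of_mem_points hreg he₀
  have hne : ∀ {τ : Sphere}, τ ∈ regularValues A → τ ≠ OnePoint.infty := by
    rintro τ hτ rfl; exact hinf hτ
  have hfib : ∀ x, toSphere A (e₀ x : Sphere) = (w : Sphere) := fun x =>
    (toSphere_coe_eq_coe A _ _).mpr ((R.eval_pencil_eq_zero_iff hP he₀).mpr ⟨x, rfl⟩)
  let E : O ≃ Fiber A (w : Sphere) := Equiv.ofBijective (fun x => ⟨(e₀ x : Sphere), hfib x⟩) (by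
    constructor
    · intro x y hxy
      exact hinj (OnePoint.coe_injective (congrArg Subtype.val hxy))
    · rintro ⟨q, hq⟩
      induction q using OnePoint.rec with
      | infty => rw [toSphere_infty hd] at hq; exact absurd hq (OnePoint.infty_ne_coe w)
      | coe z =>
        obtain ⟨x, rfl⟩ := (R.eval_pencil_eq_zero_iff hP he₀).mp ((toSphere_coe_eq_coe A z w).mp hq)
        exact ⟨x, rfl⟩)
  have hE : ∀ x, (E x).1 = (e₀ x : Sphere) := fun x => rfl
  refine ⟨E.symm, ?_⟩
  ext σ
  constructor
  · rintro ⟨g, ⟨γ, hγ, hlift⟩, rfl⟩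
    -- Infinity is critical, so the loop avoids it; its lifts do too, because `A` maps infinity to
    -- infinity.
    obtain ⟨γ', hγ'⟩ := exists_path_of_forall_ne_infty γ fun τ => hne (hγ τ)
    have hgx : ∀ x, (g (E x)).1 = (e₀ (E.symm (g (E x))) : Sphere) := fun x => by
      rw [← hE, Equiv.apply_symm_apply]
    have hΓ : ∀ x, ∃ Γ : Path (e₀ x) (e₀ (E.symm (g (E x)))), ∀ τ,
        (pencil A.num A.denom (γ' τ)).eval (Γ τ) = 0 := by
      intro x
      obtain ⟨Γ, h⟩ := hlift (E x)
      obtain ⟨Γ', hΓ'⟩ := exists_path_of_forall_ne_infty (Γ.cast (hE x).symm (hgx x).symm)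
        fun τ hτ => by
          rw [Path.cast_coe] at hτ
          have := h τ
          rw [hτ, toSphere_infty hd] at this
          exact hne (hγ τ) this.symm
      refine ⟨Γ', fun τ => ?_⟩
      rw [← toSphere_coe_eq_coe, ← hΓ', Path.cast_coe, h, hγ']
    choose Γ hΓ using hΓ
    have hc : Continues A.num A.denom w e₀ w (fun x => e₀ (E.symm (g (E x)))) := by
      refine ⟨γ', fun τ => ?_, Γ, hΓ⟩
      rw [← coe_mem_regularValues_iff hd, ← hγ']
      exact hγ τ
    obtain ⟨k, hk⟩ := R.exists_smul_eq he₀ (hc.mem_points R hd he₀)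
    exact ⟨k, Equiv.ext fun x => (hinj (hk x)).symm⟩
  · rintro ⟨k, rfl⟩
    obtain ⟨γ, h1, Γ, h2⟩ := R.continues_smul hcop hd hreg he₀ k
    refine ⟨E.permCongr (MulAction.toPermHom K O k), ?_, ?_⟩
    · refine ⟨γ.map OnePoint.continuous_coe, fun τ => (coe_mem_regularValues_iff hd _).mpr (h1 τ),
        fun q => ?_⟩
      obtain ⟨x, rfl⟩ := E.surjective q
      have hend : (E.permCongr (MulAction.toPermHom K O k) (E x)).1 = (e₀ (k • x) : Sphere) := by
        rw [Equiv.permCongr_apply, Equiv.symm_apply_apply]; rfl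
      refine ⟨((Γ x).map OnePoint.continuous_coe).cast rfl hend, fun τ => ?_⟩
      exact (toSphere_coe_eq_coe A _ _).mpr (h2 x τ)
    · ext x
      simp [Equiv.permCongrHom]

end SphereBridge

end

section

open Polynomial

/-! ### The relation ideal of the conjugates. -/

section PencilOverRing

variable {S : Type*} [CommRing S] [IsDomain S] [Algebra ℂ S] {P Q : ℂ[X]}

theorem natDegree_C_mul_map_lt (hd : Q.natDegree < P.natDegree) (v : S) :
    (C v * Q.map (algebraMap ℂ S)).natDegree < (P.map (algebraMap ℂ S)).natDegree := by
  rw [natDegree_map_eq_of_injective (algebraMap ℂ S).injective P]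
  exact (natDegree_C_mul_le _ _).trans_lt (natDegree_map_le.trans_lt hd)

theorem natDegree_map_sub (hd : Q.natDegree < P.natDegree) (v : S) :
    (P.map (algebraMap ℂ S) - C v * Q.map (algebraMap ℂ S)).natDegree = P.natDegree := by
  rw [natDegree_sub_eq_left_of_natDegree_lt (natDegree_C_mul_map_lt hd v),
    natDegree_map_eq_of_injective (algebraMap ℂ S).injective]

theorem leadingCoeff_map_sub (hd : Q.natDegree < P.natDegree) (v : S) :
    (P.map (algebraMap ℂ S) - C v * Q.map (algebraMap ℂ S)).leadingCoeff =
      algebraMap ℂ S P.leadingCoeff := by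
  rw [leadingCoeff_sub_of_degree_lt (degree_lt_degree (natDegree_C_mul_map_lt hd v)),
    leadingCoeff_map_of_injective (algebraMap ℂ S).injective]

end PencilOverRing

theorem permEquivalent_orbit_quotient (K : Type*) {Y : Type*} [Group K] [MulAction K Y] (y : Y) :
    PermEquivalent (MulAction.toPermHom K (MulAction.orbit K y)).range
      (MulAction.toPermHom K (K ⧸ MulAction.stabilizer K y)).range := by
  have key : ∀ (k : K) (x : K ⧸ MulAction.stabilizer K y),
      (MulAction.orbitEquivQuotientStabilizer K y).symm (k • x) =
        k • (MulAction.orbitEquivQuotientStabilizer K y).symm x := by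
    intro k x
    obtain ⟨g, rfl⟩ := QuotientGroup.mk_surjective x
    ext
    rw [MulAction.orbit.coe_smul, MulAction.Quotient.smul_coe,
      MulAction.orbitEquivQuotientStabilizer_symm_apply,
      MulAction.orbitEquivQuotientStabilizer_symm_apply, smul_eq_mul, mul_smul]
  exact PermEquivalent.symm' (permEquivalent_range_toPermHom
    (MulAction.orbitEquivQuotientStabilizer K y).symm (fun k => ⟨k, key k⟩) fun k => ⟨k, key k⟩)

namespace GaloisFrame

variable {F : RatFunc ℂ} (W : GaloisFrame F) {A U D : RatFunc ℂ}

/-- Evaluation of a polynomial in the conjugates of `U` over `ℂ(V)`. -/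
def evalConj (V U : RatFunc ℂ) :
    MvPolynomial (MulAction.orbit (W.St V) (W.ι U)) ℂ →ₐ[ℂ] W.L :=
  MvPolynomial.aeval fun x => (x : W.L)

theorem smul_evalConj {V U : RatFunc ℂ} (k : W.St V)
    (r : MvPolynomial (MulAction.orbit (W.St V) (W.ι U)) ℂ) :
    (k : W.Γ) • W.evalConj V U r = W.evalConj V U (MvPolynomial.rename (k • ·) r) := by
  induction r using MvPolynomial.induction_on with
  | C a =>
    rw [MvPolynomial.rename_C, ← MvPolynomial.algebraMap_eq, AlgHom.commutes, W.smul_algebraMap]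
  | add p q hp hq => simp only [map_add, smul_add, hp, hq]
  | mul_X p x hp =>
    simp only [map_mul, smul_mul', hp, MvPolynomial.rename_X]
    congr 1
    simp only [evalConj, MvPolynomial.aeval_X]
    rfl

/-- The orbit supplies as many distinct roots as the degree, so there are no others. -/
theorem fiberPoly_eq_prod (hF : Nonconst F) (h : F = comp D (comp A U))
    (hd : A.denom.natDegree < A.num.natDegree)
    [Fintype (MulAction.orbit (W.St (comp A U)) (W.ι U))] :
    fiberPoly A (W.ι (comp A U)) = C (algebraMap ℂ W.L A.num.leadingCoeff) *
      ∏ x : MulAction.orbit (W.St (comp A U)) (W.ι U), (X - C (x : W.L)) := by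
  classical
  have hV := (nonconst_of_comp (h ▸ hF)).2
  have hU := (nonconst_of_comp hV).2
  have h0 := W.fiberPoly_ne_zero A hV
  set p := fiberPoly A (W.ι (comp A U)) with hp
  have hdeg : p.natDegree = A.num.natDegree := natDegree_map_sub hd _
  have hlc : p.leadingCoeff = algebraMap ℂ W.L A.num.leadingCoeff := leadingCoeff_map_sub hd _
  set s : Multiset W.L := (Finset.univ : Finset (MulAction.orbit (W.St (comp A U)) (W.ι U))).val.map
    Subtype.val with hs
  have hcard : s.card = p.natDegree := by
    have := W.ncard_orb hF h
    rw [degree, max_eq_left hd.le] at this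
    rw [hdeg, ← this, hs, Multiset.card_map, Finset.card_val, Finset.card_univ, orb,
      Set.ncard_eq_toFinset_card', Set.toFinset_card]
  have hroots : s = p.roots := by
    refine Multiset.eq_of_le_of_card_le ?_ ((card_roots' p).trans hcard.ge)
    rw [Multiset.le_iff_subset (Finset.univ.nodup.map Subtype.val_injective)]
    intro y hy
    obtain ⟨⟨_, g, rfl⟩, -, rfl⟩ := Multiset.mem_map.mp hy
    rw [mem_roots h0]
    exact eval_fiberPoly_smul hU g.2
  have := C_leadingCoeff_mul_prod_multiset_X_sub_C (p := p) (by rw [← hroots, hcard])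
  rw [← this, hlc, ← hroots, hs, Multiset.map_map]
  rfl

/-- The conjugates are roots of a polynomial over `ℂ[v]`, `v = A ∘ U`, whose leading coefficient is
a nonzero constant. -/
theorem isIntegralElem_evalConj (hF : Nonconst F) (h : F = comp D (comp A U))
    (hd : A.denom.natDegree < A.num.natDegree)
    (r : MvPolynomial (MulAction.orbit (W.St (comp A U)) (W.ι U)) ℂ) :
    (aeval (R := ℂ) (W.ι (comp A U)) : ℂ[X] →ₐ[ℂ] W.L).toRingHom.IsIntegralElem
      (W.evalConj (comp A U) U r) := by
  have hV := (nonconst_of_comp (h ▸ hF)).2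
  have hU := (nonconst_of_comp hV).2
  set φ := (aeval (R := ℂ) (W.ι (comp A U)) : ℂ[X] →ₐ[ℂ] W.L).toRingHom with hφ
  have hφC : ∀ c, φ (C c) = algebraMap ℂ W.L c := fun c => aeval_C _ c
  have hφX : φ X = W.ι (comp A U) := aeval_X _
  have hP : A.num.leadingCoeff ≠ 0 := by
    rw [leadingCoeff_ne_zero]; intro h0; simp [h0] at hd
  induction r using MvPolynomial.induction_on with
  | C a =>
    rw [← MvPolynomial.algebraMap_eq, AlgHom.commutes, ← hφC]
    exact φ.isIntegralElem_map
  | add p q hp hq => rw [map_add]; exact hp.add φ hq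
  | mul_X p x hp =>
    rw [map_mul]
    refine hp.mul φ ?_
    obtain ⟨⟨_, g, rfl⟩, rfl⟩ : ∃ y, y = x := ⟨x, rfl⟩
    let q : ℂ[X][X] := A.num.map (algebraMap ℂ ℂ[X]) - C X * A.denom.map (algebraMap ℂ ℂ[X])
    have hcomp : φ.comp (algebraMap ℂ ℂ[X]) = algebraMap ℂ W.L := RingHom.ext hφC
    have hmap : q.map φ = fiberPoly A (W.ι (comp A U)) := by
      simp only [q, Polynomial.map_sub, Polynomial.map_mul, map_map, hcomp, map_C, hφX, fiberPoly]
    have hq : q.eval₂ φ ((g : W.Γ) • W.ι U) = 0 := by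
      rw [← eval_map, hmap]
      exact eval_fiberPoly_smul hU g.2
    have h1 := φ.isIntegralElem_leadingCoeff_mul q _ hq
    have h2 : q.leadingCoeff = C A.num.leadingCoeff := leadingCoeff_map_sub hd X
    rw [h2] at h1
    have h3 := (φ.isIntegralElem_map (x := C A.num.leadingCoeff⁻¹)).mul φ h1
    rw [← mul_assoc, ← map_mul, ← C_mul, inv_mul_cancel₀ hP, C_1, map_one, one_mul] at h3
    simp only [evalConj, MvPolynomial.aeval_X]
    exact h3

/-- An invariant expression lies in `ℂ(v)` and is integral over `ℂ[v]`, which is integrally closed.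
-/
theorem exists_evalConj_eq_aeval (hF : Nonconst F) (h : F = comp D (comp A U))
    (hd : A.denom.natDegree < A.num.natDegree)
    (r : MvPolynomial (MulAction.orbit (W.St (comp A U)) (W.ι U)) ℂ)
    (hr : ∀ k : W.St (comp A U), MvPolynomial.rename (k • ·) r = r) :
    ∃ p : ℂ[X], W.evalConj (comp A U) U r = aeval (W.ι (comp A U)) p := by
  have hV := (nonconst_of_comp (h ▸ hF)).2
  obtain ⟨B, hB⟩ := W.exists_of_fixed D (comp A U) h (W.evalConj (comp A U) U r) fun g hg => by
    rw [W.smul_evalConj ⟨g, hg⟩, hr]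
  let ψ : RatFunc ℂ →ₐ[ℂ] W.L := W.ι.comp (substHom (comp A U) hV.transcendental)
  have hψ : ψ B = W.evalConj (comp A U) U r := by
    rw [hB, comp_eq_substHom _ hV]; rfl
  have hψp : ∀ p : ℂ[X], ψ (algebraMap _ _ p) = aeval (W.ι (comp A U)) p := fun p => by
    rw [algHom_algebraMap]
    simp [ψ]
  obtain ⟨q, hq, hq0⟩ := W.isIntegralElem_evalConj hF h hd r
  have hint : IsIntegral ℂ[X] B := by
    refine ⟨q, hq, ψ.injective ?_⟩
    change ψ (eval₂ (algebraMap ℂ[X] (RatFunc ℂ)) B q) = ψ 0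
    have e : ψ (eval₂ (algebraMap ℂ[X] (RatFunc ℂ)) B q) =
        eval₂ ((ψ : RatFunc ℂ →+* W.L).comp (algebraMap ℂ[X] (RatFunc ℂ))) (ψ B) q :=
      hom_eval₂ q _ (ψ : RatFunc ℂ →+* W.L) B
    rw [e, map_zero, hψ, ← hq0]
    congr 1
    exact RingHom.ext hψp
  obtain ⟨p, rfl⟩ := IsIntegrallyClosed.isIntegral_iff.mp hint
  exact ⟨p, by rw [← hψ, hψp]⟩

/-- The ideal of relations between the conjugates of `U` over `ℂ(A ∘ U)`. -/
def relationIdeal (hF : Nonconst F) (h : F = comp D (comp A U))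
    (hd : A.denom.natDegree < A.num.natDegree)
    [Fintype (MulAction.orbit (W.St (comp A U)) (W.ι U))] :
    RelationIdeal A.num A.denom (MulAction.orbit (W.St (comp A U)) (W.ι U)) (W.St (comp A U)) :=
  let R := MvPolynomial (MulAction.orbit (W.St (comp A U)) (W.ι U)) ℂ
  let T : R[X] := ∏ x, (X - C (MvPolynomial.X x))
  -- Obtained by solving for the parameter in the coefficient of degree `A.denom.natDegree`; the
  -- denominator is monic, so `v` occurs there with coefficient one.
  let v : R := MvPolynomial.C (A.num.coeff A.denom.natDegree) -
    MvPolynomial.C A.num.leadingCoeff * T.coeff A.denom.natDegree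
  have hπ : ∀ c : ℂ, W.evalConj (comp A U) U (MvPolynomial.C c) = algebraMap ℂ W.L c :=
    fun c => AlgHom.commutes _ c
  have hT : T.map (W.evalConj (comp A U) U : R →+* W.L) =
      ∏ x : MulAction.orbit (W.St (comp A U)) (W.ι U), (X - C (x : W.L)) := by
    simp only [T, Polynomial.map_prod, Polynomial.map_sub, map_X, map_C]
    refine Finset.prod_congr rfl fun x _ => ?_
    congr 2
    exact MvPolynomial.aeval_X _ x
  have hv : W.evalConj (comp A U) U v = W.ι (comp A U) := by
    have h1 := congrArg (fun p => coeff p A.denom.natDegree) (W.fiberPoly_eq_prod hF h hd)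
    simp only [fiberPoly, coeff_sub, coeff_map, coeff_C_mul] at h1
    have h2 : A.denom.coeff A.denom.natDegree = 1 := A.monic_denom
    rw [h2, map_one, mul_one, ← hT, coeff_map, RingHom.coe_coe] at h1
    rw [map_sub, map_mul, hπ, hπ]
    linear_combination h1
  have hsm : ∀ (k : W.St (comp A U)) (r : R), W.evalConj (comp A U) U
      (MvPolynomial.rename (k • ·) r) = (k : W.Γ) • W.evalConj (comp A U) U r :=
    fun k r => (W.smul_evalConj k r).symm
  have hval : ∀ p : ℂ[X], W.evalConj (comp A U) U (aeval v p) = aeval (W.ι (comp A U)) p :=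
    fun p => by rw [← aeval_algHom_apply, hv]
  have hinv : ∀ r : R, (∀ k : W.St (comp A U), MvPolynomial.rename (k • ·) r = r) →
      ∃ p : ℂ[X], r - aeval v p ∈ RingHom.ker (W.evalConj (comp A U) U) := by
    intro r hr
    obtain ⟨p, hp⟩ := W.exists_evalConj_eq_aeval hF h hd r hr
    exact ⟨p, by rw [RingHom.mem_ker, map_sub, hp, hval, sub_self]⟩
  { I := RingHom.ker (W.evalConj (comp A U) U)
    v := v
    prime := RingHom.ker_isPrime _
    rename_mem := fun k r hr => by
      rw [RingHom.mem_ker] at hr ⊢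
      rw [hsm, hr, smul_zero]
    exists_of_invariant := hinv
    rename_v := fun k => by
      rw [RingHom.mem_ker, map_sub, hsm, hv, W.mem_St.mp k.2, sub_self]
    exists_point := by
      classical
      intro t
      have hV := (nonconst_of_comp (h ▸ hF)).2
      have := Fintype.ofFinite (W.St (comp A U))
      -- If `a (v - t) = 1` among the conjugates, taking the norm gives `p(v) (v - t)^n = 1` in
      -- `ℂ[v]`, which is absurd at `v = t`. The Nullstellensatz then provides a point.
      have hne : RingHom.ker (W.evalConj (comp A U) U) ⊔ Ideal.span {v - MvPolynomial.C t} ≠ ⊤ := by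
        intro htop
        obtain ⟨i, hi, j, hj, hij⟩ := Submodule.mem_sup.mp ((Ideal.eq_top_iff_one _).mp htop)
        obtain ⟨a, rfl⟩ := Ideal.mem_span_singleton'.mp hj
        have e1 : W.evalConj (comp A U) U a *
            (W.ι (comp A U) - algebraMap ℂ W.L t) = 1 := by
          have := congrArg (W.evalConj (comp A U) U) hij
          rw [map_add, RingHom.mem_ker.mp hi, zero_add, map_mul, map_sub, hv, hπ, map_one] at this
          exact this
        let n : R := ∏ k : W.St (comp A U), MvPolynomial.rename (k • ·) a
        obtain ⟨p, hp⟩ := W.exists_evalConj_eq_aeval hF h hd n fun l => by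
          rw [map_prod]
          refine Fintype.prod_equiv (Equiv.mulLeft l) _ _ fun k => ?_
          rw [RelationIdeal.rename_rename]; rfl
        have e2 : aeval (W.ι (comp A U))
            (p * (X - C t) ^ Fintype.card (W.St (comp A U))) =
              aeval (W.ι (comp A U)) (1 : ℂ[X]) := by
          rw [map_mul, ← hp, map_prod, map_pow, ← Finset.card_univ, ← Finset.prod_const,
            ← Finset.prod_mul_distrib, map_one]
          refine Finset.prod_eq_one fun k _ => ?_
          have := congrArg ((k : W.Γ) • ·) e1
          simp only [smul_mul', smul_sub, W.mem_St.mp k.2, W.smul_algebraMap, smul_one] at this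
          rw [hsm, ← this]
          simp
        have htr : Transcendental ℂ (W.ι (comp A U)) := by
          rw [transcendental_iff_injective]
          have : (aeval (W.ι (comp A U)) : ℂ[X] → W.L) = W.ι ∘ aeval (comp A U) := by
            ext p; rw [Function.comp, aeval_algHom_apply]
          rw [this]
          exact W.ι.injective.comp (transcendental_iff_injective.mp hV.transcendental)
        have e3 := congrArg (Polynomial.eval t) (transcendental_iff_injective.mp htr e2)
        simp at e3
      obtain ⟨M, hM, hle⟩ := Ideal.exists_le_maximal _ hne
      obtain ⟨e, rfl⟩ := MvPolynomial.isMaximal_iff_eq_vanishingIdeal_singleton.mp hM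
      refine ⟨e, fun r hr => ?_, ?_⟩
      · exact (MvPolynomial.mem_vanishingIdeal_singleton_iff e r).mp (hle (Ideal.mem_sup_left hr))
      · have := (MvPolynomial.mem_vanishingIdeal_singleton_iff e _).mp
          (hle (Ideal.mem_sup_right (Ideal.mem_span_singleton_self _)))
        rw [map_sub, sub_eq_zero] at this
        rw [this]; simp
    eq_prod := by
      intro e he
      let q : R[X] := A.num.map (algebraMap ℂ R) - C v * A.denom.map (algebraMap ℂ R) -
        C (algebraMap ℂ R A.num.leadingCoeff) * T
      have hq : q.map (W.evalConj (comp A U) U : R →+* W.L) = 0 := by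
        have hc : (W.evalConj (comp A U) U : R →+* W.L).comp (algebraMap ℂ R) = algebraMap ℂ W.L :=
          RingHom.ext hπ
        have hv' : (W.evalConj (comp A U) U : R →+* W.L) v = W.ι (comp A U) := hv
        have hπ' : ∀ c : ℂ, (W.evalConj (comp A U) U : R →+* W.L) (algebraMap ℂ R c) =
          algebraMap ℂ W.L c := hπ
        simp only [q, Polynomial.map_sub, Polynomial.map_mul, map_map, hc, map_C, hT]
        rw [hv', hπ', sub_eq_zero]
        exact W.fiberPoly_eq_prod hF h hd
      have hq' : q.map (MvPolynomial.aeval e : R →ₐ[ℂ] ℂ).toRingHom = 0 := by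
        ext i
        rw [coeff_map, coeff_zero]
        refine he _ ?_
        rw [RingHom.mem_ker]
        have := congrArg (fun p => coeff p i) hq
        rw [coeff_map] at this
        exact this
      have hc : (MvPolynomial.aeval e : R →ₐ[ℂ] ℂ).toRingHom.comp (algebraMap ℂ R) =
          RingHom.id ℂ := RingHom.ext fun c => AlgHom.commutes (MvPolynomial.aeval e : R →ₐ[ℂ] ℂ) c
      have hc' : ∀ c, (MvPolynomial.aeval e : R →ₐ[ℂ] ℂ).toRingHom (algebraMap ℂ R c) = c :=
        fun c => AlgHom.commutes (MvPolynomial.aeval e : R →ₐ[ℂ] ℂ) c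
      simp only [q, Polynomial.map_sub, Polynomial.map_mul, map_map, hc, map_C, map_id, hc', T,
        Polynomial.map_prod, map_X] at hq'
      rw [sub_eq_zero] at hq'
      simpa using hq' }

/-- Algebraic and topological monodromy groups agree, if infinity is a critical value that is
attained at infinity. -/
theorem permEquivalent_permRep_of_normalised (hF : Nonconst F) (h : F = comp D (comp A U))
    (hd : A.denom.natDegree < A.num.natDegree) (hinf : OnePoint.infty ∉ regularValues A)
    {w : Sphere} (hw : w ∈ regularValues A) :
    PermEquivalent (monodromyGroup A w hw) (permRep (W.St (comp A U)) (W.St U)) := by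
  have : Fintype (MulAction.orbit (W.St (comp A U)) (W.ι U)) :=
    (W.finite_orb (comp A U) U).fintype
  refine ((W.relationIdeal hF h hd).permEquivalent_monodromyGroup hd hinf hw).trans' ?_
  exact permEquivalent_orbit_quotient (W.St (comp A U)) (W.ι U)

end GaloisFrame

end

section

open Polynomial Topology

/-! ### The normal closure and multiplicativity of the degree. -/

section Frames

open IntermediateField

/-- The normal closure of `ℂ(z)` over `ℂ(F)`. -/
abbrev NormalClosure (F : RatFunc ℂ) : Type :=
  normalClosure ℂ⟮F⟯ (RatFunc ℂ) (AlgebraicClosure (RatFunc ℂ))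

/-- The embedding of `ℂ(z)` into its normal closure over `ℂ(F)`. -/
def toNormalClosure {F : RatFunc ℂ} (hF : Nonconst F) : RatFunc ℂ →ₐ[ℂ⟮F⟯] NormalClosure F :=
  have := finiteDimensional_adjoin hF
  (IsScalarTower.toAlgHom ℂ⟮F⟯ (RatFunc ℂ) (AlgebraicClosure (RatFunc ℂ))).codRestrict
    (normalClosure ℂ⟮F⟯ (RatFunc ℂ) (AlgebraicClosure (RatFunc ℂ))).toSubalgebra
    fun x => AlgHom.fieldRange_le_normalClosure
      (IsScalarTower.toAlgHom ℂ⟮F⟯ (RatFunc ℂ) (AlgebraicClosure (RatFunc ℂ))) ⟨x, rfl⟩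

theorem finiteDimensional_normalClosure {F : RatFunc ℂ} (hF : Nonconst F) :
    FiniteDimensional ℂ⟮F⟯ (NormalClosure F) := by
  have := finiteDimensional_adjoin hF
  infer_instance

theorem isGalois_normalClosure {F : RatFunc ℂ} (hF : Nonconst F) :
    IsGalois ℂ⟮F⟯ (NormalClosure F) := by
  have := finiteDimensional_adjoin hF
  have : Algebra.IsAlgebraic ℂ⟮F⟯ (AlgebraicClosure (RatFunc ℂ)) :=
    Algebra.IsAlgebraic.trans ℂ⟮F⟯ (RatFunc ℂ) _
  have : Normal ℂ⟮F⟯ (AlgebraicClosure (RatFunc ℂ)) :=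
    normal_iff.mpr fun x => ⟨Algebra.IsIntegral.isIntegral x, IsAlgClosed.splits _⟩
  have := normalClosure.normal ℂ⟮F⟯ (RatFunc ℂ) (AlgebraicClosure (RatFunc ℂ))
  exact { }

/-- The frame given by the normal closure. -/
def normalFrame {F : RatFunc ℂ} (hF : Nonconst F) : GaloisFrame F :=
  have := finiteDimensional_normalClosure hF
  have := isGalois_normalClosure hF
  galoisFrame (toNormalClosure hF) hF

end Frames

/-- Multiplicativity of the index along the stabilisers of `z`, `B` and `A ∘ B`. -/
theorem degree_comp {A B : RatFunc ℂ} (hA : Nonconst A) (hB : Nonconst B) :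
    degree (comp A B) = degree A * degree B := by
  have hF := comp_nonconst hA hB
  let W := normalFrame hF
  have h1 := W.relIndex_St (A := B) (U := RatFunc.X) (D := A) hF (by simp)
  have h2 := W.relIndex_St (A := A) (U := B) (D := RatFunc.X) hF (by simp)
  have h3 := W.relIndex_St (A := comp A B) (U := RatFunc.X) (D := RatFunc.X) hF (by simp)
  rw [comp_X] at h1 h3
  rw [← h1, ← h2, ← h3, mul_comm]
  refine (Subgroup.relIndex_mul_relIndex _ _ _ ?_ (W.St_le_comp A B)).symm
  simpa using W.St_le_comp B RatFunc.X

/-! ### Continuity and composition of the maps of the sphere. -/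

section SphereMaps

theorem natDegree_num_le (A : RatFunc ℂ) : A.num.natDegree ≤ degree A := le_max_left _ _

theorem natDegree_denom_le (A : RatFunc ℂ) : A.denom.natDegree ≤ degree A := le_max_right _ _

theorem tendsto_coe_cobounded :
    Filter.Tendsto ((↑) : ℂ → Sphere) (Bornology.cobounded ℂ) (𝓝 OnePoint.infty) := by
  rw [Metric.cobounded_eq_cocompact, ← Filter.coclosedCompact_eq_cocompact]
  exact OnePoint.tendsto_coe_infty

/-- The value at `z` of the quotient of two polynomials, as a point of the sphere. -/
def sphereVal (P Q : ℂ[X]) (z : ℂ) : Sphere :=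
  if Q.eval z = 0 then OnePoint.infty else ((P.eval z / Q.eval z : ℂ) : Sphere)

theorem continuousAt_sphereVal {P Q : ℂ[X]} (hQ : Q ≠ 0) {z : ℂ}
    (h : Q.eval z = 0 → P.eval z ≠ 0) : ContinuousAt (sphereVal P Q) z := by
  by_cases hz : Q.eval z = 0
  · have hPz := h hz
    have hev : ∀ᶠ y in 𝓝[≠] z, Q.eval y ≠ 0 := by
      have hfin : {y | Q.eval y = 0}.Finite := by
        classical
        refine (Q.roots.toFinset.finite_toSet).subset fun y hy => ?_
        simpa [hQ] using hy
      have : ({y | Q.eval y = 0} \ {z})ᶜ ∈ 𝓝 z :=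
        (hfin.subset Set.sdiff_subset).isClosed.isOpen_compl.mem_nhds (by simp)
      filter_upwards [mem_nhdsWithin_of_mem_nhds this, self_mem_nhdsWithin] with y hy hyz hy0
      exact hy ⟨hy0, hyz⟩
    have hPev : ∀ᶠ y in 𝓝[≠] z, P.eval y ≠ 0 :=
      (P.continuous.continuousAt.eventually_ne hPz).filter_mono nhdsWithin_le_nhds
    have hlim : Filter.Tendsto (fun y => Q.eval y / P.eval y) (𝓝[≠] z) (𝓝[≠] 0) := by
      refine tendsto_nhdsWithin_iff.mpr ⟨?_, ?_⟩
      · have : ContinuousAt (fun y => Q.eval y / P.eval y) z :=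
          Q.continuous.continuousAt.div P.continuous.continuousAt hPz
        have h2 := this.tendsto.mono_left (nhdsWithin_le_nhds (s := {z}ᶜ))
        simpa [hz] using h2
      · filter_upwards [hev, hPev] with y h1 h2 using div_ne_zero h1 h2
    have hlim2 := tendsto_coe_cobounded.comp (Filter.tendsto_inv₀_nhdsNE_zero.comp hlim)
    have hval : sphereVal P Q z = OnePoint.infty := if_pos hz
    rw [continuousAt_iff_punctured_nhds, hval]
    refine hlim2.congr' ?_
    filter_upwards [hev] with y hy
    simp [sphereVal, hy]
  · have hev : ∀ᶠ y in 𝓝 z, Q.eval y ≠ 0 := Q.continuous.continuousAt.eventually_ne hz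
    have hc : ContinuousAt (fun y => ((P.eval y / Q.eval y : ℂ) : Sphere)) z :=
      (OnePoint.continuous_coe.continuousAt).comp
        (P.continuous.continuousAt.div Q.continuous.continuousAt hz)
    refine hc.congr ?_
    filter_upwards [hev] with y hy
    simp [sphereVal, hy]

theorem toSphere_coe (A : RatFunc ℂ) (z : ℂ) :
    toSphere A (z : Sphere) = sphereVal A.num A.denom z := rfl

theorem eval_reflect_inv {P : ℂ[X]} {n : ℕ} (h : P.natDegree ≤ n) {z : ℂ} (hz : z ≠ 0) :
    P.eval z = (P.reflect n).eval z⁻¹ * z ^ n := by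
  have := invertibleOfNonzero hz
  have h1 := eval₂_reflect_mul_pow (RingHom.id ℂ) z n P h
  rw [invOf_eq_inv] at h1
  exact h1.symm

/-- In the coordinate `1/z`, numerator and denominator are reflected with respect to the common
degree `degree A`; continuity at infinity reduces to continuity at zero. -/
theorem toSphere_coe_eq_reflect (A : RatFunc ℂ) {z : ℂ} (hz : z ≠ 0) :
    toSphere A (z : Sphere) =
      sphereVal (A.num.reflect (degree A)) (A.denom.reflect (degree A)) z⁻¹ := by
  have hzn : z ^ degree A ≠ 0 := pow_ne_zero _ hz
  rw [toSphere_coe, sphereVal, sphereVal, eval_reflect_inv (natDegree_num_le A) hz,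
    eval_reflect_inv (natDegree_denom_le A) hz, mul_div_mul_right _ _ hzn]
  simp [hzn]

theorem eval_zero_reflect (P : ℂ[X]) (n : ℕ) : (P.reflect n).eval 0 = P.coeff n := by
  rw [← coeff_zero_eq_eval_zero, coeff_reflect, revAt_le (Nat.zero_le n), Nat.sub_zero]

theorem toSphere_infty_eq_reflect (A : RatFunc ℂ) :
    toSphere A OnePoint.infty =
      sphereVal (A.num.reflect (degree A)) (A.denom.reflect (degree A)) 0 := by
  change (if _ then _ else _) = _
  rw [sphereVal, eval_zero_reflect, eval_zero_reflect]
  by_cases h : A.denom.natDegree < A.num.natDegree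
  · rw [if_pos h, if_pos]
    exact coeff_eq_zero_of_natDegree_lt (h.trans_le (le_max_left _ _))
  · have : degree A = A.denom.natDegree := max_eq_right (not_lt.mp h)
    rw [if_neg h, this, if_neg (by rw [coeff_natDegree, A.monic_denom]; exact one_ne_zero)]
    rfl

theorem continuous_toSphere (A : RatFunc ℂ) : Continuous (toSphere A) := by
  rw [continuous_iff_continuousAt]
  intro p
  induction p using OnePoint.rec with
  | infty =>
    rw [OnePoint.continuousAt_infty', Filter.coclosedCompact_eq_cocompact,
      ← Metric.cobounded_eq_cocompact, toSphere_infty_eq_reflect]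
    have hc : ContinuousAt
        (sphereVal (A.num.reflect (degree A)) (A.denom.reflect (degree A))) 0 := by
      refine continuousAt_sphereVal ?_ ?_
      · rw [Ne, reflect_eq_zero_iff]; exact A.denom_ne_zero
      · rw [eval_zero_reflect, eval_zero_reflect]
        intro h1 h2
        rcases max_choice A.num.natDegree A.denom.natDegree with h | h
        · rw [degree, h, coeff_natDegree, leadingCoeff_eq_zero] at h2
          rw [degree, h, h2, natDegree_zero] at h1
          have : A.denom.natDegree = 0 := by
            have := h ▸ le_max_right A.num.natDegree A.denom.natDegree
            rw [h2, natDegree_zero] at this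
            omega
          rw [← this, coeff_natDegree, A.monic_denom] at h1
          exact one_ne_zero h1
        · rw [degree, h, coeff_natDegree, A.monic_denom] at h1
          exact one_ne_zero h1
    refine (hc.tendsto.comp Filter.tendsto_inv₀_cobounded).congr' ?_
    filter_upwards [Bornology.eventually_ne_cobounded (0 : ℂ)] with z hz
    exact (toSphere_coe_eq_reflect A hz).symm
  | coe z =>
    rw [OnePoint.continuousAt_coe]
    refine continuousAt_sphereVal A.denom_ne_zero fun h1 h2 => ?_
    obtain ⟨a, b, hab⟩ := RatFunc.isCoprime_num_denom A
    have := congrArg (Polynomial.eval z) hab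
    simp [h1, h2] at this

/-- The numerator of `P(B)` over the denominator `B.denom ^ n`. -/
def homog (P : ℂ[X]) (n : ℕ) (B : RatFunc ℂ) : ℂ[X] :=
  ∑ i ∈ Finset.range (n + 1), C (P.coeff i) * B.num ^ i * B.denom ^ (n - i)

theorem algebraMap_homog {P : ℂ[X]} {n : ℕ} (h : P.natDegree ≤ n) (B : RatFunc ℂ) :
    algebraMap ℂ[X] (RatFunc ℂ) (homog P n B) = algebraMap _ _ B.denom ^ n * aeval B P := by
  rw [aeval_eq_sum_range' (Nat.lt_succ_of_le h), homog, map_sum, Finset.mul_sum]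
  refine Finset.sum_congr rfl fun i hi => ?_
  have hi : i ≤ n := Nat.lt_succ_iff.mp (Finset.mem_range.mp hi)
  have hB : algebraMap ℂ[X] (RatFunc ℂ) B.num = B * algebraMap _ _ B.denom := by
    rw [← div_eq_iff (RatFunc.algebraMap_ne_zero B.denom_ne_zero), RatFunc.num_div_denom]
  have hpow : (algebraMap ℂ[X] (RatFunc ℂ) B.denom) ^ n =
      algebraMap ℂ[X] (RatFunc ℂ) B.denom ^ i * algebraMap ℂ[X] (RatFunc ℂ) B.denom ^ (n - i) := by
    rw [← pow_add, Nat.add_sub_cancel' hi]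
  rw [map_mul, map_mul, map_pow, map_pow, hB, mul_pow, hpow, Algebra.smul_def,
    RatFunc.algebraMap_C, RatFunc.algebraMap_eq_C]
  ring

theorem eval_homog {P : ℂ[X]} {n : ℕ} (h : P.natDegree ≤ n) (B : RatFunc ℂ) {z : ℂ}
    (hz : B.denom.eval z ≠ 0) :
    (homog P n B).eval z = B.denom.eval z ^ n * P.eval (B.num.eval z / B.denom.eval z) := by
  rw [eval_eq_sum_range' (Nat.lt_succ_of_le h), homog, eval_finsetSum, Finset.mul_sum]
  refine Finset.sum_congr rfl fun i hi => ?_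
  have hi : i ≤ n := Nat.lt_succ_iff.mp (Finset.mem_range.mp hi)
  have hpow : B.denom.eval z ^ n = B.denom.eval z ^ i * B.denom.eval z ^ (n - i) := by
    rw [← pow_add, Nat.add_sub_cancel' hi]
  rw [hpow, div_pow]
  simp only [eval_mul, eval_C, eval_pow]
  field_simp

/-- Both sides are continuous and agree off the zeros of one polynomial, hence on a dense set. -/
theorem toSphere_comp (A : RatFunc ℂ) {B : RatFunc ℂ} (hB : Nonconst B) :
    toSphere (comp A B) = toSphere A ∘ toSphere B := by
  classical
  set E := comp A B with hE
  set M := homog A.denom (degree A) B with hM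
  have haev : aeval B A.denom ≠ 0 :=
    (map_ne_zero_iff _ (transcendental_iff_injective.mp hB.transcendental)).mpr A.denom_ne_zero
  have hM0 : M ≠ 0 := by
    intro h
    have := algebraMap_homog (natDegree_denom_le A) B
    rw [← hM, h, map_zero] at this
    exact mul_ne_zero (pow_ne_zero _ (RatFunc.algebraMap_ne_zero B.denom_ne_zero)) haev this.symm
  have hcross : E.num * M = E.denom * homog A.num (degree A) B := by
    apply RatFunc.algebraMap_injective
    have hEd := RatFunc.algebraMap_ne_zero E.denom_ne_zero
    have e1 : algebraMap ℂ[X] (RatFunc ℂ) E.num = E * algebraMap _ _ E.denom := by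
      rw [← div_eq_iff hEd, RatFunc.num_div_denom]
    have e2 : E * aeval B A.denom = aeval B A.num := by
      rw [hE, comp_eq_div, div_mul_cancel₀ _ haev]
    rw [map_mul, map_mul, hM, algebraMap_homog (natDegree_denom_le A), algebraMap_homog (natDegree_num_le A),
      e1, ← e2]
    ring
  set g := B.denom * E.denom * M with hg
  have hg0 : g ≠ 0 := mul_ne_zero (mul_ne_zero B.denom_ne_zero E.denom_ne_zero) hM0
  have hdense : Dense (((↑) : ℂ → Sphere) '' ((g.roots.toFinset : Set ℂ)ᶜ)) :=
    OnePoint.denseRange_coe.dense_image OnePoint.continuous_coe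
      ((Finset.finite_toSet _).countable.dense_compl ℝ)
  refine Continuous.ext_on hdense (continuous_toSphere _)
    ((continuous_toSphere A).comp (continuous_toSphere B)) ?_
  rintro _ ⟨z, hz, rfl⟩
  have hgz : g.eval z ≠ 0 := by simpa [hg0] using hz
  rw [hg, eval_mul, eval_mul] at hgz
  have h1 : B.denom.eval z ≠ 0 := fun h => hgz (by rw [h]; ring)
  have h2 : E.denom.eval z ≠ 0 := fun h => hgz (by rw [h]; ring)
  have h3 : M.eval z ≠ 0 := fun h => hgz (by rw [h]; ring)
  have hc := congrArg (Polynomial.eval z) hcross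
  rw [eval_mul, eval_mul] at hc
  rw [hM, eval_homog (natDegree_denom_le A) B h1] at h3 hc
  rw [eval_homog (natDegree_num_le A) B h1] at hc
  have h4 := right_ne_zero_of_mul h3
  have h5 := left_ne_zero_of_mul h3
  rw [Function.comp_apply, toSphere_coe, toSphere_coe, sphereVal, if_neg h2, sphereVal, if_neg h1,
    toSphere_coe, sphereVal, if_neg h4]
  rw [OnePoint.coe_eq_coe, div_eq_div_iff h2 h4]
  refine mul_left_cancel₀ h5 ?_
  linear_combination hc

theorem toSphere_X : toSphere RatFunc.X = id := by
  funext p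
  induction p using OnePoint.rec with
  | infty => exact toSphere_infty (by simp)
  | coe z => simp [toSphere_coe, sphereVal]

/-- The homeomorphism of the sphere given by a function of degree one. -/
def homeoOfInverse {M N : RatFunc ℂ} (h : comp N M = RatFunc.X) : Sphere ≃ₜ Sphere where
  toFun := toSphere M
  invFun := toSphere N
  left_inv p := by
    have hn := nonconst_of_comp (h ▸ nonconst_X : Nonconst (comp N M))
    rw [← Function.comp_apply (f := toSphere N), ← toSphere_comp N hn.2, h, toSphere_X]; rfl
  right_inv p := by
    have hn := nonconst_of_comp (h ▸ nonconst_X : Nonconst (comp N M))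
    rw [← Function.comp_apply (f := toSphere M), ← toSphere_comp M hn.1, comp_eq_X_symm h,
      toSphere_X]; rfl
  continuous_toFun := continuous_toSphere M
  continuous_invFun := continuous_toSphere N

end SphereMaps

end

section

open Polynomial Topology

/-! ### Moving a critical value to infinity. -/

section Normalisation

theorem mem_regularValues_of_homeo {A A' : RatFunc ℂ} (f g : Sphere ≃ₜ Sphere)
    (h : ∀ p, toSphere A' p = f (toSphere A (g p))) (hdeg : degree A' = degree A) (w : Sphere) :
    f w ∈ regularValues A' ↔ w ∈ regularValues A := by
  have : toSphere A' ⁻¹' {f w} = g.symm '' (toSphere A ⁻¹' {w}) := by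
    ext p
    rw [g.symm.image_eq_preimage_symm]
    simp [h]
  rw [regularValues, regularValues, Set.mem_ofPred_eq, Set.mem_ofPred_eq, this, hdeg,
    Set.ncard_image_of_injective _ g.symm.injective]

theorem permEquivalent_of_homeo {A A' : RatFunc ℂ} (f g : Sphere ≃ₜ Sphere)
    (h : ∀ p, toSphere A' p = f (toSphere A (g p))) (hdeg : degree A' = degree A) {w : Sphere}
    (hw : w ∈ regularValues A) (hw' : f w ∈ regularValues A') :
    PermEquivalent (monodromyGroup A w hw) (monodromyGroup A' (f w) hw') := by
  let e : Fiber A w ≃ Fiber A' (f w) :=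
    { toFun := fun p => ⟨g.symm p.1, by rw [h, g.apply_symm_apply, p.2]⟩
      invFun := fun p => ⟨g p.1, by
        have := p.2
        rw [h] at this
        exact f.injective this⟩
      left_inv := fun p => Subtype.ext (g.apply_symm_apply p.1)
      right_inv := fun p => Subtype.ext (g.symm_apply_apply p.1) }
  have he : ∀ p, (e p).1 = g.symm p.1 := fun _ => rfl
  refine ⟨e, le_antisymm ?_ ?_⟩
  · rintro _ ⟨σ, ⟨γ, h1, h2⟩, rfl⟩
    refine ⟨γ.map f.continuous, fun τ => (mem_regularValues_of_homeo f g h hdeg _).mpr (h1 τ),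
      fun p => ?_⟩
    obtain ⟨q, rfl⟩ := e.surjective p
    obtain ⟨Γ, hΓ⟩ := h2 q
    have hend : ((e.permCongrHom.toMonoidHom σ) (e q)).1 = g.symm (σ q).1 := by
      rw [← he]
      simp
    refine ⟨(Γ.map g.symm.continuous).cast (he q) hend, fun τ => ?_⟩
    rw [Path.cast_coe, Path.map_coe, Function.comp_apply, h, g.apply_symm_apply, hΓ]; rfl
  · rintro σ ⟨γ, h1, h2⟩
    refine ⟨e.symm.permCongr σ, ?_, ?_⟩
    · refine ⟨(γ.map f.symm.continuous).cast (f.symm_apply_apply w).symm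
        (f.symm_apply_apply w).symm, fun τ => ?_, fun p => ?_⟩
      · rw [Path.cast_coe, Path.map_coe, Function.comp_apply,
          ← mem_regularValues_of_homeo f g h hdeg, f.apply_symm_apply]
        exact h1 τ
      · obtain ⟨Γ, hΓ⟩ := h2 (e p)
        have hstart : p.1 = g (e p).1 := by rw [he, g.apply_symm_apply]
        refine ⟨(Γ.map g.continuous).cast hstart rfl, fun τ => ?_⟩
        change toSphere A (g (Γ τ)) = f.symm (γ τ)
        apply f.injective
        rw [← h, hΓ, f.apply_symm_apply]
    · ext p
      simp [Equiv.permCongrHom]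

/-- A function of degree one that sends a given point to infinity. -/
theorem exists_toSphere_eq_infty (d : Sphere) :
    ∃ M N : RatFunc ℂ, comp N M = RatFunc.X ∧ toSphere M d = OnePoint.infty := by
  induction d using OnePoint.rec with
  | infty => exact ⟨RatFunc.X, RatFunc.X, by simp, by rw [toSphere_X]; rfl⟩
  | coe d =>
    let M : RatFunc ℂ := algebraMap ℂ[X] _ 1 / algebraMap _ _ (X - C d)
    have hden : M.denom = X - C d := by
      rw [RatFunc.denom_div _ (X_sub_C_ne_zero d), gcd_one_left, EuclideanDomain.div_one]
      simp
    have hnum : M.num = 1 := by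
      rw [RatFunc.num_div, gcd_one_left, EuclideanDomain.div_one, EuclideanDomain.div_one]
      simp
    have hdeg : degree M = 1 := by simp [degree, hden, hnum]
    obtain ⟨N, hN⟩ := degree_eq_one_iff.mp hdeg
    refine ⟨M, N, hN, ?_⟩
    rw [toSphere_coe, sphereVal, if_pos]
    simp [hden]

theorem natDegree_lt_of_toSphere_infty {A : RatFunc ℂ}
    (h : toSphere A OnePoint.infty = OnePoint.infty) : A.denom.natDegree < A.num.natDegree := by
  by_contra hcon
  change (if _ then _ else _) = _ at h
  rw [if_neg hcon] at h
  exact OnePoint.coe_ne_infty _ h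

/-- The Wronskian is not constant once the degree is at least two. At a zero of it, either the value
is finite and the solution is multiple, or there is a multiple pole and infinity has too few
preimages. -/
theorem exists_critical_of_natDegree_lt {A : RatFunc ℂ} (hA : 2 ≤ degree A)
    (hd : A.denom.natDegree < A.num.natDegree) : ∃ c, toSphere A c ∉ regularValues A := by
  classical
  by_contra! hreg
  set P := A.num
  set Q := A.denom
  have hdeg : degree A = P.natDegree := max_eq_left hd.le
  obtain ⟨c, hc⟩ : ∃ c, (P.derivative * Q - P * Q.derivative).IsRoot c := by
    refine IsAlgClosed.exists_root _ fun h0 => ?_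
    have h1 := coeff_wronskian_ne_zero hd A.denom_ne_zero
    exact h1 (coeff_eq_zero_of_degree_lt (by
      rw [h0]; exact_mod_cast (by omega : 0 < P.natDegree - 1 + Q.natDegree)))
  have hc' : P.derivative.eval c * Q.eval c - P.eval c * Q.derivative.eval c = 0 := by
    simpa using hc
  by_cases hQ : Q.eval c = 0
  · have hP : P.eval c ≠ 0 := by
      intro hP
      obtain ⟨a, b, hab⟩ := RatFunc.isCoprime_num_denom A
      have := congrArg (Polynomial.eval c) hab
      simp [P, Q] at hP hQ
      simp [hP, hQ] at this
    have hQ' : Q.derivative.eval c = 0 := by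
      rw [hQ, mul_zero, zero_sub, neg_eq_zero, mul_eq_zero] at hc'
      exact hc'.resolve_left hP
    have hmult : 1 < Q.rootMultiplicity c :=
      (one_lt_rootMultiplicity_iff_isRoot A.denom_ne_zero).mpr ⟨hQ, hQ'⟩
    have hlt : Q.roots.toFinset.card < Q.roots.card := by
      refine lt_of_le_of_ne (Multiset.toFinset_card_le _) fun h => ?_
      have := Multiset.nodup_iff_count_le_one.mp
        (Multiset.toFinset_card_eq_card_iff_nodup.mp h) c
      rw [count_roots] at this
      omega
    have hinf := hreg OnePoint.infty
    rw [toSphere_infty hd, regularValues, Set.mem_ofPred_eq, hdeg] at hinf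
    have hsub : toSphere A ⁻¹' {OnePoint.infty} ⊆
        insert OnePoint.infty (((↑) : ℂ → Sphere) '' (Q.roots.toFinset : Set ℂ)) := by
      intro p hp
      induction p using OnePoint.rec with
      | infty => exact Set.mem_insert _ _
      | coe z =>
        refine Set.mem_insert_of_mem _ ⟨z, ?_, rfl⟩
        have hz : sphereVal P Q z = OnePoint.infty := hp
        have : Q.eval z = 0 := by
          by_contra h
          rw [sphereVal, if_neg h] at hz
          exact OnePoint.coe_ne_infty _ hz
        simpa [A.denom_ne_zero, Q] using this
    have h1 := Set.ncard_le_ncard hsub (((Finset.finite_toSet _).image _).insert _)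
    have h2 := (Set.ncard_insert_le OnePoint.infty
      (((↑) : ℂ → Sphere) '' (Q.roots.toFinset : Set ℂ)))
    rw [Set.ncard_image_of_injective _ OnePoint.coe_injective, Set.ncard_coe_finset] at h2
    have h3 := card_roots' Q
    omega
  · have hval : toSphere A (c : Sphere) = ((P.eval c / Q.eval c : ℂ) : Sphere) := by
      rw [toSphere_coe, sphereVal, if_neg hQ]
    have h1 := hreg (c : Sphere)
    rw [hval, coe_mem_regularValues_iff hd] at h1
    refine h1 c ?_ ?_
    · rw [eval_pencil, div_mul_cancel₀ _ hQ, sub_self]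
    · rw [eval_derivative_pencil]
      field_simp
      linear_combination hc'

theorem exists_critical {A : RatFunc ℂ} (hA : 2 ≤ degree A) :
    ∃ c, toSphere A c ∉ regularValues A := by
  obtain ⟨M, N, hNM, hM⟩ := exists_toSphere_eq_infty (toSphere A OnePoint.infty)
  have hn := nonconst_of_comp (hNM ▸ nonconst_X : Nonconst (comp N M))
  have hAn : Nonconst A := nonconst_iff_degree.mpr (by omega)
  have hM1 : degree M = 1 := degree_eq_one_iff.mpr ⟨N, hNM⟩
  have hdeg : degree (comp M A) = degree A := by rw [degree_comp hn.2 hAn, hM1, one_mul]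
  have hcomp : ∀ p, toSphere (comp M A) p = toSphere M (toSphere A p) := fun p => by
    rw [toSphere_comp M hAn]; rfl
  obtain ⟨c, hc⟩ := exists_critical_of_natDegree_lt (A := comp M A) (by omega)
    (natDegree_lt_of_toSphere_infty (by rw [hcomp, hM]))
  refine ⟨c, fun h => hc ?_⟩
  rw [hcomp]
  exact (mem_regularValues_of_homeo (homeoOfInverse hNM) (Homeomorph.refl _) hcomp hdeg _).mpr h

theorem GaloisFrame.St_comp_of_inverse {F : RatFunc ℂ} (W : GaloisFrame F) {M N U : RatFunc ℂ}
    (h : comp N M = RatFunc.X) (hU : Nonconst U) : W.St (comp M U) = W.St U := by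
  refine le_antisymm ?_ (W.St_le_comp M U)
  have := W.St_le_comp N (comp M U)
  rwa [← comp_assoc _ _ hU, h, X_comp] at this

/-- The monodromy group of `A` is the permutation group induced by the Galois group. -/
theorem GaloisFrame.permEquivalent_permRep {F : RatFunc ℂ} (W : GaloisFrame F)
    {A U D : RatFunc ℂ} (hF : Nonconst F) (h : F = comp D (comp A U)) (hA : 2 ≤ degree A)
    {w : Sphere} (hw : w ∈ regularValues A) :
    PermEquivalent (monodromyGroup A w hw) (permRep (W.St (comp A U)) (W.St U)) := by
  have hV := (nonconst_of_comp (h ▸ hF)).2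
  have hAn := (nonconst_of_comp hV).1
  have hU := (nonconst_of_comp hV).2
  obtain ⟨c, hc⟩ := exists_critical hA
  obtain ⟨M, N, hNM, hM⟩ := exists_toSphere_eq_infty (toSphere A c)
  obtain ⟨M₁, N₁, hNM₁, hM₁⟩ := exists_toSphere_eq_infty c
  have hn := nonconst_of_comp (hNM ▸ nonconst_X : Nonconst (comp N M))
  have hn₁ := nonconst_of_comp (hNM₁ ▸ nonconst_X : Nonconst (comp N₁ M₁))
  have hMN₁ := comp_eq_X_symm hNM₁
  -- A critical value of `B` is infinity, attained at infinity. The degree-one factors change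
  -- neither the stabilisers nor the monodromy group up to equivalence.
  set B := comp M (comp A N₁) with hB
  have hcomp : ∀ p, toSphere B p = homeoOfInverse hNM (toSphere A (homeoOfInverse hMN₁ p)) := by
    intro p
    rw [hB, toSphere_comp M (comp_nonconst hAn hn₁.1), toSphere_comp A hn₁.1]; rfl
  have hdeg : degree B = degree A := by
    rw [hB, degree_comp hn.2 (comp_nonconst hAn hn₁.1), degree_comp hAn hn₁.1,
      degree_eq_one_iff.mpr ⟨N, hNM⟩, degree_eq_one_iff.mpr ⟨M₁, hMN₁⟩, one_mul, mul_one]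
  have hinf : homeoOfInverse hMN₁ OnePoint.infty = c := by
    rw [← hM₁]
    exact (homeoOfInverse hNM₁).symm_apply_apply c
  have hBinf : toSphere B OnePoint.infty = OnePoint.infty := by
    rw [hcomp, hinf]; exact hM
  have hcrit : OnePoint.infty ∉ regularValues B := by
    rw [← hM]
    exact fun hcon => hc ((mem_regularValues_of_homeo (homeoOfInverse hNM) _ hcomp hdeg _).mp hcon)
  have hBU : comp B (comp M₁ U) = comp M (comp A U) := by
    rw [hB, comp_assoc _ _ (comp_nonconst hn₁.2 hU), comp_assoc _ _ (comp_nonconst hn₁.2 hU),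
      ← comp_assoc N₁ M₁ hU, hNM₁, X_comp]
  have hFB : F = comp (comp D N) (comp B (comp M₁ U)) := by
    rw [hBU, comp_assoc _ _ (comp_nonconst hn.2 hV), ← comp_assoc N M hV, hNM, X_comp, h]
  have hw' := (mem_regularValues_of_homeo (homeoOfInverse hNM) _ hcomp hdeg w).mpr hw
  refine (permEquivalent_of_homeo (homeoOfInverse hNM) _ hcomp hdeg hw hw').trans' ?_
  have := W.permEquivalent_permRep_of_normalised hF hFB (natDegree_lt_of_toSphere_infty hBinf)
    hcrit hw'
  rw [hBU, W.St_comp_of_inverse hNM hV, W.St_comp_of_inverse hNM₁ hU] at this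
  exact this

end Normalisation

end

/-! ### Lists of factors. -/

section Lists

theorem exists_equiv_of_perm {α : Type*} {l l' : List α} (h : l.Perm l') :
    ∃ σ : Fin l.length ≃ Fin l'.length, ∀ i, l.get i = l'.get (σ i) := by
  induction h with
  | nil => exact ⟨Equiv.refl _, fun i => rfl⟩
  | @cons x l l' _ ih =>
    obtain ⟨σ, hσ⟩ := ih
    refine ⟨(finSuccEquiv l.length).trans (σ.optionCongr.trans (finSuccEquiv l'.length).symm),
      fun i => ?_⟩
    refine Fin.cases ?_ (fun j => ?_) i
    · simp
    · simpa using hσ j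
  | swap x y l =>
    refine ⟨Equiv.swap (0 : Fin (l.length + 2)) 1, fun i => ?_⟩
    refine Fin.cases ?_ (fun j => Fin.cases ?_ (fun k => ?_) j) i
    · simp
    · simp
    · have h0 : k.succ.succ ≠ (0 : Fin (l.length + 2)) := Fin.succ_ne_zero _
      have h1 : k.succ.succ ≠ (1 : Fin (l.length + 2)) := by
        rw [← Fin.succ_zero_eq_one]
        exact fun h => Fin.succ_ne_zero _ (Fin.succ_injective _ h)
      have e : Equiv.swap (0 : Fin (l.length + 2)) 1 k.succ.succ = k.succ.succ :=
        Equiv.swap_apply_of_ne_of_ne h0 h1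
      exact (congrArg (x :: y :: l).get e).symm
  | trans _ _ ih₁ ih₂ =>
    obtain ⟨σ, hσ⟩ := ih₁
    obtain ⟨τ, hτ⟩ := ih₂
    exact ⟨σ.trans τ, fun i => by rw [hσ, hτ]; rfl⟩

theorem compList_append {L M : List (RatFunc ℂ)} (hM : Nonconst (compList M)) :
    compList (L ++ M) = comp (compList L) (compList M) := by
  induction L with
  | nil => simp [compList]
  | cons a L ih =>
    change comp a (compList (L ++ M)) = comp (comp a (compList L)) (compList M)
    rw [ih, comp_assoc _ _ hM]

@[simp] theorem compList_singleton (u : RatFunc ℂ) : compList [u] = u := comp_X u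

theorem compList_concat (L : List (RatFunc ℂ)) {u : RatFunc ℂ} (hu : Nonconst u) :
    compList (L ++ [u]) = comp (compList L) u := by
  rw [compList_append (by rwa [compList_singleton]), compList_singleton]

theorem nonconst_of_one_lt {A : RatFunc ℂ} (h : 1 < degree A) : Nonconst A :=
  nonconst_iff_degree.mpr (by omega)

theorem nonconst_compList {L : List (RatFunc ℂ)} (h : ∀ A ∈ L, 1 < degree A) :
    Nonconst (compList L) := by
  induction L with
  | nil => exact nonconst_X
  | cons a L ih =>
    exact comp_nonconst (nonconst_of_one_lt (h a (by simp)))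
      (ih fun A hA => h A (List.mem_cons_of_mem _ hA))

theorem eq_nil_of_degree_compList {L : List (RatFunc ℂ)} (h : ∀ A ∈ L, 1 < degree A)
    (h1 : degree (compList L) = 1) : L = [] := by
  cases L with
  | nil => rfl
  | cons a L =>
    have ha := h a (by simp)
    have hL := nonconst_compList fun A hA => h A (List.mem_cons_of_mem a hA)
    change degree (comp a (compList L)) = 1 at h1
    rw [degree_comp (nonconst_of_one_lt ha) hL] at h1
    have := Nat.eq_one_of_mul_eq_one_right h1
    omega

/-- Induction has to remove the right-most factor, because that end of a decomposition corresponds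
to the bottom of the chain of subgroups. -/
theorem IsMaximalDecomposition.concat_iff {G u : RatFunc ℂ} {L : List (RatFunc ℂ)} :
    IsMaximalDecomposition G (L ++ [u]) ↔
      ∃ G', IsMaximalDecomposition G' L ∧ Indecomposable u ∧ 1 < degree u ∧ G = comp G' u := by
  constructor
  · rintro ⟨h1, h2⟩
    have hu := h2 u (by simp)
    refine ⟨compList L, ⟨rfl, fun A hA => h2 A (by simp [hA])⟩, hu.1, hu.2, ?_⟩
    rw [← h1, compList_concat L (nonconst_of_one_lt hu.2)]
  · rintro ⟨G', ⟨h1, h2⟩, hu, hu', rfl⟩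
    refine ⟨by rw [compList_concat L (nonconst_of_one_lt hu'), h1], fun A hA => ?_⟩
    rcases List.mem_append.mp hA with h | h
    · exact h2 A h
    · rw [List.mem_singleton.mp h]; exact ⟨hu, hu'⟩

theorem Step.concat {G u : RatFunc ℂ} (hu : Indecomposable u) (hu' : 1 < degree u)
    {U V : List (RatFunc ℂ)} (h : Step G U V) : Step (comp G u) (U ++ [u]) (V ++ [u]) := by
  obtain ⟨h1, h2, L, R, A, B, C, D, rfl, rfl, h3⟩ := h
  refine ⟨IsMaximalDecomposition.concat_iff.mpr ⟨G, h1, hu, hu', rfl⟩,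
    IsMaximalDecomposition.concat_iff.mpr ⟨G, h2, hu, hu', rfl⟩, L, R ++ [u], A, B, C, D, ?_, ?_,
    h3⟩ <;> simp

theorem exists_isMaximalDecomposition (n : ℕ) : ∀ A : RatFunc ℂ, degree A = n → 1 < n →
    ∃ L, IsMaximalDecomposition A L := by
  induction n using Nat.strong_induction_on with
  | _ n ih =>
    intro A hA hn
    by_cases hind : Indecomposable A
    · refine ⟨[A], comp_X A, fun B hB => ?_⟩
      rw [List.mem_singleton.mp hB]
      exact ⟨hind, by omega⟩
    · simp only [Indecomposable, not_forall, not_or] at hind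
      obtain ⟨B, D, hBD, hB, hD⟩ := hind
      have hAn : Nonconst A := nonconst_of_one_lt (by omega)
      have hnc := nonconst_of_comp (hBD ▸ hAn)
      have hdeg : degree A = degree B * degree D := by rw [hBD, degree_comp hnc.1 hnc.2]
      have hB0 := nonconst_iff_degree.mp hnc.1
      have hD0 := nonconst_iff_degree.mp hnc.2
      obtain ⟨L, hL⟩ := ih (degree B) (by
        rw [← hA, hdeg]; exact lt_mul_of_one_lt_right (by omega) (by omega)) B rfl (by omega)
      obtain ⟨M, hM⟩ := ih (degree D) (by
        rw [← hA, hdeg]; exact lt_mul_of_one_lt_left (by omega) (by omega)) D rfl (by omega)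
      refine ⟨L ++ M, ?_, fun E hE => (List.mem_append.mp hE).elim (hL.2 E) (hM.2 E)⟩
      rw [compList_append (by rw [hM.1]; exact hnc.2), hL.1, hM.1, hBD]

end Lists

/-! ### Monodromy equivalence as equality of classes. -/

section MonodromyClasses

/-- Monodromy equivalence quantifies over all base points; transitivity needs the middle function to
have one. -/
theorem exists_mem_regularValues {A : RatFunc ℂ} (hA : Nonconst A) : ∃ w, w ∈ regularValues A := by
  obtain ⟨M, N, hNM, hM⟩ := exists_toSphere_eq_infty (toSphere A OnePoint.infty)
  have hn := nonconst_of_comp (hNM ▸ nonconst_X : Nonconst (comp N M))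
  have hdeg : degree (comp M A) = degree A := by
    rw [degree_comp hn.2 hA, degree_eq_one_iff.mpr ⟨N, hNM⟩, one_mul]
  have hcomp : ∀ p, toSphere (comp M A) p = toSphere M (toSphere A p) := fun p => by
    rw [toSphere_comp M hA]; rfl
  have hd := natDegree_lt_of_toSphere_infty (A := comp M A) (by rw [hcomp, hM])
  have hinf := (finite_compl_Reg (RatFunc.isCoprime_num_denom (comp M A)) hd).infinite_compl
  rw [compl_compl] at hinf
  obtain ⟨t, ht⟩ := hinf.nonempty
  refine ⟨(homeoOfInverse hNM).symm (t : Sphere), ?_⟩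
  rw [← mem_regularValues_of_homeo (homeoOfInverse hNM) (Homeomorph.refl _) hcomp hdeg,
    Homeomorph.apply_symm_apply]
  exact (coe_mem_regularValues_iff hd t).mpr ht

theorem MonodromyEquivalent.symm' {A B : RatFunc ℂ} (h : MonodromyEquivalent A B) :
    MonodromyEquivalent B A := fun w w' hw hw' => (h w' w hw' hw).symm'

theorem MonodromyEquivalent.trans' {A B D : RatFunc ℂ} (hB : Nonconst B)
    (h : MonodromyEquivalent A B) (h' : MonodromyEquivalent B D) : MonodromyEquivalent A D := by
  intro w w' hw hw'
  obtain ⟨v, hv⟩ := exists_mem_regularValues hB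
  exact (h w v hw hv).trans' (h' v w' hv hw')

/-- The functions whose monodromy group is equivalent to that of `A`. -/
def monodromyClass (A : RatFunc ℂ) : Set (RatFunc ℂ) := {B | MonodromyEquivalent A B}

/-- With equivalence turned into equality of classes, agreement up to order can be stated by
`List.Perm`. -/
theorem monodromyClass_eq {A B : RatFunc ℂ} (hA : Nonconst A) (hB : Nonconst B)
    (h : MonodromyEquivalent A B) : monodromyClass A = monodromyClass B :=
  Set.ext fun _ => ⟨fun h' => h.symm'.trans' hA h', fun h' => h.trans' hB h'⟩

end MonodromyClasses

/-! ### The exchange argument. -/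

namespace GaloisFrame

variable {F : RatFunc ℂ} (W : GaloisFrame F)

theorem monodromyEquivalent {A U D A' U' D' : RatFunc ℂ} (hF : Nonconst F)
    (h : F = comp D (comp A U)) (h' : F = comp D' (comp A' U')) (hA : 1 < degree A)
    (hA' : 1 < degree A')
    (he : PermEquivalent (permRep (W.St (comp A U)) (W.St U))
      (permRep (W.St (comp A' U')) (W.St U'))) : MonodromyEquivalent A A' :=
  fun _ _ hw hw' => ((W.permEquivalent_permRep hF h hA hw).trans' he).trans'
    (W.permEquivalent_permRep hF h' hA' hw').symm'

theorem monodromyEquivalent_of_St_eq {A U D A' U' D' : RatFunc ℂ} (hF : Nonconst F)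
    (h : F = comp D (comp A U)) (h' : F = comp D' (comp A' U')) (hA : 1 < degree A)
    (hA' : 1 < degree A') (hU : W.St U = W.St U') (hV : W.St (comp A U) = W.St (comp A' U')) :
    MonodromyEquivalent A A' := by
  refine W.monodromyEquivalent hF h h' hA hA' ?_
  rw [hU, hV]
  exact ⟨Equiv.refl _, Subgroup.map_id _⟩

theorem degree_eq_one_of_St_eq {A U D : RatFunc ℂ} (hF : Nonconst F)
    (h : F = comp D (comp A U)) (he : W.St (comp A U) = W.St U) : degree A = 1 := by
  rw [← W.relIndex_St hF h, he, Subgroup.relIndex_self]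

/-- An intermediate subgroup is the stabiliser of some `B ∘ U` through which `A` factors;
indecomposability makes one factor of degree one, which leaves stabilisers unchanged. -/
theorem eq_or_eq_of_indecomposable {A U D : RatFunc ℂ} (hF : Nonconst F)
    (h : F = comp D (comp A U)) (hA : Indecomposable A) (M : Subgroup W.Γ) (h1 : W.St U ≤ M)
    (h2 : M ≤ W.St (comp A U)) : M = W.St U ∨ M = W.St (comp A U) := by
  have hV := (nonconst_of_comp (h ▸ hF)).2
  have hU := (nonconst_of_comp hV).2
  have hX : W.St RatFunc.X ≤ W.St U := by simpa using W.St_le_comp U RatFunc.X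
  obtain ⟨C, E, hE, rfl⟩ := W.exists_of_subgroup M (hX.trans h1)
  have hFU : F = comp (comp D A) U := by rw [comp_assoc _ _ hU, h]
  obtain ⟨B, rfl⟩ := (W.St_le_iff (V := E) hFU).mp h1
  obtain ⟨B', hB'⟩ := (W.St_le_iff hE).mp h2
  have hAB : A = comp B' B := by
    apply comp_right_cancel hU
    rw [hB', comp_assoc _ _ hU]
  have hn := nonconst_of_comp (hAB ▸ (nonconst_of_comp hV).1)
  rcases hA B' B hAB with h3 | h3
  · right
    obtain ⟨N, hN⟩ := degree_eq_one_iff.mp h3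
    rw [hB', W.St_comp_of_inverse hN (comp_nonconst hn.2 hU)]
    rfl
  · left
    obtain ⟨N, hN⟩ := degree_eq_one_iff.mp h3
    exact W.St_comp_of_inverse hN hU

theorem indecomposable_of_maximal {A U D : RatFunc ℂ} (hF : Nonconst F)
    (h : F = comp D (comp A U))
    (hmax : ∀ M : Subgroup W.Γ, W.St U ≤ M → M ≤ W.St (comp A U) →
      M = W.St U ∨ M = W.St (comp A U)) : Indecomposable A := by
  rintro B E rfl
  have hV := (nonconst_of_comp (h ▸ hF)).2
  have hU := (nonconst_of_comp hV).2
  have e : comp (comp B E) U = comp B (comp E U) := comp_assoc _ _ hU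
  rw [e] at h hmax
  have hEU := (nonconst_of_comp (nonconst_of_comp (h ▸ hF)).2).2
  rcases hmax (W.St (comp E U)) (W.St_le_comp E U) (W.St_le_comp B _) with h1 | h1
  · right
    refine W.degree_eq_one_of_St_eq (D := comp D B) hF ?_ h1
    rw [comp_assoc _ _ hEU, h]
  · left
    exact W.degree_eq_one_of_St_eq hF h h1.symm

/-- Every subgroup containing `St z` is `St E` with `F = C ∘ E`, where `C` is either trivial or has a
maximal decomposition. -/
theorem exists_of_subgroup_isMaximalDecomposition (hF : Nonconst F) (K : Subgroup W.Γ)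
    (hK : W.St RatFunc.X ≤ K) :
    ∃ C E, F = comp C E ∧ K = W.St E ∧ ∃ L, IsMaximalDecomposition C L := by
  obtain ⟨C, E, hE, rfl⟩ := W.exists_of_subgroup K hK
  have hn := nonconst_of_comp (hE ▸ hF)
  by_cases h1 : degree C = 1
  · obtain ⟨N, hN⟩ := degree_eq_one_iff.mp h1
    refine ⟨RatFunc.X, F, (X_comp F).symm, ?_, [], rfl, by simp⟩
    have := W.St_comp_of_inverse hN hn.2
    rw [← hE] at this
    exact this.symm
  · exact ⟨C, E, hE, rfl, exists_isMaximalDecomposition _ C rfl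
      (by have := nonconst_iff_degree.mp hn.1; omega)⟩

variable {W} in
/-- Any two maximal decompositions are connected by steps, and have the same monodromy groups up to
order. -/
theorem reflTransGen_step_and_perm (hF : Nonconst F) (hgood : IsGood (W.St RatFunc.X)) (n : ℕ) :
    ∀ (R G : RatFunc ℂ) (U V : List (RatFunc ℂ)), degree G = n → F = comp G R →
      IsMaximalDecomposition G U → IsMaximalDecomposition G V →
      Relation.ReflTransGen (Step G) U V ∧
        (U.map monodromyClass).Perm (V.map monodromyClass) := by
  induction n using Nat.strong_induction_on with
  | _ n ih =>
  intro R G U V hn hFG hU hV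
  have hnc := nonconst_of_comp (hFG ▸ hF)
  have hRn := hnc.2
  rcases List.eq_nil_or_concat' U with rfl | ⟨U₀, u, rfl⟩
  · have : V = [] := eq_nil_of_degree_compList (fun A hA => (hV.2 A hA).2) (by
      rw [hV.1, ← hU.1]; exact degree_X)
    subst this
    exact ⟨.refl, .refl _⟩
  rcases List.eq_nil_or_concat' V with rfl | ⟨V₀, v, rfl⟩
  · have : U₀ ++ [u] = [] := eq_nil_of_degree_compList (fun A hA => (hU.2 A hA).2) (by
      rw [hU.1, ← hV.1]; exact degree_X)
    simp at this
  have hUmax := hU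
  have hVmax := hV
  obtain ⟨G₁, hU₀, hu, hu', hG₁⟩ := IsMaximalDecomposition.concat_iff.mp hU
  obtain ⟨G₂, hV₀, hv, hv', hG₂⟩ := IsMaximalDecomposition.concat_iff.mp hV
  have hun := nonconst_of_one_lt hu'
  have hvn := nonconst_of_one_lt hv'
  have hG₁n := (nonconst_of_comp (hG₁ ▸ hnc.1)).1
  have hG₂n := (nonconst_of_comp (hG₂ ▸ hnc.1)).1
  have hlt₁ : degree G₁ < n := by
    rw [← hn, hG₁, degree_comp hG₁n hun]
    exact lt_mul_of_one_lt_right (Nat.pos_of_ne_zero (nonconst_iff_degree.mp hG₁n)) hu'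
  have hlt₂ : degree G₂ < n := by
    rw [← hn, hG₂, degree_comp hG₂n hvn]
    exact lt_mul_of_one_lt_right (Nat.pos_of_ne_zero (nonconst_iff_degree.mp hG₂n)) hv'
  have hF₁ : F = comp G₁ (comp u R) := by rw [hFG, hG₁, comp_assoc _ _ hRn]
  have hF₂ : F = comp G₂ (comp v R) := by rw [hFG, hG₂, comp_assoc _ _ hRn]
  have huR := comp_nonconst hun hRn
  have hvR := comp_nonconst hvn hRn
  by_cases hSt : W.St (comp u R) = W.St (comp v R)
  · -- the last functions differ by a function of degree one
    obtain ⟨B, hB⟩ := (W.St_le_iff hF₁).mp hSt.le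
    have hvB : v = comp B u := by
      apply comp_right_cancel hRn
      rw [hB, comp_assoc _ _ hRn]
    have hG₁B : G₁ = comp G₂ B := by
      apply comp_right_cancel hun
      rw [comp_assoc _ _ hun, ← hvB, ← hG₁, hG₂]
    have hBn : Nonconst B := (nonconst_of_comp (hvB ▸ hvn)).1
    have hB1 : degree B = 1 := by
      refine W.degree_eq_one_of_St_eq (A := B) (U := comp u R) (D := G₂) hF ?_ ?_
      · rw [← hB, hF₂]
      · rw [← hB, hSt]
    have huv : monodromyClass u = monodromyClass v := monodromyClass_eq hun hvn
      (W.monodromyEquivalent_of_St_eq hF hF₁ hF₂ hu' hv' rfl hSt)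
    obtain ⟨N, hN1, hNB, hBN⟩ := exists_inverse hB1
    rcases List.eq_nil_or_concat' V₀ with rfl | ⟨V₁, z, rfl⟩
    -- With a single factor there is nothing to absorb `B`, but then `B` is the identity and the
    -- lists coincide.
    · have hG₂X : G₂ = RatFunc.X := hV₀.1.symm
      rw [hG₂X, X_comp] at hG₁B
      have : U₀ = [] := eq_nil_of_degree_compList (fun A hA => (hU₀.2 A hA).2)
        (by rw [hU₀.1, hG₁B, hB1])
      subst this
      have hBX : B = RatFunc.X := by rw [← hG₁B]; exact hU₀.1.symm
      rw [hBX, X_comp] at hvB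
      subst hvB
      exact ⟨.refl, .refl _⟩
    · obtain ⟨G₃, hV₁, hz, hz', hG₃⟩ := IsMaximalDecomposition.concat_iff.mp hV₀
      have hzn := nonconst_of_one_lt hz'
      have hzB : 1 < degree (comp z B) := by rwa [degree_comp hzn hBn, hB1, mul_one]
      have hzBi : Indecomposable (comp z B) := by
        intro a b hab
        have hzab : z = comp a (comp b N) := by
          have hNn : Nonconst N := nonconst_iff_degree.mpr (by omega)
          rw [← comp_assoc _ _ hNn, ← hab, comp_assoc _ _ hNn, hBN, comp_X]
        have hbn := nonconst_of_comp (hab ▸ comp_nonconst hzn hBn)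
        refine (hz a _ hzab).imp_right fun h => ?_
        rwa [degree_comp hbn.2 (nonconst_iff_degree.mpr (by omega)), hN1, mul_one] at h
      have hmax : IsMaximalDecomposition G₁ (V₁ ++ [comp z B]) :=
        IsMaximalDecomposition.concat_iff.mpr ⟨G₃, hV₁, hzBi, hzB, by
          rw [hG₁B, hG₃, comp_assoc _ _ hBn]⟩
      -- The function `B` is absorbed by the preceding factor `z`; a final step then trades the pair
      -- `z ∘ B`, `u` for `z`, `v`.
      obtain ⟨hs, hp⟩ := ih _ hlt₁ (comp u R) G₁ U₀ (V₁ ++ [comp z B]) rfl hF₁ hU₀ hmax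
      have hzz : monodromyClass (comp z B) = monodromyClass z := by
        have e1 : comp (comp z B) (comp u R) = comp z (comp v R) := by
          rw [comp_assoc _ _ huR, ← hB]
        have e2 : F = comp G₃ (comp z (comp v R)) := by rw [hF₂, hG₃, comp_assoc _ _ hvR]
        exact monodromyClass_eq (comp_nonconst hzn hBn) hzn
          (W.monodromyEquivalent_of_St_eq hF (by rw [e1]; exact e2) e2 hzB hz' hSt (by rw [e1]))
      constructor
      · have hlift := Relation.ReflTransGen.lift (p := Step G) (· ++ [u])
          (fun a b hab => by rw [hG₁]; exact Step.concat hu hu' hab) _ _ hs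
        refine hlift.tail ⟨?_, hVmax, V₁, [], comp z B, u, z, v, by simp, by simp, ?_⟩
        · rw [hG₁]
          exact IsMaximalDecomposition.concat_iff.mpr ⟨G₁, hmax, hu, hu', rfl⟩
        · rw [comp_assoc _ _ hun, ← hvB]
      · rw [List.map_append, List.map_append]
        refine (hp.append_right _).trans ?_
        simp [hzz, huv]
  · -- the last functions are exchanged
    have hXR : W.St RatFunc.X ≤ W.St R := by simpa using W.St_le_comp R RatFunc.X
    have hgR := hgood.mono hXR
    have hA := W.St_le_comp u R
    have hB := W.St_le_comp v R
    have maxA := W.eq_or_eq_of_indecomposable hF hF₁ hu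
    have maxB := W.eq_or_eq_of_indecomposable hF hF₂ hv
    have hneA : W.St R ≠ W.St (comp u R) := fun h => by
      have := W.degree_eq_one_of_St_eq hF hF₁ h.symm
      omega
    have hneB : W.St R ≠ W.St (comp v R) := fun h => by
      have := W.degree_eq_one_of_St_eq hF hF₂ h.symm
      omega
    have hnle : ¬ W.St (comp u R) ≤ W.St (comp v R) := fun h =>
      (maxB _ hA h).elim (fun h => hneA h.symm) hSt
    have hnle' : ¬ W.St (comp v R) ≤ W.St (comp u R) := fun h =>
      (maxA _ hB h).elim (fun h => hneB h.symm) fun h => hSt h.symm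
    have hinf : W.St (comp u R) ⊓ W.St (comp v R) = W.St R :=
      (maxA _ (le_inf hA hB) inf_le_left).resolve_right fun h => hnle (inf_eq_left.mp h)
    have hinf' : W.St (comp v R) ⊓ W.St (comp u R) = W.St R := by rw [inf_comm, hinf]
    -- The join of the two stabilisers belongs to a function `E` of both `u ∘ R` and `v ∘ R`, giving
    -- the square `P ∘ u = Q ∘ v` and a common left part `l`.
    obtain ⟨D, E, hFE, hK, l, hl⟩ := W.exists_of_subgroup_isMaximalDecomposition hF
      (W.St (comp u R) ⊔ W.St (comp v R)) (hXR.trans (hA.trans le_sup_left))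
    obtain ⟨P, hP⟩ := (W.St_le_iff (V := E) hF₁).mp (le_sup_left.trans hK.le)
    obtain ⟨Q, hQ⟩ := (W.St_le_iff (V := E) hF₂).mp (le_sup_right.trans hK.le)
    have hPQ : comp P u = comp Q v := by
      apply comp_right_cancel hRn
      rw [comp_assoc _ _ hRn, comp_assoc _ _ hRn, ← hP, ← hQ]
    have hFP : F = comp D (comp P (comp u R)) := by rw [← hP]; exact hFE
    have hFQ : F = comp D (comp Q (comp v R)) := by rw [← hQ]; exact hFE
    have hKP : W.St (comp P (comp u R)) = W.St (comp u R) ⊔ W.St (comp v R) := by rw [← hP, hK]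
    have hKQ : W.St (comp Q (comp v R)) = W.St (comp v R) ⊔ W.St (comp u R) := by
      rw [← hQ, sup_comm, hK]
    have hPn := (nonconst_of_comp (nonconst_of_comp (hFP ▸ hF)).2).1
    have hQn := (nonconst_of_comp (nonconst_of_comp (hFQ ▸ hF)).2).1
    have hPi : Indecomposable P := W.indecomposable_of_maximal hF hFP (by
      rw [hKP]
      exact maximal_sup_of_permute (fun a ha b hb => hgR.exists_mul_eq_mul hA hB ha hb) hA hB maxB)
    have hQi : Indecomposable Q := W.indecomposable_of_maximal hF hFQ (by
      rw [hKQ]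
      exact maximal_sup_of_permute (fun a ha b hb => hgR.exists_mul_eq_mul hB hA ha hb) hB hA maxA)
    have hP1 : 1 < degree P := by
      have h0 := nonconst_iff_degree.mp hPn
      have h1 : degree P ≠ 1 := fun h => by
        obtain ⟨N, hN⟩ := degree_eq_one_iff.mp h
        rw [W.St_comp_of_inverse hN huR] at hKP
        exact hnle' (le_sup_right.trans hKP.ge)
      omega
    have hQ1 : 1 < degree Q := by
      have h0 := nonconst_iff_degree.mp hQn
      have h1 : degree Q ≠ 1 := fun h => by
        obtain ⟨N, hN⟩ := degree_eq_one_iff.mp h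
        rw [W.St_comp_of_inverse hN hvR] at hKQ
        exact hnle (le_sup_right.trans hKQ.ge)
      omega
    have hDP : G₁ = comp D P := by
      apply comp_right_cancel huR
      rw [← hF₁, comp_assoc _ _ huR, ← hFP]
    have hDQ : G₂ = comp D Q := by
      apply comp_right_cancel hvR
      rw [← hF₂, comp_assoc _ _ hvR, ← hFQ]
    have hmaxP : IsMaximalDecomposition G₁ (l ++ [P]) :=
      IsMaximalDecomposition.concat_iff.mpr ⟨D, hl, hPi, hP1, hDP⟩
    have hmaxQ : IsMaximalDecomposition G₂ (l ++ [Q]) :=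
      IsMaximalDecomposition.concat_iff.mpr ⟨D, hl, hQi, hQ1, hDQ⟩
    obtain ⟨hs₁, hp₁⟩ := ih _ hlt₁ (comp u R) G₁ U₀ (l ++ [P]) rfl hF₁ hU₀ hmaxP
    obtain ⟨hs₂, hp₂⟩ := ih _ hlt₂ (comp v R) G₂ (l ++ [Q]) V₀ rfl hF₂ hmaxQ hV₀
    -- Opposite sides of the square match: `P` with `v`, and `Q` with `u`. So the step only
    -- interchanges two classes.
    have hPv : monodromyClass P = monodromyClass v := monodromyClass_eq hPn hvn
      (W.monodromyEquivalent hF hFP hF₂ hP1 hv' (by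
        rw [hKP]; exact hgR.permEquivalent_permRep hA hB hinf hneA maxA))
    have hQu : monodromyClass Q = monodromyClass u := monodromyClass_eq hQn hun
      (W.monodromyEquivalent hF hFQ hF₁ hQ1 hu' (by
        rw [hKQ]; exact hgR.permEquivalent_permRep hB hA hinf' hneB maxB))
    constructor
    · have hlift₁ := Relation.ReflTransGen.lift (p := Step G) (· ++ [u])
        (fun a b hab => by rw [hG₁]; exact Step.concat hu hu' hab) _ _ hs₁
      have hlift₂ := Relation.ReflTransGen.lift (p := Step G) (· ++ [v])
        (fun a b hab => by rw [hG₂]; exact Step.concat hv hv' hab) _ _ hs₂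
      refine (hlift₁.tail ⟨?_, ?_, l, [], P, u, Q, v, by simp, by simp, hPQ⟩).trans hlift₂
      · rw [hG₁]
        exact IsMaximalDecomposition.concat_iff.mpr ⟨G₁, hmaxP, hu, hu', rfl⟩
      · rw [hG₂]
        exact IsMaximalDecomposition.concat_iff.mpr ⟨G₂, hmaxQ, hv, hv', rfl⟩
    · rw [List.map_append, List.map_append]
      refine ((hp₁.append_right _).trans ?_).trans (hp₂.append_right _)
      simp only [List.map_append, List.append_assoc, List.map_cons, List.map_nil, hPv, hQu]
      exact List.Perm.append_left _ (List.Perm.swap _ _ _)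

/-- Reflexivity has content, namely independence of the base point; it holds since the group at
every base point is equivalent to the same Galois action. -/
theorem self_mem_monodromyClass {R G : RatFunc ℂ} {U : List (RatFunc ℂ)} (hF : Nonconst F)
    (hFG : F = comp G R) (hU : IsMaximalDecomposition G U) :
    ∀ A ∈ U, A ∈ monodromyClass A := by
  induction U using List.reverseRecOn generalizing R G with
  | nil => simp
  | append_singleton U u ih =>
    obtain ⟨G', h1, -, h3, rfl⟩ := IsMaximalDecomposition.concat_iff.mp hU
    have hR := (nonconst_of_comp (hFG ▸ hF)).2
    have hF' : F = comp G' (comp u R) := by rw [hFG, comp_assoc _ _ hR]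
    intro A hA
    rcases List.mem_append.mp hA with h | h
    · exact ih hF' h1 A h
    · rw [List.mem_singleton.mp h]
      exact (normalFrame hF).monodromyEquivalent_of_St_eq hF hF' hF' h3 h3 rfl rfl

/-- The conclusion for functions with a good cyclic group. -/
theorem weaklyEquivalent_and_monodromyEquivalent (hF : Nonconst F)
    (hgood : IsGood (W.St RatFunc.X)) {U V : List (RatFunc ℂ)}
    (hU : IsMaximalDecomposition F U) (hV : IsMaximalDecomposition F V) :
    WeaklyEquivalent F U V ∧ U.length = V.length ∧
      ∃ σ : Fin U.length ≃ Fin V.length, ∀ i, MonodromyEquivalent (U.get i) (V.get (σ i)) := by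
  obtain ⟨hs, hp⟩ := reflTransGen_step_and_perm hF hgood _ RatFunc.X F U V rfl (comp_X F).symm hU hV
  refine ⟨⟨V, hs, rfl, fun _ => RatFunc.X, rfl, rfl, fun _ => degree_X, fun i hi => by simp⟩,
    by simpa using hp.length_eq, ?_⟩
  obtain ⟨σ, hσ⟩ := exists_equiv_of_perm hp
  refine ⟨(finCongr (List.length_map _).symm).trans (σ.trans (finCongr (List.length_map _))),
    fun i => ?_⟩
  have h1 := hσ (finCongr (List.length_map _).symm i)
  have hmem := self_mem_monodromyClass hF (comp_X F).symm hV
    (V.get (((finCongr (List.length_map _).symm).trans (σ.trans (finCongr (List.length_map _)))) i))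
    (List.get_mem _ _)
  have h2 : monodromyClass (U.get i) = monodromyClass (V.get
      (((finCongr (List.length_map _).symm).trans (σ.trans (finCongr (List.length_map _)))) i)) := by
    simpa using h1
  rw [← h2] at hmem
  exact hmem

end GaloisFrame

section

open Polynomial

/-! ### Goodness from an automorphism of a larger field. -/

namespace GaloisFrame

variable {F : RatFunc ℂ} (W : GaloisFrame F)

/-- If an automorphism of a larger field splits the solutions of `F(x) = v` into two orbits of
different lengths, then the Galois group is good. -/
theorem isGood_of_orbits (hF : Nonconst F) {Ω : Type} [Field Ω] [Algebra ℂ Ω] (σ : Ω ≃ₐ[ℂ] Ω)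
    (j : W.L →ₐ[ℂ] Ω) (h : W.Γ) (hj : ∀ l, j (h • l) = σ (j l)) {v x y : Ω}
    (hv : v = j (W.ι F)) (hx : j (W.ι RatFunc.X) = x) (hy : (fiberPoly F v).eval y = 0)
    {p q : ℕ} (hp : 0 < p) (hpq : p < q) (hdeg : degree F = p + q)
    (hxp : ∀ i, 0 < i → i < p → (σ ^ i) x ≠ x) (hyq : ∀ i, 0 < i → i < q → (σ ^ i) y ≠ y)
    (hxy : ∀ i : ℕ, (σ ^ i) y ≠ x) : IsGood (W.St RatFunc.X) := by
  classical
  have hjpow : ∀ (i : ℕ) l, j (h ^ i • l) = (σ ^ i) (j l) := by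
    intro i
    induction i with
    | zero => intro l; simp
    | succ i ih => intro l; rw [pow_succ, mul_smul, ih, hj, pow_succ, AlgEquiv.mul_apply]
  have hjinj : Function.Injective j := j.injective
  have hinjσ : ∀ i : ℕ, Function.Injective (σ ^ i : Ω ≃ₐ[ℂ] Ω) := fun i => (σ ^ i).injective
  have hσv : σ v = v := by rw [hv, ← hj, W.smul_base]
  have hroot : ∀ g : W.Γ, (fiberPoly F v).eval (j (g • W.ι RatFunc.X)) = 0 := by
    intro g
    have h1 := eval_fiberPoly_smul (W := W) (A := F) (U := RatFunc.X) nonconst_X (g := g)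
      (by rw [comp_X, W.St_base]; trivial)
    rw [comp_X, eval_fiberPoly] at h1
    rw [eval_fiberPoly, hv, aeval_algHom_apply, aeval_algHom_apply, ← map_mul, ← map_sub, h1,
      map_zero]
  have hσroot : ∀ z, (fiberPoly F v).eval z = 0 → (fiberPoly F v).eval (σ z) = 0 := by
    intro z hz
    rw [eval_fiberPoly] at hz ⊢
    have := congrArg σ hz
    rw [map_sub, map_mul, hσv, map_zero] at this
    have e : ∀ r : ℂ[X], aeval (σ z) r = σ (aeval z r) := fun r =>
      aeval_algHom_apply (σ : Ω →ₐ[ℂ] Ω) z r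
    rw [← this, e, e]
  have hσroots : ∀ (i : ℕ) z, (fiberPoly F v).eval z = 0 →
      (fiberPoly F v).eval ((σ ^ i) z) = 0 := by
    intro i
    induction i with
    | zero => intro z hz; simpa using hz
    | succ i ih =>
      intro z hz
      rw [pow_succ', AlgEquiv.mul_apply]
      exact hσroot _ (ih z hz)
  have hxroot : (fiberPoly F v).eval x = 0 := by
    have := hroot 1
    rwa [one_smul, hx] at this
  have hne0 : fiberPoly F v ≠ 0 := by
    intro h0
    have h2 := congrArg (fun p => coeff p F.denom.natDegree) h0
    simp only [fiberPoly, coeff_sub, coeff_map, coeff_C_mul, coeff_zero, sub_eq_zero] at h2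
    have h1 : F.denom.coeff F.denom.natDegree = 1 := F.monic_denom
    rw [h1, map_one, mul_one, hv, ← j.commutes, ← W.ι.commutes] at h2
    exact hF ⟨_, (W.ι.injective (hjinj h2)).symm⟩
  set Z := (fiberPoly F v).roots.toFinset with hZ
  have hmemZ : ∀ z, z ∈ Z ↔ (fiberPoly F v).eval z = 0 := fun z => by
    rw [hZ, Multiset.mem_toFinset, mem_roots hne0]; rfl
  have hcardZ : Z.card ≤ p + q := by
    rw [← hdeg]
    exact (Multiset.toFinset_card_le _).trans ((card_roots' _).trans (natDegree_fiberPoly_le _ _))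
  have hinj : ∀ (z : Ω) (n : ℕ), (∀ i, 0 < i → i < n → (σ ^ i) z ≠ z) →
      Set.InjOn (fun i : ℕ => (σ ^ i) z) (Finset.range n) := by
    intro z n hn
    have key : ∀ i k, i < k → k < n → (σ ^ i) z ≠ (σ ^ k) z := by
      intro i k hik hk he
      refine hn (k - i) (by omega) (by omega) (hinjσ i ?_)
      rw [← AlgEquiv.mul_apply, ← pow_add, Nat.add_sub_cancel' hik.le, he]
    intro i hi k hk he
    rcases lt_trichotomy i k with hlt | rfl | hlt
    · exact absurd he (key i k hlt (Finset.mem_range.mp hk))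
    · rfl
    · exact absurd he.symm (key k i hlt (Finset.mem_range.mp hi))
  set X₁ := (Finset.range p).image fun i : ℕ => (σ ^ i) x
  set Y₁ := (Finset.range q).image fun i : ℕ => (σ ^ i) y
  have hX₁ : X₁.card = p := by
    rw [Finset.card_image_of_injOn (hinj x p hxp), Finset.card_range]
  have hY₁ : Y₁.card = q := by
    rw [Finset.card_image_of_injOn (hinj y q hyq), Finset.card_range]
  -- Negative powers are avoided: `h` has finite order, so some power `m ≥ k` of `σ` fixes `x`.
  have hdisj' : ∀ i k : ℕ, (σ ^ i) y ≠ (σ ^ k) x := by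
    intro i k he
    have hord : ∃ m : ℕ, h ^ m = 1 ∧ k ≤ m := by
      refine ⟨orderOf h * k, by rw [pow_mul, pow_orderOf_eq_one, one_pow], ?_⟩
      exact Nat.le_mul_of_pos_left k (orderOf_pos h)
    obtain ⟨m, hm, hkm⟩ := hord
    refine hxy ((m - k) + i) ?_
    rw [pow_add, AlgEquiv.mul_apply, he, ← AlgEquiv.mul_apply, ← pow_add,
      Nat.sub_add_cancel hkm, ← hx, ← hjpow, hm, one_smul]
  have hdisj : Disjoint X₁ Y₁ := by
    rw [Finset.disjoint_left]
    intro z hz hz'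
    obtain ⟨i, -, rfl⟩ := Finset.mem_image.mp hz
    obtain ⟨k, -, hk⟩ := Finset.mem_image.mp hz'
    exact hdisj' k i hk
  -- These are `p + q = degree F` distinct solutions, so they are all of them.
  have hT : X₁ ∪ Y₁ = Z := by
    refine Finset.eq_of_subset_of_card_le ?_ ?_
    · intro z hz
      rw [hmemZ]
      rcases Finset.mem_union.mp hz with hz | hz
      · obtain ⟨i, -, rfl⟩ := Finset.mem_image.mp hz
        exact hσroots i x hxroot
      · obtain ⟨i, -, rfl⟩ := Finset.mem_image.mp hz
        exact hσroots i y hy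
    · rw [Finset.card_union_of_disjoint hdisj, hX₁, hY₁]; exact hcardZ
  have hS : (j '' W.orb F RatFunc.X) = Z := by
    refine Set.eq_of_subset_of_ncard_le ?_ ?_ (Finset.finite_toSet _)
    · rintro _ ⟨_, ⟨g, rfl⟩, rfl⟩
      rw [Finset.mem_coe, hmemZ]
      exact hroot g
    · have := W.ncard_orb (A := F) (U := RatFunc.X) (D := RatFunc.X) hF (by simp)
      rw [comp_X] at this
      rw [Set.ncard_coe_finset, Set.ncard_image_of_injective _ hjinj, this, hdeg]
      exact hcardZ
  obtain ⟨t, ht⟩ : ∃ t : W.Γ, j (t • W.ι RatFunc.X) = y := by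
    have : y ∈ (j '' W.orb F RatFunc.X) := by rw [hS, Finset.mem_coe, hmemZ]; exact hy
    obtain ⟨_, ⟨g, rfl⟩, hg⟩ := this
    exact ⟨g, hg⟩
  have hSt : ∀ g : W.Γ, g ∈ W.St RatFunc.X ↔ j (g • W.ι RatFunc.X) = j (W.ι RatFunc.X) :=
    fun g => hjinj.eq_iff.symm
  have hσp : (σ ^ p) x = x := by
    have : (σ ^ p) x ∈ X₁ ∪ Y₁ := by rw [hT, hmemZ]; exact hσroots p x hxroot
    rcases Finset.mem_union.mp this with hz | hz
    · obtain ⟨i, hi, he⟩ := Finset.mem_image.mp hz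
      rw [Finset.mem_range] at hi
      have h1 : (σ ^ (p - i)) x = x := by
        refine hinjσ i ?_
        rw [← AlgEquiv.mul_apply, ← pow_add, Nat.add_sub_cancel' hi.le, he]
      rcases Nat.eq_zero_or_pos i with rfl | hi0
      · simpa using h1
      · exact absurd h1 (hxp _ (by omega) (by omega))
    · obtain ⟨i, -, he⟩ := Finset.mem_image.mp hz
      exact absurd he (hdisj' i p)
  -- The exponent `p` distinguishes the lengths: `h ^ p` fixes `z`, but moves its conjugate `t • z`
  -- because `p < q`.
  refine Or.inr ⟨h, t, ?_, ?_, p, ?_⟩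
  · intro i hi
    obtain ⟨n, hn⟩ := mem_powers_iff_mem_zpowers.mpr
      (show h ^ i ∈ Subgroup.zpowers h from ⟨_, rfl⟩)
    have hn : h ^ n = h ^ i := hn
    rw [← hn, hSt, mul_smul, hjpow, ht, hx] at hi
    exact hxy n hi
  · intro g
    have hg : j (g • W.ι RatFunc.X) ∈ X₁ ∪ Y₁ := by rw [hT, hmemZ]; exact hroot g
    rcases Finset.mem_union.mp hg with hz | hz
    · obtain ⟨i, -, he⟩ := Finset.mem_image.mp hz
      left
      refine ⟨-(i : ℤ), ?_⟩
      have he' : h ^ i • W.ι RatFunc.X = g • W.ι RatFunc.X :=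
        hjinj (by rw [hjpow, hx, he])
      rw [W.mem_St, mul_smul, ← he', zpow_neg, zpow_natCast, inv_smul_smul]
    · obtain ⟨i, -, he⟩ := Finset.mem_image.mp hz
      right
      refine ⟨-(i : ℤ), ?_⟩
      have he' : h ^ i • t • W.ι RatFunc.X = g • W.ι RatFunc.X :=
        hjinj (by rw [hjpow, ht, he])
      rw [W.mem_St, mul_smul, ← he', zpow_neg, zpow_natCast, mul_smul, inv_smul_smul, inv_smul_smul]
  · intro hiff
    have h1 : h ^ (p : ℤ) ∈ W.St RatFunc.X := by
      rw [zpow_natCast, hSt, hjpow, hx, hσp]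
    have h2 := hiff.mp h1
    rw [W.mem_St, mul_smul, mul_smul, inv_smul_eq_iff, zpow_natCast] at h2
    have h3 := congrArg j h2
    rw [hjpow, ht] at h3
    exact hyq p hp hpq h3

end GaloisFrame

/-! ### Restricting automorphisms to the normal closure. -/

section Embedding

open IntermediateField GaloisFrame

theorem exists_ringHom_of_isAlgebraic {K L Ω : Type*} [Field K] [Field L] [Field Ω] [Algebra K L]
    [Algebra.IsAlgebraic K L] [IsAlgClosed Ω] (θ : K →+* Ω) :
    ∃ j : L →+* Ω, ∀ a, j (algebraMap K L a) = θ a := by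
  let _ : Algebra K Ω := θ.toAlgebra
  let j : L →ₐ[K] Ω := IsAlgClosed.lift
  exact ⟨j, j.commutes⟩

theorem exists_algEquiv_of_fixed {K L Ω : Type*} [Field K] [Field L] [Field Ω] [Algebra K L]
    [Normal K L] (j : L →+* Ω) (σ : Ω ≃+* Ω)
    (hσ : ∀ a, σ (j (algebraMap K L a)) = j (algebraMap K L a)) :
    ∃ h : L ≃ₐ[K] L, ∀ l, j (h l) = σ (j l) := by
  let _ : Algebra L Ω := j.toAlgebra
  let _ : Algebra K Ω := (j.comp (algebraMap K L)).toAlgebra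
  have : IsScalarTower K L Ω := IsScalarTower.of_algebraMap_eq fun _ => rfl
  let σ' : Ω ≃ₐ[K] Ω := AlgEquiv.ofRingEquiv (f := σ) hσ
  exact ⟨σ'.restrictNormal L, fun l => σ'.restrictNormal_commutes L l⟩

theorem transcendental_of_fiberPoly {F : RatFunc ℂ} {Ω : Type} [Field Ω] [Algebra ℂ Ω] {v x : Ω}
    (hv : Transcendental ℂ v) (hx : (fiberPoly F v).eval x = 0) : Transcendental ℂ x := by
  intro hx'
  rw [eval_fiberPoly, sub_eq_zero] at hx
  have hd : aeval x F.denom ≠ 0 := by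
    intro h0
    obtain ⟨a, b, hab⟩ := RatFunc.isCoprime_num_denom F
    have := congrArg (aeval x) hab
    rw [h0, mul_zero] at hx
    rw [map_add, map_mul, map_mul, hx, h0, mul_zero, mul_zero, add_zero, map_one] at this
    exact zero_ne_one this
  refine hv ?_
  rw [← div_eq_iff hd] at hx
  rw [← hx]
  have hmem : ∀ r : ℂ[X], IsAlgebraic ℂ (aeval x r) := fun r => by
    have := hx'.isIntegral
    exact (IsIntegral.of_mem_of_fg _ this.fg_adjoin_singleton _ (aeval_mem_adjoin_singleton ℂ x)).isAlgebraic
  rw [div_eq_mul_inv]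
  exact (hmem _).mul (hmem _).inv

/-- Sending `z` to `x` sends `F` to `v` and extends to the normal closure. As `σ` fixes `ℂ(v)`,
normality lets it restrict to a Galois element. -/
theorem isGood_of_automorphism {F : RatFunc ℂ} (hF : Nonconst F) {Ω : Type} [Field Ω] [Algebra ℂ Ω]
    [IsAlgClosed Ω] (σ : Ω ≃ₐ[ℂ] Ω) {v x y : Ω} (hv : Transcendental ℂ v) (hσ : σ v = v)
    (hx : (fiberPoly F v).eval x = 0) (hy : (fiberPoly F v).eval y = 0) {p q : ℕ} (hp : 0 < p)
    (hpq : p < q) (hdeg : degree F = p + q)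
    (hxp : ∀ i, 0 < i → i < p → (σ ^ i) x ≠ x) (hyq : ∀ i, 0 < i → i < q → (σ ^ i) y ≠ y)
    (hxy : ∀ i : ℕ, (σ ^ i) y ≠ x) : IsGood ((normalFrame hF).St RatFunc.X) := by
  have hxt := transcendental_of_fiberPoly hv hx
  let θ : RatFunc ℂ →ₐ[ℂ] Ω := substHom x hxt
  have hθX : θ RatFunc.X = x := substHom_X x hxt
  have hθF : θ F = v := by
    rw [algHom_apply, hθX, div_eq_iff, ← sub_eq_zero, ← eval_fiberPoly, hx]
    exact (map_ne_zero_iff _ (transcendental_iff_injective.mp hxt)).mpr F.denom_ne_zero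
  have := finiteDimensional_adjoin hF
  obtain ⟨j₀, hj₀⟩ :=
    exists_ringHom_of_isAlgebraic (L := AlgebraicClosure (RatFunc ℂ)) θ.toRingHom
  let j : NormalClosure F →+* Ω :=
    j₀.comp (algebraMap (NormalClosure F) (AlgebraicClosure (RatFunc ℂ)))
  have hjι : ∀ A, j (toNormalClosure hF A) = θ A := fun A => hj₀ A
  have hjbase : ∀ A : ℂ⟮F⟯, j (algebraMap ℂ⟮F⟯ (NormalClosure F) A) = θ A := fun A => by
    rw [← hjι]
    exact congrArg j ((toNormalClosure hF).commutes A).symm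
  have hfix : ∀ A : ℂ⟮F⟯, σ (θ A) = θ A := by
    rintro ⟨A, hA⟩
    obtain ⟨B, rfl⟩ := (mem_adjoin_iff hF).mp hA
    change σ (θ (comp B F)) = θ (comp B F)
    have e : ∀ r : ℂ[X], aeval (σ v) r = σ (aeval v r) := fun r =>
      aeval_algHom_apply (σ : Ω →ₐ[ℂ] Ω) v r
    rw [algHom_comp, hθF, map_div₀, ← e, ← e, hσ]
  have := isGalois_normalClosure hF
  obtain ⟨h, hh⟩ := exists_algEquiv_of_fixed (K := ℂ⟮F⟯) j (σ : Ω ≃+* Ω) fun A => by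
    rw [hjbase]; exact hfix A
  let jC : NormalClosure F →ₐ[ℂ] Ω :=
    { j with
      commutes' := fun c => by
        have e1 : algebraMap ℂ (NormalClosure F) c =
          algebraMap ℂ⟮F⟯ (NormalClosure F) (algebraMap ℂ ℂ⟮F⟯ c) :=
            IsScalarTower.algebraMap_apply ℂ ℂ⟮F⟯ (NormalClosure F) c
        change j (algebraMap ℂ (NormalClosure F) c) = _
        rw [e1, hjbase, ← θ.commutes]
        rfl }
  exact (normalFrame hF).isGood_of_orbits hF σ jC h hh ((hjι F).trans hθF).symm
    ((hjι _).trans hθX) hy hp hpq hdeg hxp hyq hxy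

end Embedding

end

section

open Polynomial

/-! ### Local solutions as power series. -/

section Puiseux

/-- An algebraic closure of the field of formal Laurent series. -/
abbrev PuiseuxField : Type := AlgebraicClosure (FractionRing (PowerSeries ℂ))

theorem algebraMap_puiseux_injective :
    Function.Injective (algebraMap (PowerSeries ℂ) PuiseuxField) := by
  rw [IsScalarTower.algebraMap_eq (PowerSeries ℂ) (FractionRing (PowerSeries ℂ)) PuiseuxField]
  exact (algebraMap (FractionRing (PowerSeries ℂ)) PuiseuxField).injective.comp
    (IsFractionRing.injective _ _)

theorem exists_rescale_automorphism {ζ : ℂ} (hζ : ζ ≠ 0) :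
    ∃ σ : PuiseuxField ≃ₐ[ℂ] PuiseuxField, ∀ f : PowerSeries ℂ,
      σ (algebraMap _ _ f) = algebraMap _ _ (PowerSeries.rescale ζ f) := by
  let e : PowerSeries ℂ ≃+* PowerSeries ℂ :=
    RingEquiv.ofRingHom (PowerSeries.rescale ζ) (PowerSeries.rescale ζ⁻¹)
      (by ext f n; simp [PowerSeries.coeff_rescale, hζ])
      (by ext f n; simp [PowerSeries.coeff_rescale, hζ])
  let e' : FractionRing (PowerSeries ℂ) ≃+* FractionRing (PowerSeries ℂ) :=
    IsFractionRing.ringEquivOfRingEquiv e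
  let σ : PuiseuxField ≃+* PuiseuxField := IsAlgClosure.equivOfEquiv PuiseuxField PuiseuxField e'
  have hσ : ∀ f : PowerSeries ℂ,
      σ (algebraMap _ _ f) = algebraMap _ _ (PowerSeries.rescale ζ f) := by
    intro f
    rw [IsScalarTower.algebraMap_apply (PowerSeries ℂ) (FractionRing (PowerSeries ℂ)) PuiseuxField,
      IsAlgClosure.equivOfEquiv_algebraMap, IsFractionRing.ringEquivOfRingEquiv_algebraMap,
      ← IsScalarTower.algebraMap_apply]
    rfl
  refine ⟨AlgEquiv.ofRingEquiv (f := σ) fun c => ?_, hσ⟩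
  rw [IsScalarTower.algebraMap_apply ℂ (PowerSeries ℂ) PuiseuxField, hσ]
  congr 1
  ext n
  rw [PowerSeries.coeff_rescale, PowerSeries.algebraMap_apply, PowerSeries.coeff_C]
  split_ifs with h <;> simp [h]

theorem transcendental_powerSeries_X_pow {n : ℕ} (hn : 0 < n) :
    Transcendental ℂ ((PowerSeries.X : PowerSeries ℂ) ^ n) := by
  refine Transcendental.pow ?_ hn
  rw [transcendental_iff_injective]
  have : (aeval (PowerSeries.X : PowerSeries ℂ)) = coeToPowerSeries.algHom (R := ℂ) ℂ :=
    Polynomial.algHom_ext (by simp [coeToPowerSeries.algHom_apply])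
  rw [this]
  intro f g hfg
  simpa [coeToPowerSeries.algHom_apply] using hfg

/-- A solution of `τ ^ p B(τ) = s ^ (r p) A(τ)` of the form `s ^ r y`, where `y` is a unit. -/
theorem exists_puiseux {A B : ℂ[X]} (hA : A.coeff 0 ≠ 0) (hB : B.coeff 0 ≠ 0) {p r : ℕ}
    (hp : 0 < p) (hr : 0 < r) : ∃ y : PowerSeries ℂ, PowerSeries.constantCoeff y ≠ 0 ∧
      (PowerSeries.X ^ r * y) ^ p * aeval (PowerSeries.X ^ r * y) B =
        PowerSeries.X ^ (r * p) * aeval (PowerSeries.X ^ r * y) A := by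
  set N := max A.natDegree B.natDegree with hN
  have hAN : A.natDegree < N + 1 := Nat.lt_succ_of_le (le_max_left _ _)
  have hBN : B.natDegree < N + 1 := Nat.lt_succ_of_le (le_max_right _ _)
  let s : PowerSeries ℂ := PowerSeries.X ^ r
  -- The equation for `y` is rewritten for the unit `z = 1/y` and divided by `A.coeff 0`, which
  -- makes it monic as Hensel's lemma requires.
  let f : (PowerSeries ℂ)[X] := ∑ i ∈ Finset.range (N + 1),
    (C (PowerSeries.C (A.coeff i / A.coeff 0) * s ^ i) * X ^ (N - i + p) -
      C (PowerSeries.C (B.coeff i / A.coeff 0) * s ^ i) * X ^ (N - i))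
  have hs : PowerSeries.constantCoeff s = 0 := by simp [s, hr.ne']
  have hfdeg : f.natDegree ≤ N + p := by
    refine natDegree_sum_le_of_forall_le _ _ fun i _ => (natDegree_sub_le _ _).trans (max_le ?_ ?_)
    · exact (natDegree_C_mul_X_pow_le _ _).trans (by omega)
    · exact (natDegree_C_mul_X_pow_le _ _).trans (by omega)
  have hfmonic : f.Monic := by
    refine monic_of_natDegree_le_of_coeff_eq_one (N + p) hfdeg ?_
    rw [finsetSum_coeff, Finset.sum_eq_single 0]
    · simp only [coeff_sub, coeff_C_mul, coeff_X_pow]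
      rw [if_pos (by omega), if_neg (by omega)]
      simp [hA]
    · intro i hi hi0
      simp only [coeff_sub, coeff_C_mul, coeff_X_pow]
      rw [if_neg (by have := Finset.mem_range.mp hi; omega), if_neg (by omega)]
      simp
    · simp
  have hmap : f.map PowerSeries.constantCoeff =
      X ^ (N + p) - C (B.coeff 0 / A.coeff 0) * X ^ N := by
    rw [Polynomial.map_sum, Finset.sum_eq_single 0]
    · simp [hA]
    · intro i _ hi
      simp [hs, hi]
    · simp
  -- Modulo `s`, the polynomial is `z^N (z^p - B₀/A₀)`, so a nonzero root `z₀` is simple.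
  obtain ⟨z₀, hz₀⟩ := IsAlgClosed.exists_pow_nat_eq (B.coeff 0 / A.coeff 0) hp
  have hz₀0 : z₀ ≠ 0 := by
    rintro rfl
    rw [zero_pow hp.ne'] at hz₀
    exact div_ne_zero hB hA hz₀.symm
  have hcc : ∀ g : (PowerSeries ℂ)[X], PowerSeries.constantCoeff (g.eval (PowerSeries.C z₀)) =
      (g.map PowerSeries.constantCoeff).eval z₀ := by
    intro g
    rw [eval_map, ← eval₂_id, hom_eval₂, RingHom.comp_id, PowerSeries.constantCoeff_C]
  obtain ⟨z, hz, hzz⟩ := HenselianRing.is_henselian (I := Ideal.span {PowerSeries.X}) f hfmonic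
    (PowerSeries.C z₀) (by
      rw [Ideal.mem_span_singleton, PowerSeries.X_dvd_iff, hcc, hmap]
      simp only [eval_sub, eval_mul, eval_pow, eval_X, eval_C]
      rw [← hz₀]; ring) (by
      refine IsUnit.map _ ?_
      rw [PowerSeries.isUnit_iff_constantCoeff, hcc, ← derivative_map, hmap, isUnit_iff_ne_zero]
      obtain ⟨P, rfl⟩ : ∃ P, p = P + 1 := ⟨p - 1, by omega⟩
      rcases Nat.eq_zero_or_pos N with h0 | h0
      · rw [h0]
        simp only [zero_add, pow_zero, mul_one, derivative_sub, derivative_X_pow, derivative_C,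
          sub_zero, eval_mul, eval_pow, eval_X, eval_C, Nat.add_sub_cancel]
        exact mul_ne_zero (Nat.cast_ne_zero.mpr (by omega)) (pow_ne_zero _ hz₀0)
      · obtain ⟨m, hm⟩ : ∃ m, N = m + 1 := ⟨N - 1, by omega⟩
        rw [hm]
        simp only [derivative_sub, derivative_X_pow, derivative_C_mul, eval_sub,
          eval_mul, eval_pow, eval_X, eval_C, ← hz₀]
        have e1 : m + 1 + (P + 1) - 1 = m + (P + 1) := by omega
        rw [e1, Nat.add_sub_cancel, pow_add]
        have : ((m + 1 + (P + 1) : ℕ) : ℂ) * (z₀ ^ m * z₀ ^ (P + 1)) -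
            z₀ ^ (P + 1) * (((m + 1 : ℕ) : ℂ) * z₀ ^ m) =
            ((P + 1 : ℕ) : ℂ) * (z₀ ^ m * z₀ ^ (P + 1)) := by push_cast; ring
        rw [this]
        exact mul_ne_zero (Nat.cast_ne_zero.mpr (by omega))
          (mul_ne_zero (pow_ne_zero _ hz₀0) (pow_ne_zero _ hz₀0)))
  have hzc : PowerSeries.constantCoeff z = z₀ := by
    rw [Ideal.mem_span_singleton, PowerSeries.X_dvd_iff, map_sub, PowerSeries.constantCoeff_C,
      sub_eq_zero] at hzz
    exact hzz
  have hzy : z * z⁻¹ = 1 := PowerSeries.mul_inv_cancel z (by rwa [hzc])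
  set y := z⁻¹ with hy
  have hyc : PowerSeries.constantCoeff y ≠ 0 := by
    intro h0
    have := congrArg PowerSeries.constantCoeff hzy
    rw [map_mul, h0, mul_zero, map_one] at this
    exact zero_ne_one this
  refine ⟨y, hyc, ?_⟩
  have key : aeval (s * y) A = y ^ p * aeval (s * y) B := by
    have h1 : f.eval z * y ^ (N + p) * PowerSeries.C (A.coeff 0) = 0 := by
      rw [hz.eq_zero, zero_mul, zero_mul]
    have hpow : ∀ i, i ≤ N → z ^ (N - i) * y ^ N = y ^ i := by
      intro i hi
      calc z ^ (N - i) * y ^ N = z ^ (N - i) * (y ^ (N - i) * y ^ i) := by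
            rw [← pow_add, Nat.sub_add_cancel hi]
        _ = (z * y) ^ (N - i) * y ^ i := by rw [mul_pow]; ring
        _ = y ^ i := by rw [hzy, one_pow, one_mul]
    have hzp : z ^ p * y ^ p = 1 := by rw [← mul_pow, hzy, one_pow]
    rw [← sub_eq_zero, ← h1, aeval_eq_sum_range' hAN, aeval_eq_sum_range' hBN, Finset.mul_sum,
      ← Finset.sum_sub_distrib, eval_finsetSum, Finset.sum_mul, Finset.sum_mul]
    refine Finset.sum_congr rfl fun i hi => ?_
    have hiN : i ≤ N := Nat.lt_succ_iff.mp (Finset.mem_range.mp hi)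
    have hdivC : ∀ a : ℂ, PowerSeries.C (a / A.coeff 0) * PowerSeries.C (A.coeff 0) =
        PowerSeries.C a := fun a => by rw [← map_mul, div_mul_cancel₀ _ hA]
    simp only [eval_sub, eval_mul, eval_C, eval_pow, eval_X, Algebra.smul_def,
      PowerSeries.algebraMap_apply, Algebra.algebraMap_self, RingHom.id_apply]
    rw [← hdivC (A.coeff i), ← hdivC (B.coeff i), pow_add, pow_add, mul_pow, ← hpow i hiN]
    linear_combination (PowerSeries.C (A.coeff i / A.coeff 0) * PowerSeries.C (A.coeff 0) * s ^ i *
      z ^ (N - i) * y ^ N) * (- hzp)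
  change (s * y) ^ p * _ = _ * aeval (s * y) A
  rw [key, pow_mul]
  ring

end Puiseux

end

section

open Polynomial

/-! ### The two poles produce a good stabiliser. -/

section Poles

open GaloisFrame

theorem denom_eval_eq_zero_of_pole {F : RatFunc ℂ} {a : ℂ}
    (h : toSphere F (a : Sphere) = OnePoint.infty) : F.denom.eval a = 0 := by
  by_contra hne
  rw [toSphere_coe, sphereVal, if_neg hne] at h
  exact OnePoint.coe_ne_infty _ h

theorem poleOrder_pos {F : RatFunc ℂ} {a : Sphere} (h : toSphere F a = OnePoint.infty) :
    0 < poleOrder F a := by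
  induction a using OnePoint.rec with
  | infty => exact Nat.sub_pos_of_lt (natDegree_lt_of_toSphere_infty h)
  | coe a =>
    exact (rootMultiplicity_pos F.denom_ne_zero).mpr (denom_eval_eq_zero_of_pole h)

theorem degree_eq_add_poleOrder {F : RatFunc ℂ} {a b : Sphere} (hab : a ≠ b)
    (h : poles F = {a, b}) : degree F = poleOrder F a + poleOrder F b := by
  classical
  have hdeg : degree F = F.denom.natDegree + poleOrder F OnePoint.infty := by
    change max _ _ = _ + (_ - _)
    omega
  have hsum : F.denom.natDegree =
      ∑ c ∈ F.denom.roots.toFinset, F.denom.rootMultiplicity c := by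
    rw [(IsAlgClosed.splits F.denom).natDegree_eq_card_roots, ← Multiset.toFinset_sum_count_eq]
    simp only [count_roots]
  have hmem : ∀ c : ℂ, c ∈ F.denom.roots.toFinset ↔ (c : Sphere) ∈ poles F := by
    intro c
    rw [Multiset.mem_toFinset, mem_roots F.denom_ne_zero]
    refine ⟨fun h => ?_, fun h => denom_eval_eq_zero_of_pole h⟩
    change toSphere F c = _
    rw [toSphere_coe, sphereVal, if_pos (show F.denom.eval c = 0 from h)]
  have hinf : OnePoint.infty ∉ poles F → poleOrder F OnePoint.infty = 0 := by
    intro hn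
    change _ - _ = 0
    by_contra h0
    exact hn (toSphere_infty (by omega))
  rw [hdeg, hsum]
  rw [h] at hmem hinf
  induction a using OnePoint.rec with
  | infty =>
    induction b using OnePoint.rec with
    | infty => exact absurd rfl hab
    | coe b =>
      have : F.denom.roots.toFinset = {b} := by ext c; rw [hmem]; simp
      rw [this, Finset.sum_singleton, add_comm]
      rfl
  | coe a =>
    induction b using OnePoint.rec with
    | infty =>
      have : F.denom.roots.toFinset = {a} := by ext c; rw [hmem]; simp
      rw [this, Finset.sum_singleton]
      rfl
    | coe b =>
      have : F.denom.roots.toFinset = {a, b} := by ext c; rw [hmem]; simp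
      have hne : a ≠ b := fun h => hab (by rw [h])
      rw [this, Finset.sum_pair hne, hinf (by simp), add_zero]
      rfl

/-- The point with local coordinate `τ` at `a`. -/
def pointAt {Ω : Type} [Field Ω] [Algebra ℂ Ω] (a : Sphere) (τ : Ω) : Ω :=
  OnePoint.elim a τ⁻¹ fun c => algebraMap ℂ Ω c + τ

theorem pointAt_injective {Ω : Type} [Field Ω] [Algebra ℂ Ω] (a : Sphere) :
    Function.Injective (pointAt (Ω := Ω) a) := by
  induction a using OnePoint.rec with
  | infty => exact inv_injective
  | coe a => exact add_right_injective _

theorem map_pointAt {Ω : Type} [Field Ω] [Algebra ℂ Ω] (σ : Ω ≃ₐ[ℂ] Ω) (a : Sphere) (τ : Ω) :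
    σ (pointAt a τ) = pointAt a (σ τ) := by
  induction a using OnePoint.rec with
  | infty => exact map_inv₀ σ τ
  | coe a =>
    change σ (algebraMap ℂ Ω a + τ) = algebraMap ℂ Ω a + σ τ
    rw [map_add, AlgEquiv.commutes]

/-- The equation `F = 1 / s` in the local coordinate at a pole. -/
theorem exists_local_form {F : RatFunc ℂ} {a : Sphere} (h : toSphere F a = OnePoint.infty) :
    ∃ A B : ℂ[X], A.coeff 0 ≠ 0 ∧ B.coeff 0 ≠ 0 ∧
      ∀ (Ω : Type) [Field Ω] [Algebra ℂ Ω] (s τ : Ω), s ≠ 0 → τ ≠ 0 →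
        τ ^ poleOrder F a * aeval τ B = s * aeval τ A →
        (fiberPoly F s⁻¹).eval (pointAt a τ) = 0 := by
  induction a using OnePoint.rec with
  | infty =>
    have hd := natDegree_lt_of_toSphere_infty h
    have hP : F.num ≠ 0 := by intro h0; simp [h0] at hd
    -- At infinity `z = 1/τ`, and the constant terms are the leading coefficients.
    refine ⟨F.num.reverse, F.denom.reverse, ?_, ?_, ?_⟩
    · rw [coeff_zero_reverse]; exact leadingCoeff_ne_zero.mpr hP
    · rw [coeff_zero_reverse]; exact leadingCoeff_ne_zero.mpr F.denom_ne_zero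
    · intro Ω _ _ s τ hs hτ he
      have hrev : ∀ r : ℂ[X], aeval τ⁻¹ r = aeval τ r.reverse * τ⁻¹ ^ r.natDegree := by
        intro r
        have := invertibleOfNonzero (inv_ne_zero hτ)
        have h1 := eval₂_reverse_mul_pow (algebraMap ℂ Ω) τ⁻¹ r
        rw [invOf_eq_inv, inv_inv] at h1
        exact h1.symm
      rw [eval_fiberPoly]
      change aeval τ⁻¹ F.num - s⁻¹ * aeval τ⁻¹ F.denom = 0
      change τ ^ (F.num.natDegree - F.denom.natDegree) * _ = _ at he
      obtain ⟨k, hk⟩ := Nat.exists_eq_add_of_lt hd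
      have hk' : F.num.natDegree - F.denom.natDegree = k + 1 := by omega
      rw [hk'] at he
      rw [hrev, hrev, hk, add_assoc, pow_add, sub_eq_zero]
      have hmain : aeval τ F.num.reverse = s⁻¹ * (τ ^ (k + 1) * aeval τ F.denom.reverse) := by
        rw [he, inv_mul_cancel_left₀ hs]
      rw [hmain]
      have : τ ^ (k + 1) * τ⁻¹ ^ (k + 1) = 1 := by
        rw [← mul_pow, mul_inv_cancel₀ hτ, one_pow]
      linear_combination (s⁻¹ * aeval τ F.denom.reverse * τ⁻¹ ^ F.denom.natDegree) * this
  | coe a =>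
    have hQ := denom_eval_eq_zero_of_pole h
    have hP : F.num.eval a ≠ 0 := by
      intro hP
      obtain ⟨u, v, huv⟩ := RatFunc.isCoprime_num_denom F
      have := congrArg (Polynomial.eval a) huv
      simp [hP, hQ] at this
    set Q₁ := F.denom /ₘ (X - C a) ^ F.denom.rootMultiplicity a with hQ₁
    -- At a finite pole `z = a + τ`; the power of `τ` is split off the denominator.
    refine ⟨F.num.comp (X + C a), Q₁.comp (X + C a), ?_, ?_, ?_⟩
    · rw [coeff_zero_eq_eval_zero, eval_comp]; simpa using hP
    · rw [coeff_zero_eq_eval_zero, eval_comp]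
      simpa using eval_divByMonic_pow_rootMultiplicity_ne_zero a F.denom_ne_zero
    · intro Ω _ _ s τ hs hτ he
      have hcomp : ∀ r : ℂ[X], aeval τ (r.comp (X + C a)) = aeval (algebraMap ℂ Ω a + τ) r := by
        intro r
        rw [aeval_comp]
        simp [add_comm]
      rw [hcomp, hcomp] at he
      have hden : aeval (algebraMap ℂ Ω a + τ) F.denom =
          τ ^ F.denom.rootMultiplicity a * aeval (algebraMap ℂ Ω a + τ) Q₁ := by
        conv_lhs => rw [← pow_mul_divByMonic_rootMultiplicity_eq F.denom a]
        rw [map_mul, map_pow, map_sub, aeval_X, aeval_C, add_sub_cancel_left]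
      rw [eval_fiberPoly]
      change aeval (algebraMap ℂ Ω a + τ) F.num - s⁻¹ * aeval (algebraMap ℂ Ω a + τ) F.denom = 0
      change τ ^ F.denom.rootMultiplicity a * _ = _ at he
      rw [hden, he, inv_mul_cancel_left₀ hs, sub_self]

/-- At parameter zero the two points specialise to the distinct points `a` and `b`. -/
theorem pointAt_ne {a b : Sphere} (hab : a ≠ b) {f g : PowerSeries ℂ}
    (hf : PowerSeries.constantCoeff f = 0) (hg : PowerSeries.constantCoeff g = 0) (hf0 : f ≠ 0)
    (hg0 : g ≠ 0) :
    pointAt a (algebraMap (PowerSeries ℂ) PuiseuxField f) ≠ pointAt b (algebraMap _ _ g) := by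
  have hC : ∀ c : ℂ, algebraMap ℂ PuiseuxField c =
      algebraMap (PowerSeries ℂ) PuiseuxField (PowerSeries.C c) := fun c =>
    IsScalarTower.algebraMap_apply ℂ (PowerSeries ℂ) PuiseuxField c
  have hmix : ∀ (c : ℂ) (f g : PowerSeries ℂ), PowerSeries.constantCoeff g = 0 → g ≠ 0 →
      algebraMap ℂ PuiseuxField c + algebraMap _ _ f ≠
        (algebraMap (PowerSeries ℂ) PuiseuxField g)⁻¹ := by
    intro c f g hg hg0 he
    have hne : algebraMap (PowerSeries ℂ) PuiseuxField g ≠ 0 :=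
      (map_ne_zero_iff _ algebraMap_puiseux_injective).mpr hg0
    have he := congrArg (· * algebraMap (PowerSeries ℂ) PuiseuxField g) he
    rw [inv_mul_cancel₀ hne, hC, ← map_add, ← map_mul,
      ← map_one (algebraMap (PowerSeries ℂ) PuiseuxField)] at he
    have := congrArg PowerSeries.constantCoeff (algebraMap_puiseux_injective he)
    rw [map_mul, hg, mul_zero, map_one] at this
    exact zero_ne_one this
  intro he
  induction a using OnePoint.rec with
  | infty =>
    induction b using OnePoint.rec with
    | infty => exact hab rfl
    | coe b => exact hmix b g f hf hf0 he.symm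
  | coe a =>
    induction b using OnePoint.rec with
    | infty => exact hmix a f g hg hg0 he
    | coe b =>
      change algebraMap ℂ PuiseuxField a + _ = algebraMap ℂ PuiseuxField b + _ at he
      rw [hC, hC, ← map_add, ← map_add] at he
      have := congrArg PowerSeries.constantCoeff (algebraMap_puiseux_injective he)
      simp only [map_add, hf, hg, add_zero, PowerSeries.constantCoeff_C] at this
      exact hab (by rw [this])

/-- With `1/F = X ^ (p * q)`, the local coordinates of the solutions are `X ^ q` and `X ^ p` times
units. Rescaling `X` by a primitive root of unity of order `p * q` fixes `F` and multiplies the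
lowest coefficients by roots of unity of orders `p` and `q`. -/
theorem isGood_of_poleOrder_lt {F : RatFunc ℂ} (hF : Nonconst F) {a b : Sphere} (hab : a ≠ b)
    (h : poles F = {a, b}) (hlt : poleOrder F a < poleOrder F b) :
    IsGood ((normalFrame hF).St RatFunc.X) := by
  have ha : toSphere F a = OnePoint.infty := by
    change a ∈ poles F
    rw [h]; simp
  have hb : toSphere F b = OnePoint.infty := by
    change b ∈ poles F
    rw [h]; simp
  have hp := poleOrder_pos ha
  have hq := poleOrder_pos hb
  have hdeg := degree_eq_add_poleOrder hab h
  obtain ⟨A, B, hA, hB, hAB⟩ := exists_local_form ha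
  obtain ⟨A', B', hA', hB', hAB'⟩ := exists_local_form hb
  set p := poleOrder F a
  set q := poleOrder F b
  have hpq : 0 < p * q := Nat.mul_pos hp hq
  obtain ⟨y, hy, hyeq⟩ := exists_puiseux hA hB hp hq
  obtain ⟨y', hy', hyeq'⟩ := exists_puiseux hA' hB' hq hp
  have hprim := Complex.isPrimitiveRoot_exp (p * q) hpq.ne'
  set ζ := Complex.exp (2 * Real.pi * Complex.I / (p * q : ℕ)) with hζ
  have hζ0 : ζ ≠ 0 := Complex.exp_ne_zero _
  obtain ⟨σ, hσ⟩ := exists_rescale_automorphism hζ0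
  have hσpow : ∀ (i : ℕ) f, (σ ^ i) (algebraMap (PowerSeries ℂ) PuiseuxField f) =
      algebraMap _ _ (PowerSeries.rescale (ζ ^ i) f) := by
    intro i
    induction i with
    | zero => intro f; simp
    | succ i ih =>
      intro f
      rw [pow_succ, AlgEquiv.mul_apply, hσ, ih, PowerSeries.rescale_rescale, pow_succ, mul_comm]
  have hne : ∀ {r : ℕ} {f : PowerSeries ℂ}, PowerSeries.constantCoeff f ≠ 0 →
      PowerSeries.X ^ r * f ≠ 0 := fun {r f} hf =>
    mul_ne_zero (pow_ne_zero _ PowerSeries.X_ne_zero) (by rintro rfl; simp at hf)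
  have hcoeff : ∀ (r : ℕ) (f : PowerSeries ℂ), PowerSeries.coeff r (PowerSeries.X ^ r * f) =
      PowerSeries.constantCoeff f := fun r f => by
    have := PowerSeries.coeff_X_pow_mul f r 0
    rwa [zero_add, PowerSeries.coeff_zero_eq_constantCoeff_apply] at this
  have hembne : ∀ {f : PowerSeries ℂ}, f ≠ 0 → algebraMap (PowerSeries ℂ) PuiseuxField f ≠ 0 :=
    fun hf => (map_ne_zero_iff _ algebraMap_puiseux_injective).mpr hf
  set s := algebraMap (PowerSeries ℂ) PuiseuxField (PowerSeries.X ^ (p * q)) with hs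
  have hs0 : s ≠ 0 := hembne (pow_ne_zero _ PowerSeries.X_ne_zero)
  have hstr : Transcendental ℂ s := by
    rw [hs, transcendental_algebraMap_iff algebraMap_puiseux_injective]
    exact transcendental_powerSeries_X_pow hpq
  have hσs : σ s = s := by
    rw [hs, hσ, map_pow, PowerSeries.rescale_X, mul_pow, ← map_pow, hprim.pow_eq_one, map_one,
      one_mul]
  have hemb : ∀ (f : PowerSeries ℂ) (r : ℂ[X]), aeval (algebraMap (PowerSeries ℂ) PuiseuxField f) r =
      algebraMap _ _ (aeval f r) := fun f r => aeval_algebraMap_apply PuiseuxField f r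
  -- The lowest coefficient is multiplied by `ζ ^ (i * r)`, which is not one while `0 < i < m`.
  have hmove : ∀ {c : Sphere} {r m : ℕ} {f : PowerSeries ℂ}, 0 < r → r * m = p * q →
      PowerSeries.constantCoeff f ≠ 0 → ∀ i, 0 < i → i < m →
      (σ ^ i) (pointAt c (algebraMap (PowerSeries ℂ) PuiseuxField (PowerSeries.X ^ r * f))) ≠
        pointAt c (algebraMap _ _ (PowerSeries.X ^ r * f)) := by
    intro c r m f hr hrm hf i hi him he
    rw [map_pointAt, hσpow] at he
    have h1 := congrArg (PowerSeries.coeff r)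
      (algebraMap_puiseux_injective (pointAt_injective c he))
    rw [PowerSeries.coeff_rescale, hcoeff, mul_eq_right₀ hf, ← pow_mul,
      hprim.pow_eq_one_iff_dvd, ← hrm, mul_comm i r] at h1
    have := Nat.le_of_dvd hi (Nat.dvd_of_mul_dvd_mul_left hr h1)
    omega
  refine isGood_of_automorphism hF σ (v := s⁻¹)
    (x := pointAt a (algebraMap _ _ (PowerSeries.X ^ q * y)))
    (y := pointAt b (algebraMap _ _ (PowerSeries.X ^ p * y'))) (p := p) (q := q) ?_ ?_ ?_ ?_ hp hlt
    hdeg (hmove hq (mul_comm q p) hy) (hmove hp rfl hy') ?_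
  · exact fun h => hstr (by simpa using h.inv)
  · rw [map_inv₀, hσs]
  · refine hAB PuiseuxField s _ hs0 (hembne (hne hy)) ?_
    rw [hemb, hemb, hs, ← map_pow, ← map_mul, ← map_mul, hyeq, mul_comm q p]
  · refine hAB' PuiseuxField s _ hs0 (hembne (hne hy')) ?_
    rw [hemb, hemb, hs, ← map_pow, ← map_mul, ← map_mul, hyeq']
  · intro i
    rw [map_pointAt, hσpow]
    refine pointAt_ne hab.symm ?_ ?_ ?_ (hne hy)
    · rw [← PowerSeries.coeff_zero_eq_constantCoeff_apply, PowerSeries.coeff_rescale,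
        PowerSeries.coeff_zero_eq_constantCoeff_apply]
      simp [hp.ne']
    · simp [hq.ne']
    · intro h0
      have := congrArg (PowerSeries.coeff p) h0
      rw [PowerSeries.coeff_rescale, hcoeff, map_zero, mul_eq_zero] at this
      exact this.elim (pow_ne_zero _ (pow_ne_zero _ hζ0)) hy'

/-- The Galois group of a function with two poles of different orders is good. -/
theorem isGood_of_two_poles {F : RatFunc ℂ} (hF : Nonconst F) {a b : Sphere} (hab : a ≠ b)
    (h : poles F = {a, b}) (hne : poleOrder F a ≠ poleOrder F b) :
    IsGood ((normalFrame hF).St RatFunc.X) := by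
  rcases lt_or_gt_of_ne hne with hlt | hlt
  · exact isGood_of_poleOrder_lt hF hab h hlt
  · exact isGood_of_poleOrder_lt hF hab.symm (by rw [h, Set.pair_comm]) hlt

theorem nonconst_of_two_poles {F : RatFunc ℂ} {a b : Sphere} (hab : a ≠ b)
    (h : poles F = {a, b}) : Nonconst F := by
  rw [nonconst_iff_degree, degree_eq_add_poleOrder hab h]
  have : 0 < poleOrder F a := poleOrder_pos (by
    change a ∈ poles F
    rw [h]; simp)
  omega

end Poles

end

end RatDecomp

end

theorem corollary2p15 (F : RatFunc ℂ)
    (hF : ∃ a b : RatDecomp.Sphere, a ≠ b ∧ RatDecomp.poles F = {a, b} ∧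
      RatDecomp.poleOrder F a ≠ RatDecomp.poleOrder F b)
    (U V : List (RatFunc ℂ))
    (hU : RatDecomp.IsMaximalDecomposition F U) (hV : RatDecomp.IsMaximalDecomposition F V) :
    RatDecomp.WeaklyEquivalent F U V ∧
    U.length = V.length ∧
    ∃ σ : Fin U.length ≃ Fin V.length,
      ∀ i, RatDecomp.MonodromyEquivalent (U.get i) (V.get (σ i)) := by
  obtain ⟨a, b, hab, hpoles, hne⟩ := hF
  have hFn := RatDecomp.nonconst_of_two_poles hab hpoles
  exact (RatDecomp.normalFrame hFn).weaklyEquivalent_and_monodromyEquivalent hFn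
    (RatDecomp.isGood_of_two_poles hFn hab hpoles hne) hU hV
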